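/- Let $G$ be a fixed finite group. All chain complexes are non-negatively graded. A $\mathbb{Z}$-complex (resp. $\mathbb{Z}G$-complex) is a chain complex of free abelian groups (resp. of free $\mathbb{Z}G$-modules); it is locally finite if each of its terms is a finitely generated abelian group. It is locally effective if its elements are represented in a computer (in each degree there is a partial surjection from $\mathbb{N}$ onto the elements, giving their names) and there are algorithms computing, on names, zero, addition, scalar multiplication and the differential, together with a fixed homogeneous basis, with algorithms that produce the basis elements and expand a given element as a linear combination of them. A map is locally effective if an algorithm computes its values on names. A reduction $(\alpha,\beta,\eta)\colon C\Rightarrow D$ consists of chain maps $\alpha\colon C\to D$, $\beta\colon D\to C$ and a map $\eta\colon C\to C$ of degree $1$ with $\alpha\beta=\mathrm{id}$, $\partial\eta+\eta\partial=\mathrm{id}-\beta\alpha$, $\alpha\eta=0$, $\eta\beta=0$, $\eta\eta=0$. A strong equivalence $C\Leftrightarrow D$ is a span of reductions $C\Leftarrow\widetilde C\Rightarrow D$; it is locally effective if all three complexes and all maps are, and $\mathbb{Z}G$-linear if the complexes are $\mathbb{Z}G$-complexes and the maps are $\mathbb{Z}G$-linear. **Theorem.** There is an algorithm which, given (the programs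 of) a locally effective $\mathbb{Z}G$-complex $M$ and a locally effective, not necessarily equivariant, strong equivalence $M\Leftarrow\widetilde M\Rightarrow N$ with $\mathbb{Z}$-complexes $\widetilde M$ and $N$, constructs (the programs of) a $\mathbb{Z}G$-linear locally effective strong equivalence $M\Leftarrow\widetilde M'\Rightarrow N'$. If $N$ is locally finite, then so is $N'$. Moreover $N'$ is isomorphic to the following $\mathbb{Z}G$-complex $BN$. Write $(\alpha_1,\beta_1,\eta_1)\colon\widetilde M\Rightarrow M$ and $(\alpha,\beta,\eta)\colon\widetilde M\Rightarrow N$ for the given reductions. Let $g\in G$ act on $\widetilde M$ by $\rho(g)x=\beta_1(g\,\alpha_1x)+x-\beta_1\alpha_1x$, and for $m\ge1$ put $(g_1,\dots,g_m)y=\alpha\,\rho(g_1)\,\eta\,\rho(g_2)\,\eta\cdots\eta\,\rho(g_m)\,\beta y$ for $y\in N$. Then $(BN)_n=\bigoplus_{m+q=n}\mathbb{Z}G\otimes(\mathbb{Z}G)^{\otimes m}\otimes N_q$, with $\mathbb{Z}G$ acting on the first factor, and for $g_0,\dots,g_m\in G$ the differential is $$\partial(g_0|\cdots|g_m\otimes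 y)=(-1)^m g_0|\cdots|g_m\otimes\partial y+\sum_{k=1}^m(-1)^{k-1}g_0|\cdots|g_{k-1}g_k|\cdots|g_m\otimes y+\sum_{k=1}^m(-1)^k g_0|\cdots|g_{k-1}\otimes(g_k,\dots,g_m)y.$$ -/

import Mathlib

open CategoryTheory
open scoped TensorProduct DirectSum

universe u

/-! ### Reductions of chain complexes -/

/-- A reduction (strong deformation retraction) `(proj, incl, htpy) : C ⇒ D`. In composition order
`≫`, the homotopy operator satisfies `𝟙 - proj ≫ incl = ∂ htpy + htpy ∂`. -/
structure Reduction {V : Type*} [Category V] [Preadditive V] (C D : ChainComplex V ℕ) where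
  proj : C ⟶ D
  incl : D ⟶ C
  htpy : Homotopy (𝟙 C) (proj ≫ incl)
  incl_proj : incl ≫ proj = 𝟙 D
  htpy_proj : ∀ n, htpy.hom n (n + 1) ≫ proj.f (n + 1) = 0
  incl_htpy : ∀ n, incl.f n ≫ htpy.hom n (n + 1) = 0
  htpy_htpy : ∀ n, htpy.hom n (n + 1) ≫ htpy.hom (n + 1) (n + 2) = 0

/-- A complex is locally finite if it consists of finitely generated abelian groups. -/
def LocallyFiniteComplex {R : Type*} [Ring R] (X : ChainComplex (ModuleCat.{u} R) ℕ) : Prop :=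
  ∀ n, AddGroup.FG (X.X n)

/-- The underlying complex of abelian groups of a complex of `ℤ[G]`-modules. -/
noncomputable abbrev underlying (G : Type u) [Group G]
    (M : ChainComplex (ModuleCat.{u} (MonoidAlgebra ℤ G)) ℕ) : ChainComplex (ModuleCat.{u} ℤ) ℕ :=
  ((ModuleCat.restrictScalars (Int.castRingHom (MonoidAlgebra ℤ G))).mapHomologicalComplex
    (ComplexShape.down ℕ)).obj M

/-! ### Representing elements in a computer -/

/-- A (partial) numbering of `X`: some natural numbers are names of elements of `X`, and every
element has at least one name. -/
structure Naming (X : Type*) where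
  val : ℕ →. X
  surj : ∀ x, ∃ a, x ∈ val a

namespace Naming

/-- Names of pairs are pairs of names. -/
def prod {X Y : Type*} (ν : Naming X) (μ : Naming Y) : Naming (X × Y) where
  val a := (ν.val a.unpair.1).bind fun x => (μ.val a.unpair.2).map fun y => (x, y)
  surj := by
    rintro ⟨x, y⟩
    obtain ⟨a, ha⟩ := ν.surj x
    obtain ⟨b, hb⟩ := μ.surj y
    refine ⟨Nat.pair a b, ?_⟩
    simp only [Nat.unpair_pair, Part.mem_bind_iff, Part.mem_map_iff]
    exact ⟨x, ha, y, hb, rfl⟩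

/-- The standard numbering of the integers. -/
def int : Naming ℤ where
  val a := ((Encodable.decode a : Option ℤ) : Part ℤ)
  surj x := ⟨Encodable.encode x, by rw [Encodable.encodek]; simp⟩

/-- The standard numbering of the group ring: its elements are given by lists of pairs `(z, g)`,
standing for the sum of the `z g`. -/
noncomputable def groupRing (G : Type u) [Group G] [Encodable G] :
    Naming (MonoidAlgebra ℤ G) where
  val a := (((Encodable.decode a : Option (List (ℤ × G))) : Part (List (ℤ × G))).map
    fun l => (l.map fun p => MonoidAlgebra.single p.2 p.1).sum)
  surj x := by
    suffices h : ∃ l : List (ℤ × G), (l.map fun p => MonoidAlgebra.single p.2 p.1).sum = x by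
      obtain ⟨l, hl⟩ := h
      exact ⟨Encodable.encode l, by simp [hl]⟩
    induction x using MonoidAlgebra.induction_linear with
    | zero => exact ⟨[], rfl⟩
    | add f g hf hg =>
      obtain ⟨l, rfl⟩ := hf
      obtain ⟨m, rfl⟩ := hg
      exact ⟨l ++ m, by simp⟩
    | single g z => exact ⟨[(z, g)], by simp⟩

end Naming

/-- The program `c` computes the family of maps `f n : X n → Y n`: on the degree `n` and any name
of `x : X n` it halts with a name of `f n x`. -/
def Computes (c : Nat.Partrec.Code) {X Y : ℕ → Type*} (ν : ∀ n, Naming (X n))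
    (μ : ∀ n, Naming (Y n)) (f : ∀ n, X n → Y n) : Prop :=
  ∀ n a x, x ∈ (ν n).val a → ∃ b ∈ c.eval (Nat.pair n a), f n x ∈ (μ n).val b

/-! ### Locally effective complexes of free modules -/

/-- A complex of free `R`-modules whose elements have names, with a chosen homogeneous basis whose
members are labelled by natural numbers (`label n` is the set of labels in degree `n`). -/
structure EffStructure {R : Type*} [Ring R] (X : ChainComplex (ModuleCat.{u} R) ℕ) where
  name : ∀ n, Naming (X.X n)
  label : ℕ → Set ℕ
  basis : ∀ n, Module.Basis (label n) R (X.X n)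

/-- The list of pairs (name of a scalar, label of a basis element) represents `x` as a linear
combination of basis elements. -/
def EffStructure.Expands {R : Type*} [Ring R] {X : ChainComplex (ModuleCat.{u} R) ℕ}
    (E : EffStructure X) (ρ : Naming R) (n : ℕ) : List (ℕ × ℕ) → X.X n → Prop
  | [], x => x = 0
  | (a, b) :: l, x => ∃ r ∈ ρ.val a, ∃ hb : b ∈ E.label n, ∃ x', E.Expands ρ n l x' ∧
      x = r • E.basis n ⟨b, hb⟩ + x'

/-- Programs for the operations of a locally effective complex of free modules. -/
structure ComplexCodes where
  zero : Nat.Partrec.Code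
  add : Nat.Partrec.Code
  smul : Nat.Partrec.Code
  diff : Nat.Partrec.Code
  gen : Nat.Partrec.Code
  coord : Nat.Partrec.Code

/-- The programs `c` make the complex `X` locally effective: they compute zero, addition, scalar
multiplication and the differential, the basis element with a given label, and the expansion of an
element in the basis. Scalars are represented by `ρ`. -/
structure EffStructure.RealizedBy {R : Type*} [Ring R] {X : ChainComplex (ModuleCat.{u} R) ℕ}
    (E : EffStructure X) (ρ : Naming R) (c : ComplexCodes) : Prop where
  zero : ∀ n, ∃ b ∈ c.zero.eval n, (0 : X.X n) ∈ (E.name n).val b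
  add : Computes c.add (fun n => (E.name n).prod (E.name n)) E.name (fun _ p => p.1 + p.2)
  smul : Computes c.smul (fun n => ρ.prod (E.name n)) E.name (fun _ p => p.1 • p.2)
  diff : Computes c.diff (fun n => E.name (n + 1)) E.name (fun n x => X.d (n + 1) n x)
  gen : ∀ n (i : E.label n), ∃ b ∈ c.gen.eval (Nat.pair n i), E.basis n i ∈ (E.name n).val b
  coord : ∀ n a x, x ∈ (E.name n).val a →
    ∃ l : List (ℕ × ℕ), Encodable.encode l ∈ c.coord.eval (Nat.pair n a) ∧ E.Expands ρ n l x

/-- Programs for the maps of a reduction. -/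
structure ReductionCodes where
  proj : Nat.Partrec.Code
  incl : Nat.Partrec.Code
  htpy : Nat.Partrec.Code

/-- The programs `c` compute the three maps of a reduction. -/
structure Reduction.RealizedBy {R : Type*} [Ring R] {C D : ChainComplex (ModuleCat.{u} R) ℕ}
    (r : Reduction C D) (ν : ∀ n, Naming (C.X n)) (μ : ∀ n, Naming (D.X n))
    (c : ReductionCodes) : Prop where
  proj : Computes c.proj ν μ (fun n x => r.proj.f n x)
  incl : Computes c.incl μ ν (fun n x => r.incl.f n x)
  htpy : Computes c.htpy ν (fun n => ν (n + 1)) (fun n x => r.htpy.hom n (n + 1) x)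

/-- Programs for a span of reductions `M ⇐ mid ⇒ target` (those for `M` itself not included). -/
structure SpanCodes where
  mid : ComplexCodes
  target : ComplexCodes
  left : ReductionCodes
  right : ReductionCodes

/-- Six programs, as a tuple. -/
def ComplexCodes.equiv : ComplexCodes ≃ Nat.Partrec.Code × Nat.Partrec.Code × Nat.Partrec.Code ×
    Nat.Partrec.Code × Nat.Partrec.Code × Nat.Partrec.Code where
  toFun c := (c.zero, c.add, c.smul, c.diff, c.gen, c.coord)
  invFun p := ⟨p.1, p.2.1, p.2.2.1, p.2.2.2.1, p.2.2.2.2.1, p.2.2.2.2.2⟩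

instance : Primcodable ComplexCodes := Primcodable.ofEquiv _ ComplexCodes.equiv

/-- Three programs, as a tuple. -/
def ReductionCodes.equiv :
    ReductionCodes ≃ Nat.Partrec.Code × Nat.Partrec.Code × Nat.Partrec.Code where
  toFun c := (c.proj, c.incl, c.htpy)
  invFun p := ⟨p.1, p.2.1, p.2.2⟩

instance : Primcodable ReductionCodes := Primcodable.ofEquiv _ ReductionCodes.equiv

/-- The programs of a span, as a tuple. -/
def SpanCodes.equiv :
    SpanCodes ≃ ComplexCodes × ComplexCodes × ReductionCodes × ReductionCodes where
  toFun c := (c.mid, c.target, c.left, c.right)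
  invFun p := ⟨p.1, p.2.1, p.2.2.1, p.2.2.2⟩

instance : Primcodable SpanCodes := Primcodable.ofEquiv _ SpanCodes.equiv

/-! ### The bar construction of the transferred structure -/

section Bar

variable {G : Type u} [Group G] {M : ChainComplex (ModuleCat.{u} (MonoidAlgebra ℤ G)) ℕ}
  {T N : ChainComplex (ModuleCat.{u} ℤ) ℕ}

/-- The action of `g` transferred along a reduction `(α, β, η) : T ⇒ M`:
`x ↦ β (g (α x)) + (x - β (α x))`. -/
noncomputable def transferredAction (L : Reduction T (underlying G M)) (g : G) (q : ℕ)
    (x : T.X q) : T.X q :=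
  let y : M.X q := L.proj.f q x
  L.incl.f q (MonoidAlgebra.of ℤ G g • y : M.X q) + (x - L.incl.f q (L.proj.f q x))

/-- `g₁ η g₂ η ⋯ η gₘ` on `T`, where `g₁ = g` and `(g₂, …, gₘ) = l`, with `G` acting on `T` by the
transferred action and `η` the homotopy operator of `T ⇒ N`. -/
noncomputable def shuffle (L : Reduction T (underlying G M)) (r : Reduction T N) {q : ℕ} :
    (g : G) → (l : List G) → T.X q → T.X (q + l.length)
  | g, [], x => transferredAction L g q x
  | g, h :: l, x => transferredAction L g (q + l.length + 1)
      (r.htpy.hom (q + l.length) (q + l.length + 1) (shuffle L r h l x))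

/-- The higher operation `(g₁, …, gₘ)` on `N` transferred along `T ⇒ N`, of degree `m - 1`. -/
noncomputable def higherAction (L : Reduction T (underlying G M)) (r : Reduction T N) {q : ℕ}
    (g : G) (l : List G) (y : N.X q) : N.X (q + l.length) :=
  r.proj.f (q + l.length) (shuffle L r g l (r.incl.f q y))

open Classical in
/-- The degree `n` part of `⨁ₘ ℤ[G] ⊗ (s ℤ[G])^{⊗ m} ⊗ N`. The group `ℤ[G]^{⊗ m}` is free on the
words `l` of length `m` in `G`; the summand of `(l, q)` is `ℤ[G] ⊗ l ⊗ N_q`. -/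
abbrev BarModule (G : Type u) [Group G] (N : ChainComplex (ModuleCat.{u} ℤ) ℕ) (n : ℕ) : Type u :=
  ⨁ p : {p : List G × ℕ // p.2 + p.1.length = n}, MonoidAlgebra ℤ G ⊗[ℤ] N.X p.1.2

open Classical in
/-- The element `g₀ | g₁ | ⋯ | gₘ ⊗ y` for `l = (g₁, …, gₘ)`. -/
noncomputable def barTensor {n : ℕ} (g₀ : G) (l : List G) (q : ℕ) (h : q + l.length = n)
    (y : N.X q) : BarModule G N n :=
  DirectSum.of (fun p : {p : List G × ℕ // p.2 + p.1.length = n} =>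
    MonoidAlgebra ℤ G ⊗[ℤ] N.X p.1.2) ⟨(l, q), h⟩ (MonoidAlgebra.of ℤ G g₀ ⊗ₜ[ℤ] y)

/-- The boundary of `g₀ | g₁ | ⋯ | gₘ ⊗ y`, that is
`(-1)^m g₀|⋯|gₘ ⊗ ∂y + ∑ₖ (-1)^(k-1) g₀|⋯|gₖ₋₁ gₖ|⋯|gₘ ⊗ y + ∑ₖ (-1)^k g₀|⋯|gₖ₋₁ ⊗ (gₖ, …, gₘ) y`
with both sums over `1 ≤ k ≤ m`. In the code, the term `k = 1` of the first sum is separate, and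
the indices start from `0`. -/
noncomputable def barBoundary (L : Reduction T (underlying G M)) (r : Reduction T N) {n : ℕ}
    (g₀ : G) (l : List G) (q : ℕ) (h : q + l.length = n + 1) (y : N.X q) : BarModule G N n :=
  (if hq : 0 < q then
    (-1 : ℤ) ^ l.length • barTensor g₀ l (q - 1) (by omega) (N.d q (q - 1) y) else 0)
  + (if hl : 0 < l.length then
    barTensor (g₀ * l[0]) l.tail q (by rw [List.length_tail]; omega) y else 0)
  + (∑ j : Fin (l.length - 1), (-1 : ℤ) ^ (j.1 + 1) •
      barTensor g₀ (l.take j ++ (l[j.1] * l[j.1 + 1]) :: l.drop (j + 2)) q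
        (by simp only [List.length_append, List.length_take, List.length_cons, List.length_drop]
            omega) y)
  + (∑ k : Fin l.length, (-1 : ℤ) ^ (k.1 + 1) •
      barTensor g₀ (l.take k) (q + (l.drop (k + 1)).length)
        (by simp only [List.length_take, List.length_drop]; omega)
        (higherAction L r l[k.1] (l.drop (k + 1)) y))

/-- `N'` is (isomorphic to) the bar construction `BN`. -/
def IsBarConstruction (L : Reduction T (underlying G M)) (r : Reduction T N)
    (N' : ChainComplex (ModuleCat.{u} (MonoidAlgebra ℤ G)) ℕ) : Prop :=
  ∃ φ : ∀ n, BarModule G N n ≃ₗ[MonoidAlgebra ℤ G] N'.X n,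
    ∀ n (g₀ : G) (l : List G) (q : ℕ) (h : q + l.length = n + 1) (y : N.X q),
      N'.d (n + 1) n (φ (n + 1) (barTensor g₀ l q h y)) = φ n (barBoundary L r g₀ l q h y)

end Bar

/-!
# Equivariant effective homology from non-equivariant effective homology

Write `L = (α₁, β₁, η₁) : T ⇒ M` and `r = (α, β, η) : T ⇒ N` for the given reductions. Conjugating
the action on `M` by `L` (and acting trivially on the complement) gives a strict action of `G` on
`T` by chain maps, `transferAct`. The bar construction `B(L, r)` of `N` with the operations
`(g₁, …, gₘ)` transferred along `r` is a complex of free `ℤ[G]`-modules, `barComplex L r`. The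
algorithm returns the span

  `M ⇐ B(L, 1) ⇒ B(L, r)`,

where `B(L, 1)` is the bar construction of `T` itself (`r` the identity reduction).

All maps out of a bar construction are built in the same way. The bar module is generated, under
sums and the action of `G`, by the elements `1 ⊗ y` and the image of the extra degeneracy
`s (g₀ | ⋯ | gₘ ⊗ y) = 1 | g₀ | ⋯ | gₘ ⊗ y` (`bar_induction`). Hence there is a unique equivariant
map `f` with prescribed `f (1 ⊗ y)` and with `f (s w)` prescribed in terms of `f w` and `w`
(`barRec`), and an identity between such maps need only be checked on `1 ⊗ y` and along `s`.

* The differential is determined by `d (1 ⊗ y) = 1 ⊗ d y` and `d s + s d = 1 - ι E`, where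
  `E (g₀ | ⋯ | gₘ ⊗ y) = (g₀, …, gₘ) y` and `ι y = 1 ⊗ y` (`barD`, `barD_S`). Unfolding the recursion
  gives the explicit formula (`barD_barTensor`, `isBarConstruction_barComplex`).
* The reduction `r` extends to an equivariant reduction `B(L, 1) ⇒ B(L, r)` (`barReduction`). Its
  maps are again given by recursion; the correction terms involve `barΦ`, that is
  `g₀ η g₁ η ⋯ η gₘ β`, and `barΨ`, that is `± g₀ η g₁ η ⋯ gₘ η`.
* The same reduction for `r = L` is `B(L, 1) ⇒ B(L, L)`, and `B(L, L)` is the ordinary bar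
  construction of the `ℤ[G]`-complex `M`. Its augmentation to `M` has an equivariant section because
  `M` is free: define it on the basis elements by recursion over the degree (`barSection`). A
  contracting homotopy is given by recursion along `s`, and it can be normalized to satisfy the side
  conditions, so `B(L, L)` reduces to `M` (`barResolution`). The composite is the left leg.

In each degree the bar module of a finite group is a finite sum of copies of the groups `N_q`, which
gives local finiteness (`locallyFiniteComplex_barComplex`).

For the computability, `EffMap` says that a family of maps is computed on names by a single program
which also receives the code of the index; here the index is the whole input (with its degree), and
its code consists of the programs given to the algorithm. An element of the bar module is named by a
list of tokens `(z, g₀, l, q, a)`, which stand for `z • (g₀ | l ⊗ y)` with `a` a name of `y`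
(`barVal`). Since the `s`-`m`-`n` theorem and the universal program allow recursion over degrees
and words (`EffMap.natRec`, `EffMap.listRec`), `barRec` is computable from its data
(`effMap_barRec`), and hence so are all of the maps above. Applying the `s`-`m`-`n` theorem once more
turns uniform computability into programs that depend computably on the input
(`EffComplex.exists_realizedBy`, `EffReduction.exists_realizedBy`).
-/

/-! ### The bar module and its recursion principle -/

section BarModule

variable {G : Type u} [Group G] {N : ChainComplex (ModuleCat.{u} ℤ) ℕ}

/-- Left multiplication by `g` on a module over the group ring. -/
noncomputable def mulAct {P : Type*} [AddCommGroup P] [Module (MonoidAlgebra ℤ G) P] (g : G) :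
    P →+ P :=
  DistribSMul.toAddMonoidHom P (MonoidAlgebra.of ℤ G g)

lemma mulAct_def {P : Type*} [AddCommGroup P] [Module (MonoidAlgebra ℤ G) P] (g : G)
    (x : P) : mulAct g x = MonoidAlgebra.of ℤ G g • x := rfl

lemma mulAct_one {P : Type*} [AddCommGroup P] [Module (MonoidAlgebra ℤ G) P] (x : P) :
    mulAct (1 : G) x = x := by
  rw [mulAct_def, map_one, one_smul]

lemma mulAct_mul {P : Type*} [AddCommGroup P] [Module (MonoidAlgebra ℤ G) P] (g h : G) (x : P) :
    mulAct (g * h) x = mulAct g (mulAct h x) := by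
  rw [mulAct_def, map_mul, mul_smul]; rfl

lemma barTensor_add {n : ℕ} (g : G) (l : List G) (q : ℕ) (h : q + l.length = n) (x y : N.X q) :
    barTensor g l q h (x + y) = barTensor g l q h x + barTensor g l q h y := by
  simp [barTensor, TensorProduct.tmul_add]

/-- `barTensor` as an additive map in its last argument. -/
noncomputable def barTensorHom {n : ℕ} (g : G) (l : List G) (q : ℕ) (h : q + l.length = n) :
    N.X q →+ BarModule G N n :=
  AddMonoidHom.mk' (barTensor g l q h) (barTensor_add g l q h)

@[simp] lemma barTensorHom_apply {n : ℕ} (g : G) (l : List G) (q : ℕ) (h : q + l.length = n)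
    (x : N.X q) : barTensorHom g l q h x = barTensor g l q h x := rfl

@[simp] lemma barTensor_zero {n : ℕ} (g : G) (l : List G) (q : ℕ) (h : q + l.length = n) :
    barTensor g l q h (0 : N.X q) = 0 := map_zero (barTensorHom g l q h)

@[simp] lemma mulAct_barTensor {n : ℕ} (g g' : G) (l : List G) (q : ℕ) (h : q + l.length = n)
    (x : N.X q) :
    mulAct g (barTensor g' l q h x) = barTensor (g * g') l q h x := by
  classical
  rw [mulAct_def]
  unfold barTensor
  rw [← DirectSum.of_smul, TensorProduct.smul_tmul', smul_eq_mul, map_mul]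

/-- Every element of the bar module is a sum of tensors `g₀ | ⋯ | gₘ ⊗ y`. -/
lemma barTensor_induction {n : ℕ} {Q : BarModule G N n → Prop} (h0 : Q 0)
    (hadd : ∀ x y, Q x → Q y → Q (x + y))
    (ht : ∀ g l q h y, Q (barTensor g l q h y)) (w : BarModule G N n) : Q w := by
  classical
  have hz : ∀ (z : ℤ) (g : G) (p : {p : List G × ℕ // p.2 + p.1.length = n}) (y : N.X p.1.2),
      ∃ y', MonoidAlgebra.single g z ⊗ₜ[ℤ] y = MonoidAlgebra.of ℤ G g ⊗ₜ[ℤ] y' := by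
    intro z g p y
    have h : (MonoidAlgebra.single g z : MonoidAlgebra ℤ G) = z • MonoidAlgebra.of ℤ G g := by
      simp [MonoidAlgebra.of_apply, MonoidAlgebra.smul_single]
    exact ⟨z • y, by
      rw [h]
      exact (map_zsmul ((TensorProduct.mk ℤ (MonoidAlgebra ℤ G) (N.X p.1.2)).flip y) z _).trans
        (map_zsmul (TensorProduct.mk ℤ (MonoidAlgebra ℤ G) (N.X p.1.2) _) z y).symm⟩
  induction w using DirectSum.induction_on with
  | zero => exact h0
  | add x y hx hy => exact hadd x y hx hy
  | of p x =>
    induction x using TensorProduct.induction_on with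
    | zero => simpa using h0
    | add x y hx hy => rw [map_add]; exact hadd _ _ hx hy
    | tmul r y =>
      induction r using MonoidAlgebra.induction_linear with
      | zero => simpa using h0
      | add r s hr hs => rw [TensorProduct.add_tmul, map_add]; exact hadd _ _ hr hs
      | single g z =>
        obtain ⟨y', hy'⟩ := hz z g p y
        rw [hy']
        exact ht g p.1.1 p.1.2 p.2 y'

open Classical in
/-- The additive map on the bar module with prescribed values on the tensors `g₀ | l ⊗ y`. -/
noncomputable def barLift {n : ℕ} {P : Type*} [AddCommGroup P]
    (f : G → ∀ p : {p : List G × ℕ // p.2 + p.1.length = n}, N.X p.1.2 →+ P) :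
    BarModule G N n →+ P :=
  DirectSum.toAddMonoid fun p => TensorProduct.liftAddHom
    ((Finsupp.liftAddHom fun g => zmultiplesHom (N.X p.1.2 →+ P) (f g p)).comp
      MonoidAlgebra.coeffAddEquiv.toAddMonoidHom)
    (by
      intro z m y
      refine (congrArg (fun F : N.X p.1.2 →+ P => F y) (map_zsmul _ z m)).trans ?_
      refine Eq.trans ?_ (congrArg _ (int_smul_eq_zsmul inferInstance z y).symm)
      rw [map_zsmul]
      rfl)

@[simp] lemma barLift_barTensor {n : ℕ} {P : Type*} [AddCommGroup P]
    (f : G → ∀ p : {p : List G × ℕ // p.2 + p.1.length = n}, N.X p.1.2 →+ P)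
    (g : G) (l : List G) (q : ℕ) (h : q + l.length = n) (y : N.X q) :
    barLift f (barTensor g l q h y) = f g ⟨(l, q), h⟩ y := by
  classical
  unfold barLift barTensor
  rw [DirectSum.toAddMonoid_of, TensorProduct.liftAddHom_tmul]
  simp [MonoidAlgebra.of_apply]

/-- The inclusion `y ↦ 1 ⊗ y` of `N` into the bar module. -/
noncomputable def barι (G : Type u) [Group G] (N : ChainComplex (ModuleCat.{u} ℤ) ℕ) (n : ℕ) :
    N.X n →+ BarModule G N n :=
  barTensorHom 1 [] n rfl

/-- The extra degeneracy `g₀ | g₁ | ⋯ | gₘ ⊗ y ↦ 1 | g₀ | ⋯ | gₘ ⊗ y`. It is not equivariant. -/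
noncomputable def barS (G : Type u) [Group G] (N : ChainComplex (ModuleCat.{u} ℤ) ℕ) (n : ℕ) :
    BarModule G N n →+ BarModule G N (n + 1) :=
  barLift fun g p => barTensorHom 1 (g :: p.1.1) p.1.2 (by have := p.2; simp; omega)

lemma barι_apply (n : ℕ) (y : N.X n) : barι G N n y = barTensor 1 [] n rfl y := rfl

@[simp] lemma barS_barTensor {n : ℕ} (g : G) (l : List G) (q : ℕ) (h : q + l.length = n)
    (y : N.X q) : barS G N n (barTensor g l q h y) =
      barTensor 1 (g :: l) q (by simp; omega) y := by
  simp [barS]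

/-- The extra degeneracy indexed by its target; it is zero into degree `0`. -/
noncomputable def barSPred (G : Type u) [Group G] (N : ChainComplex (ModuleCat.{u} ℤ) ℕ) :
    ∀ n, BarModule G N (n - 1) →+ BarModule G N n
  | 0 => 0
  | n + 1 => barS G N n

@[simp] lemma barSPred_zero : barSPred G N 0 = 0 := rfl

@[simp] lemma barSPred_succ (n : ℕ) : barSPred G N (n + 1) = barS G N n := rfl

/-- The bar module is generated, under sums and the action of `G`, by the image of `N` and the image
of the extra degeneracy. All identities between maps out of it are proved by this induction. -/
lemma bar_induction {Q : ∀ n, BarModule G N n → Prop} (h0 : ∀ n, Q n 0)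
    (hadd : ∀ n x y, Q n x → Q n y → Q n (x + y))
    (hsmul : ∀ n (g : G) x, Q n x → Q n (mulAct g x))
    (hι : ∀ n y, Q n (barι G N n y))
    (hS : ∀ n w, Q n w → Q (n + 1) (barS G N n w)) (n : ℕ) (w : BarModule G N n) : Q n w := by
  induction w using barTensor_induction with
  | h0 => exact h0 n
  | hadd x y hx hy => exact hadd n x y hx hy
  | ht g l q h y =>
    induction l generalizing g n with
    | nil =>
      obtain rfl : q = n := h
      simpa [barι_apply] using hsmul q g _ (hι q y)
    | cons g' l ih =>
      obtain rfl : n = (q + l.length) + 1 := by simp at h; omega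
      simpa using hsmul _ g _ (hS _ _ (ih _ g' rfl))

section Rec

variable {P : ℕ → Type*} [∀ n, AddCommGroup (P n)] (act : ∀ n, G → P n →+ P n)
  (a : ∀ n, N.X n →+ P n) (t : ∀ n, P n →+ P (n + 1)) (v : ∀ n, BarModule G N n →+ P (n + 1))

/-- The restriction of `barRec` to the elements `1 | l ⊗ y`. -/
noncomputable def barRecAux (q : ℕ) : (l : List G) → N.X q →+ P (q + l.length)
  | [] => a q
  | g :: l => (t (q + l.length)).comp ((act _ g).comp (barRecAux q l)) +
      (v (q + l.length)).comp (barTensorHom g l q rfl)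

/-- The map `f` on the bar module that is equivariant for `act` and satisfies `f (1 ⊗ y) = a y` and
`f (s w) = t (f w) + v w` for the extra degeneracy `s`. -/
noncomputable def barRec (n : ℕ) : BarModule G N n →+ P n :=
  barLift fun g p => (act n g).comp
    (Eq.rec (motive := fun m _ => N.X p.1.2 →+ P m) (barRecAux act a t v p.1.2 p.1.1) p.2)

lemma barRec_barTensor (g : G) (l : List G) (q : ℕ) (y : N.X q) :
    barRec act a t v (q + l.length) (barTensor g l q rfl y) =
      act _ g (barRecAux act a t v q l y) := by
  simp [barRec]

variable {act a t v}

lemma barRec_smul (hmul : ∀ n g h x, act n (g * h) x = act n g (act n h x)) (n : ℕ) (g : G)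
    (w : BarModule G N n) :
    barRec act a t v n (mulAct g w) = act n g (barRec act a t v n w) := by
  induction w using barTensor_induction with
  | h0 => simp
  | hadd x y hx hy => simp only [map_add, hx, hy]
  | ht g' l q h y =>
    cases h
    rw [mulAct_barTensor, barRec_barTensor, barRec_barTensor, hmul]

lemma barRec_ι (hone : ∀ n x, act n 1 x = x) (n : ℕ) (y : N.X n) :
    barRec act a t v n (barι G N n y) = a n y := by
  have := barRec_barTensor act a t v 1 [] n y
  rw [hone] at this
  exact this

lemma barRec_S (hone : ∀ n x, act n 1 x = x) (n : ℕ) (w : BarModule G N n) :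
    barRec act a t v (n + 1) (barS G N n w) = t n (barRec act a t v n w) + v n w := by
  induction w using barTensor_induction with
  | h0 => simp
  | hadd x y hx hy => simp only [map_add, hx, hy]; abel
  | ht g' l q h y =>
    cases h
    rw [barS_barTensor, barRec_barTensor]
    have := barRec_barTensor act a t v 1 (g' :: l) q y
    rw [hone] at this
    exact this

end Rec

/-- An additive map that commutes with the action of `G` is linear over the group ring. -/
def linearOfEquivariant {P Q : Type*} [AddCommGroup P] [AddCommGroup Q]
    [Module (MonoidAlgebra ℤ G) P] [Module (MonoidAlgebra ℤ G) Q] (f : P →+ Q)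
    (hf : ∀ (g : G) x, f (mulAct g x) = mulAct g (f x)) :
    P →ₗ[MonoidAlgebra ℤ G] Q where
  toFun := f
  map_add' := map_add f
  map_smul' r x := by
    induction r using MonoidAlgebra.induction_linear with
    | zero => simp
    | add r s hr hs => simp only [add_smul, map_add, hr, hs, RingHom.id_apply]
    | single g z =>
      have : (MonoidAlgebra.single g z : MonoidAlgebra ℤ G) = z • MonoidAlgebra.of ℤ G g := by
        simp [MonoidAlgebra.of_apply, MonoidAlgebra.smul_single]
      rw [this, RingHom.id_apply, smul_assoc, smul_assoc, map_zsmul, ← mulAct_def, hf, mulAct_def]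

@[simp] lemma linearOfEquivariant_apply {P Q : Type*} [AddCommGroup P] [AddCommGroup Q]
    [Module (MonoidAlgebra ℤ G) P] [Module (MonoidAlgebra ℤ G) Q] (f : P →+ Q)
    (hf : ∀ (g : G) x, f (mulAct g x) = mulAct g (f x)) (x : P) :
    linearOfEquivariant f hf x = f x := rfl

end BarModule

/-! ### Reductions as families of additive maps -/

/-- The differential of a chain complex out of degree `n` as an additive map. In degree `0` it is
the zero map `X 0 → X (0 - 1) = X 0`. -/
noncomputable def dHom {R : Type*} [Ring R] (X : ChainComplex (ModuleCat.{u} R) ℕ) (n : ℕ) :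
    X.X n →+ X.X (n - 1) :=
  (X.d n (n - 1)).hom.toAddMonoidHom

lemma dHom_dHom {R : Type*} [Ring R] (X : ChainComplex (ModuleCat.{u} R) ℕ) (n : ℕ) (x : X.X n) :
    dHom X (n - 1) (dHom X n x) = 0 :=
  congrArg (fun f => f.hom x) (X.d_comp_d n (n - 1) (n - 1 - 1))

namespace Reduction

section

variable {R : Type*} [Ring R] {C D : ChainComplex (ModuleCat.{u} R) ℕ} (r : Reduction C D)

/-- The projection of a reduction as a family of additive maps. -/
noncomputable def projHom (n : ℕ) : C.X n →+ D.X n := (r.proj.f n).hom.toAddMonoidHom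

/-- The inclusion of a reduction as a family of additive maps. -/
noncomputable def inclHom (n : ℕ) : D.X n →+ C.X n := (r.incl.f n).hom.toAddMonoidHom

/-- The homotopy operator of a reduction as a family of additive maps. -/
noncomputable def htpyHom (n : ℕ) : C.X n →+ C.X (n + 1) :=
  (r.htpy.hom n (n + 1)).hom.toAddMonoidHom

/-- The homotopy operator indexed by its target; it is zero into degree `0`. -/
noncomputable def htpyPred : ∀ n, C.X (n - 1) →+ C.X n
  | 0 => 0
  | n + 1 => r.htpyHom n

@[simp] lemma htpyPred_zero : r.htpyPred 0 = 0 := rfl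

@[simp] lemma htpyPred_succ (n : ℕ) : r.htpyPred (n + 1) = r.htpyHom n := rfl

@[simp] lemma proj_incl (n : ℕ) (y : D.X n) : r.projHom n (r.inclHom n y) = y :=
  congrArg (fun f => (f.f n).hom y) r.incl_proj

@[simp] lemma proj_htpy (n : ℕ) (x : C.X n) : r.projHom (n + 1) (r.htpyHom n x) = 0 :=
  congrArg (fun f => f.hom x) (r.htpy_proj n)

@[simp] lemma htpy_incl (n : ℕ) (y : D.X n) : r.htpyHom n (r.inclHom n y) = 0 :=
  congrArg (fun f => f.hom y) (r.incl_htpy n)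

@[simp] lemma htpy_htpy_apply (n : ℕ) (x : C.X n) : r.htpyHom (n + 1) (r.htpyHom n x) = 0 :=
  congrArg (fun f => f.hom x) (r.htpy_htpy n)

@[simp] lemma proj_d (n : ℕ) (x : C.X n) :
    r.projHom (n - 1) (dHom C n x) = dHom D n (r.projHom n x) :=
  congrArg (fun f => f.hom x) (r.proj.comm n (n - 1)).symm

@[simp] lemma incl_d (n : ℕ) (x : D.X n) :
    r.inclHom (n - 1) (dHom D n x) = dHom C n (r.inclHom n x) :=
  congrArg (fun f => f.hom x) (r.incl.comm n (n - 1)).symm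

lemma d_htpy (n : ℕ) (x : C.X n) :
    @Eq (C.X n) (dHom C (n + 1) (r.htpyHom n x))
      (x - r.inclHom n (r.projHom n x) - r.htpyPred n (dHom C n x)) := by
  have h := congrArg (fun f => f.hom x) (r.htpy.comm n)
  cases n with
  | zero =>
    rw [prevD_eq r.htpy.hom (show (ComplexShape.down ℕ).Rel 1 0 by simp),
      dNext_eq_zero _ _ (by simp)] at h
    simp only [HomologicalComplex.id_f, HomologicalComplex.comp_f, zero_add] at h
    simp only [htpyPred_zero, AddMonoidHom.zero_apply, sub_zero]
    exact eq_sub_of_add_eq h.symm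
  | succ n =>
    rw [prevD_eq r.htpy.hom (show (ComplexShape.down ℕ).Rel (n + 1 + 1) (n + 1) by simp),
      dNext_eq r.htpy.hom (show (ComplexShape.down ℕ).Rel (n + 1) n by simp)] at h
    have h' : x = r.htpyPred (n + 1) (dHom C (n + 1) x) +
      (C.d (n + 1 + 1) (n + 1)).hom (r.htpyHom (n + 1) x) +
        r.inclHom (n + 1) (r.projHom (n + 1) x) := h
    rw [sub_sub, eq_sub_iff_add_eq]
    conv_rhs => rw [h']
    change (C.d (n + 1 + 1) (n + 1)).hom (r.htpyHom (n + 1) x) + _ = _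
    abel

end

/-- The trivial reduction of a complex to itself. -/
def refl {V : Type*} [Category V] [Preadditive V] (C : ChainComplex V ℕ) : Reduction C C where
  proj := 𝟙 C
  incl := 𝟙 C
  htpy := Homotopy.ofEq (by simp)
  incl_proj := by simp
  htpy_proj n := by simp
  incl_htpy n := by simp
  htpy_htpy n := by simp

section

variable {R : Type*} [Ring R] (C : ChainComplex (ModuleCat.{u} R) ℕ)

@[simp] lemma refl_projHom (n : ℕ) (x : C.X n) : (refl C).projHom n x = x := rfl

@[simp] lemma refl_inclHom (n : ℕ) (x : C.X n) : (refl C).inclHom n x = x := rfl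

@[simp] lemma refl_htpyHom (n : ℕ) : (refl C).htpyHom n = 0 := rfl

end

end Reduction

/-! ### The transferred action and the bar differential -/

section Bar

variable {G : Type u} [Group G] {M : ChainComplex (ModuleCat.{u} (MonoidAlgebra ℤ G)) ℕ}
  {T N : ChainComplex (ModuleCat.{u} ℤ) ℕ}

/-- The action of `g` on the abelian group underlying `M`. -/
noncomputable def underlyingAct (M : ChainComplex (ModuleCat.{u} (MonoidAlgebra ℤ G)) ℕ) (q : ℕ)
    (g : G) : (underlying G M).X q →+ (underlying G M).X q :=
  (mulAct g : M.X q →+ M.X q)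

lemma underlyingAct_one (q : ℕ) (x : (underlying G M).X q) : underlyingAct M q 1 x = x :=
  mulAct_one (P := M.X q) x

lemma underlyingAct_mul (q : ℕ) (g h : G) (x : (underlying G M).X q) :
    underlyingAct M q (g * h) x = underlyingAct M q g (underlyingAct M q h x) :=
  mulAct_mul (P := M.X q) g h x

lemma underlyingAct_d (q : ℕ) (g : G) (x : (underlying G M).X q) :
    underlyingAct M (q - 1) g (dHom (underlying G M) q x) =
      dHom (underlying G M) q (underlyingAct M q g x) :=
  (LinearMap.map_smul (M.d q (q - 1)).hom (MonoidAlgebra.of ℤ G g) x).symm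

variable (L : Reduction T (underlying G M)) (r : Reduction T N)

/-- `transferredAction` as a family of additive maps. -/
noncomputable def transferAct (q : ℕ) (g : G) : T.X q →+ T.X q :=
  (L.inclHom q).comp ((underlyingAct M q g).comp (L.projHom q)) +
    (AddMonoidHom.id _ - (L.inclHom q).comp (L.projHom q))

lemma transferAct_apply (q : ℕ) (g : G) (x : T.X q) :
    transferAct L q g x =
      L.inclHom q (underlyingAct M q g (L.projHom q x)) + (x - L.inclHom q (L.projHom q x)) := rfl

lemma transferAct_one (q : ℕ) (x : T.X q) : transferAct L q (1 : G) x = x := by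
  simp [transferAct_apply, underlyingAct_one]

lemma transferAct_mul (q : ℕ) (g h : G) (x : T.X q) :
    transferAct L q (g * h) x = transferAct L q g (transferAct L q h x) := by
  simp [transferAct_apply, underlyingAct_mul]

lemma transferAct_d (q : ℕ) (g : G) (x : T.X q) :
    transferAct L (q - 1) g (dHom T q x) = dHom T q (transferAct L q g x) := by
  simp only [transferAct_apply, L.proj_d, underlyingAct_d, L.incl_d, map_add, map_sub]

@[simp] lemma proj_transferAct (q : ℕ) (g : G) (x : T.X q) :
    L.projHom q (transferAct L q g x) = underlyingAct M q g (L.projHom q x) := by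
  simp [transferAct_apply]

/-- The equivariant chain map from the bar construction of `N` to `T` with the transferred action,
`g₀ | ⋯ | gₘ ⊗ y ↦ g₀ η g₁ η ⋯ η gₘ (β y)`. -/
noncomputable def barΦ (n : ℕ) : BarModule G N n →+ T.X n :=
  barRec (transferAct L) r.inclHom r.htpyHom 0 n

lemma barΦ_act (n : ℕ) (g : G) (w : BarModule G N n) :
    barΦ L r n (mulAct g w) = transferAct L n g (barΦ L r n w) :=
  barRec_smul (transferAct_mul L) n g w

lemma barΦ_ι (n : ℕ) (y : N.X n) : barΦ L r n (barι G N n y) = r.inclHom n y :=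
  barRec_ι (transferAct_one L) n y

lemma barΦ_S (n : ℕ) (w : BarModule G N n) :
    barΦ L r (n + 1) (barS G N n w) = r.htpyHom n (barΦ L r n w) := by
  exact (barRec_S (transferAct_one L) n w).trans (add_zero _)

lemma barΦ_shift (n : ℕ) (w : BarModule G N (n - 1)) :
    barΦ L r n (barSPred G N n w) = r.htpyPred n (barΦ L r (n - 1) w) := by
  cases n with
  | zero => simp
  | succ n => exact barΦ_S L r n w

/-- The chain map `g₀ | ⋯ | gₘ ⊗ y ↦ (g₀, …, gₘ) y` from the bar construction to `N`, which is left
inverse to `barι` and not equivariant. -/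
noncomputable def barE (n : ℕ) : BarModule G N n →+ N.X n :=
  (r.projHom n).comp (barΦ L r n)

lemma barE_apply (n : ℕ) (w : BarModule G N n) : barE L r n w = r.projHom n (barΦ L r n w) := rfl

lemma barE_ι (n : ℕ) (y : N.X n) : barE L r n (barι G N n y) = y := by
  rw [barE_apply, barΦ_ι, r.proj_incl]

/-- The differential of the bar construction out of degree `n`, characterized by equivariance,
`d ι = ι d` and `d s = 1 - s d - ι E`: the degeneracy `s` contracts the bar construction
onto `N`. -/
noncomputable def barD (n : ℕ) : BarModule G N n →+ BarModule G N (n - 1) :=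
  barRec (P := fun n => BarModule G N (n - 1)) (fun _ => mulAct)
    (fun n => (barι G N (n - 1)).comp (dHom N n)) (fun n => -barSPred G N n)
    (fun n => AddMonoidHom.id (BarModule G N n) - (barι G N n).comp (barE L r n)) n

lemma barD_act (n : ℕ) (g : G) (w : BarModule G N n) :
    barD L r n (mulAct g w) = mulAct g (barD L r n w) :=
  barRec_smul (P := fun n => BarModule G N (n - 1)) (fun _ => mulAct_mul) n g w

lemma barD_ι (n : ℕ) (y : N.X n) : barD L r n (barι G N n y) = barι G N (n - 1) (dHom N n y) :=
  barRec_ι (P := fun n => BarModule G N (n - 1)) (fun _ => mulAct_one) n y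

lemma barD_S (n : ℕ) (w : BarModule G N n) :
    @Eq (BarModule G N n) (barD L r (n + 1) (barS G N n w))
      (w - barι G N n (barE L r n w) - barSPred G N n (barD L r n w)) := by
  refine (barRec_S (P := fun n => BarModule G N (n - 1)) (fun _ => mulAct_one) n w).trans ?_
  change -barSPred G N n (barD L r n w) + (w - barι G N n (barE L r n w)) = _
  abel

lemma barD_zero (w : BarModule G N 0) : barD L r 0 w = 0 := by
  induction w using barTensor_induction with
  | h0 => simp
  | hadd x y hx hy => rw [map_add, hx, hy, add_zero]
  | ht g l q h y =>
    obtain ⟨rfl, hl⟩ := Nat.add_eq_zero_iff.mp h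
    obtain rfl := List.length_eq_zero_iff.mp hl
    have h1 : barTensor g [] 0 h y = mulAct g (barι G N 0 y) := by simp [barι_apply]
    have h2 : N.d 0 0 = 0 := N.shape _ _ (by simp)
    have h3 : dHom N 0 y = 0 := congrArg (fun f => f.hom y) h2
    rw [h1, barD_act, barD_ι, h3, map_zero, map_zero]

lemma barΦ_d (n : ℕ) (w : BarModule G N n) :
    barΦ L r (n - 1) (barD L r n w) = dHom T n (barΦ L r n w) := by
  induction n, w using bar_induction with
  | h0 n => simp
  | hadd n x y hx hy => simp only [map_add, hx, hy]
  | hsmul n g x hx => rw [barD_act, barΦ_act, barΦ_act, hx, transferAct_d]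
  | hι n y => rw [barD_ι, barΦ_ι, barΦ_ι, r.incl_d]
  | hS n w ih =>
    rw [barD_S, barΦ_S, r.d_htpy]
    change barΦ L r n _ = _
    rw [map_sub, map_sub, barΦ_ι, barΦ_shift, ih]
    rfl

lemma barE_d (n : ℕ) (w : BarModule G N n) :
    barE L r (n - 1) (barD L r n w) = dHom N n (barE L r n w) := by
  rw [barE_apply, barΦ_d, r.proj_d, barE_apply]

lemma barD_barD (n : ℕ) (w : BarModule G N n) : barD L r (n - 1) (barD L r n w) = 0 := by
  induction n, w using bar_induction with
  | h0 n => simp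
  | hadd n x y hx hy => simp only [map_add, hx, hy, add_zero]
  | hsmul n g x hx => rw [barD_act, barD_act, hx, map_zero]
  | hι n y => rw [barD_ι, barD_ι, dHom_dHom, map_zero]
  | hS n w ih =>
    rw [barD_S]
    cases n with
    | zero =>
      rw [barD_zero]
    | succ n =>
      change barD L r (n + 1) _ = _
      rw [map_sub, map_sub, barD_ι, ← barE_d, barSPred_succ, barD_S]
      have ih' : barD L r n (barD L r (n + 1) w) = 0 := ih
      rw [ih', map_zero]
      simp

end Bar

/-! ### Extending a reduction to bar constructions -/

section BarReduction

variable {G : Type u} [Group G] {M : ChainComplex (ModuleCat.{u} (MonoidAlgebra ℤ G)) ℕ}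
  {T N : ChainComplex (ModuleCat.{u} ℤ) ℕ}
  (L : Reduction T (underlying G M)) (r : Reduction T N)

lemma barΦ_refl_S (n : ℕ) (w : BarModule G T n) :
    barΦ L (Reduction.refl T) (n + 1) (barS G T n w) = 0 := by
  rw [barΦ_S, Reduction.refl_htpyHom, AddMonoidHom.zero_apply]

lemma barΦ_refl_ι (n : ℕ) (x : T.X n) : barΦ L (Reduction.refl T) n (barι G T n x) = x :=
  barΦ_ι L (Reduction.refl T) n x

lemma barE_refl (n : ℕ) (w : BarModule G T n) :
    barE L (Reduction.refl T) n w = barΦ L (Reduction.refl T) n w := rfl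

/-- The equivariant homotopy `g₀ | ⋯ | gₘ ⊗ x ↦ ± g₀ η g₁ η ⋯ gₘ η x` from the augmentation of the
bar construction of `T` to the map that factors through the bar construction of `N`. -/
noncomputable def barΨ (n : ℕ) : BarModule G T n →+ T.X (n + 1) :=
  barRec (P := fun n => T.X (n + 1)) (fun n => transferAct L (n + 1)) (fun n => -r.htpyHom n)
    (fun n => -r.htpyHom (n + 1)) 0 n

lemma barΨ_act (n : ℕ) (g : G) (w : BarModule G T n) :
    barΨ L r n (mulAct g w) = transferAct L (n + 1) g (barΨ L r n w) :=
  barRec_smul (P := fun n => T.X (n + 1)) (fun n => transferAct_mul L (n + 1)) n g w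

lemma barΨ_ι (n : ℕ) (x : T.X n) : barΨ L r n (barι G T n x) = -r.htpyHom n x :=
  barRec_ι (P := fun n => T.X (n + 1)) (fun n => transferAct_one L (n + 1)) n x

lemma barΨ_S (n : ℕ) (w : BarModule G T n) :
    barΨ L r (n + 1) (barS G T n w) = -r.htpyHom (n + 1) (barΨ L r n w) :=
  (barRec_S (P := fun n => T.X (n + 1)) (fun n => transferAct_one L (n + 1)) n w).trans
    (add_zero _)

/-- The projection from the bar construction of `T` to that of `N`. -/
noncomputable def barProj (n : ℕ) : BarModule G T n →+ BarModule G N n :=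
  barRec (fun _ => mulAct) (fun n => (barι G N n).comp (r.projHom n)) (barS G N)
    (fun n => (barι G N (n + 1)).comp ((r.projHom (n + 1)).comp (barΨ L r n))) n

lemma barProj_act (n : ℕ) (g : G) (w : BarModule G T n) :
    barProj L r n (mulAct g w) = mulAct g (barProj L r n w) :=
  barRec_smul (fun _ => mulAct_mul) n g w

lemma barProj_ι (n : ℕ) (x : T.X n) :
    barProj L r n (barι G T n x) = barι G N n (r.projHom n x) :=
  barRec_ι (fun _ => mulAct_one) n x

lemma barProj_S (n : ℕ) (w : BarModule G T n) :
    barProj L r (n + 1) (barS G T n w) =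
      barS G N n (barProj L r n w) + barι G N (n + 1) (r.projHom (n + 1) (barΨ L r n w)) :=
  barRec_S (fun _ => mulAct_one) n w

/-- The inclusion of the bar construction of `N` into that of `T`. -/
noncomputable def barIncl (n : ℕ) : BarModule G N n →+ BarModule G T n :=
  barRec (fun _ => mulAct) (fun n => (barι G T n).comp (r.inclHom n)) (barS G T)
    (fun n => (barι G T (n + 1)).comp ((r.htpyHom n).comp (barΦ L r n))) n

lemma barIncl_act (n : ℕ) (g : G) (w : BarModule G N n) :
    barIncl L r n (mulAct g w) = mulAct g (barIncl L r n w) :=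
  barRec_smul (fun _ => mulAct_mul) n g w

lemma barIncl_ι (n : ℕ) (y : N.X n) :
    barIncl L r n (barι G N n y) = barι G T n (r.inclHom n y) :=
  barRec_ι (fun _ => mulAct_one) n y

lemma barIncl_S (n : ℕ) (w : BarModule G N n) :
    barIncl L r (n + 1) (barS G N n w) =
      barS G T n (barIncl L r n w) + barι G T (n + 1) (r.htpyHom n (barΦ L r n w)) :=
  barRec_S (fun _ => mulAct_one) n w

/-- The homotopy operator on the bar construction of `T`. -/
noncomputable def barHtpy (n : ℕ) : BarModule G T n →+ BarModule G T (n + 1) :=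
  barRec (P := fun n => BarModule G T (n + 1)) (fun _ => mulAct)
    (fun n => (barι G T (n + 1)).comp (r.htpyHom n)) (fun n => -barS G T (n + 1))
    (fun n => (barι G T (n + 1 + 1)).comp ((r.htpyHom (n + 1)).comp (barΨ L r n))) n

lemma barHtpy_act (n : ℕ) (g : G) (w : BarModule G T n) :
    barHtpy L r n (mulAct g w) = mulAct g (barHtpy L r n w) :=
  barRec_smul (P := fun n => BarModule G T (n + 1)) (fun _ => mulAct_mul) n g w

lemma barHtpy_ι (n : ℕ) (x : T.X n) :
    barHtpy L r n (barι G T n x) = barι G T (n + 1) (r.htpyHom n x) :=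
  barRec_ι (P := fun n => BarModule G T (n + 1)) (fun _ => mulAct_one) n x

lemma barHtpy_S (n : ℕ) (w : BarModule G T n) :
    barHtpy L r (n + 1) (barS G T n w) = -barS G T (n + 1) (barHtpy L r n w) +
      barι G T (n + 1 + 1) (r.htpyHom (n + 1) (barΨ L r n w)) :=
  barRec_S (P := fun n => BarModule G T (n + 1)) (fun _ => mulAct_one) n w

/-- `barΨ` indexed by the degree of its target; it is zero into degree `0`. -/
noncomputable def barΨPred : ∀ n, BarModule G T (n - 1) →+ T.X n
  | 0 => 0
  | n + 1 => barΨ L r n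

/-- `barHtpy` indexed by the degree of its target; it is zero into degree `0`. -/
noncomputable def barHtpyPred : ∀ n, BarModule G T (n - 1) →+ BarModule G T n
  | 0 => 0
  | n + 1 => barHtpy L r n

lemma barΨPred_act (n : ℕ) (g : G) (w : BarModule G T (n - 1)) :
    barΨPred L r n (mulAct g w) = transferAct L n g (barΨPred L r n w) := by
  cases n with
  | zero => simp [barΨPred]
  | succ n => exact barΨ_act L r n g w

lemma barΨPred_ι (n : ℕ) (x : T.X (n - 1)) :
    barΨPred L r n (barι G T (n - 1) x) = -r.htpyPred n x := by
  cases n with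
  | zero => simp [barΨPred]
  | succ n => exact barΨ_ι L r n x

lemma barΨ_SPred (n : ℕ) (w : BarModule G T (n - 1)) :
    barΨ L r n (barSPred G T n w) = -r.htpyHom n (barΨPred L r n w) := by
  cases n with
  | zero => simp [barΨPred]
  | succ n => exact barΨ_S L r n w

lemma barProj_SPred (n : ℕ) (w : BarModule G T (n - 1)) :
    barProj L r n (barSPred G T n w) =
      barSPred G N n (barProj L r (n - 1) w) + barι G N n (r.projHom n (barΨPred L r n w)) := by
  cases n with
  | zero => simp [barΨPred]
  | succ n => exact barProj_S L r n w

lemma barIncl_SPred (n : ℕ) (w : BarModule G N (n - 1)) :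
    barIncl L r n (barSPred G N n w) =
      barSPred G T n (barIncl L r (n - 1) w) +
        barι G T n (r.htpyPred n (barΦ L r (n - 1) w)) := by
  cases n with
  | zero => simp
  | succ n => exact barIncl_S L r n w

lemma barHtpy_SPred (n : ℕ) (w : BarModule G T (n - 1)) :
    barHtpy L r n (barSPred G T n w) = -barS G T n (barHtpyPred L r n w) +
      barι G T (n + 1) (r.htpyHom n (barΨPred L r n w)) := by
  cases n with
  | zero => simp [barΨPred, barHtpyPred]
  | succ n => exact barHtpy_S L r n w

lemma barHtpyPred_ι (n : ℕ) (x : T.X (n - 1)) :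
    barHtpyPred L r n (barι G T (n - 1) x) = barι G T n (r.htpyPred n x) := by
  cases n with
  | zero => simp [barHtpyPred]
  | succ n => exact barHtpy_ι L r n x

lemma barHtpyPred_act (n : ℕ) (g : G) (w : BarModule G T (n - 1)) :
    barHtpyPred L r n (mulAct g w) = mulAct g (barHtpyPred L r n w) := by
  cases n with
  | zero => simp [barHtpyPred]
  | succ n => exact barHtpy_act L r n g w

lemma barΦ_barIncl (n : ℕ) (w : BarModule G N n) :
    barΦ L (Reduction.refl T) n (barIncl L r n w) = barΦ L r n w := by
  induction n, w using bar_induction with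
  | h0 n => simp
  | hadd n x y hx hy => simp only [map_add, hx, hy]
  | hsmul n g x hx => rw [barIncl_act, barΦ_act, hx, barΦ_act]
  | hι n y => rw [barIncl_ι, barΦ_refl_ι, barΦ_ι]
  | hS n w ih => rw [barIncl_S, map_add, barΦ_refl_S, barΦ_refl_ι, barΦ_S, zero_add]

lemma barΦ_barHtpy (n : ℕ) (w : BarModule G T n) :
    barΦ L (Reduction.refl T) (n + 1) (barHtpy L r n w) = -barΨ L r n w := by
  induction n, w using bar_induction with
  | h0 n => simp
  | hadd n x y hx hy => simp only [map_add, hx, hy, neg_add]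
  | hsmul n g x hx => rw [barHtpy_act, barΦ_act, hx, barΨ_act, map_neg]
  | hι n y => rw [barHtpy_ι, barΦ_refl_ι, barΨ_ι, neg_neg]
  | hS n w ih => rw [barHtpy_S, map_add, map_neg, barΦ_refl_S, barΦ_refl_ι, barΨ_S]; simp

lemma barΨ_barIncl (n : ℕ) (w : BarModule G N n) : barΨ L r n (barIncl L r n w) = 0 := by
  induction n, w using bar_induction with
  | h0 n => simp
  | hadd n x y hx hy => simp only [map_add, hx, hy, add_zero]
  | hsmul n g x hx => rw [barIncl_act, barΨ_act, hx, map_zero]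
  | hι n y => rw [barIncl_ι, barΨ_ι]; simp
  | hS n w ih => rw [barIncl_S, map_add, barΨ_S, ih, barΨ_ι]; simp

lemma barΨ_barHtpy (n : ℕ) (w : BarModule G T n) :
    barΨ L r (n + 1) (barHtpy L r n w) = 0 := by
  induction n, w using bar_induction with
  | h0 n => simp
  | hadd n x y hx hy => simp only [map_add, hx, hy, add_zero]
  | hsmul n g x hx => rw [barHtpy_act, barΨ_act, hx, map_zero]
  | hι n y => rw [barHtpy_ι, barΨ_ι]; simp
  | hS n w ih => rw [barHtpy_S, map_add, map_neg, barΨ_S, ih, barΨ_ι]; simp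

lemma barΨ_d (n : ℕ) (w : BarModule G T n) :
    @Eq (T.X n) (dHom T (n + 1) (barΨ L r n w))
      (barΦ L r n (barProj L r n w) - barΦ L (Reduction.refl T) n w -
        barΨPred L r n (barD L (Reduction.refl T) n w)) := by
  induction n, w using bar_induction with
  | h0 n => simp
  | hadd n x y hx hy =>
    rw [map_add, map_add, hx, hy]
    simp only [map_add]
    abel
  | hsmul n g x hx =>
    rw [barΨ_act, ← transferAct_d, barD_act, barΨPred_act, barProj_act, barΦ_act, barΦ_act,
      ← map_sub, ← map_sub, ← hx]
    rfl
  | hι n y =>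
    rw [barΨ_ι, map_neg, r.d_htpy, barProj_ι, barΦ_ι, barΦ_refl_ι, barD_ι, barΨPred_ι]
    abel
  | hS n w ih =>
    rw [barΨ_S, map_neg, r.d_htpy, barProj_S, map_add, barΦ_S, barΦ_ι, barΦ_refl_S, barD_S,
      r.htpyPred_succ, ih]
    change _ = _ - barΨ L r n _
    simp only [map_sub]
    rw [barΨ_ι, barΨ_SPred, barE_refl]
    abel

lemma barProj_d (n : ℕ) (w : BarModule G T n) :
    barProj L r (n - 1) (barD L (Reduction.refl T) n w) = barD L r n (barProj L r n w) := by
  induction n, w using bar_induction with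
  | h0 n => simp
  | hadd n x y hx hy => simp only [map_add, hx, hy]
  | hsmul n g x hx => rw [barD_act, barProj_act, hx, barProj_act, barD_act]
  | hι n y => rw [barD_ι, barProj_ι, barProj_ι, barD_ι, r.proj_d]
  | hS n w ih =>
    rw [barD_S, barProj_S, map_add, barD_S, barD_ι, ← r.proj_d]
    change barProj L r n _ = _ + barι G N n (r.projHom n _)
    rw [barΨ_d, map_sub, map_sub, barProj_ι, barProj_SPred, ih, barE_refl, map_sub, map_sub,
      map_sub, map_sub, barE_apply]
    abel

lemma barIncl_d (n : ℕ) (w : BarModule G N n) :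
    barIncl L r (n - 1) (barD L r n w) = barD L (Reduction.refl T) n (barIncl L r n w) := by
  induction n, w using bar_induction with
  | h0 n => simp
  | hadd n x y hx hy => simp only [map_add, hx, hy]
  | hsmul n g x hx => rw [barD_act, barIncl_act, hx, barIncl_act, barD_act]
  | hι n y => rw [barD_ι, barIncl_ι, barIncl_ι, barD_ι, r.incl_d]
  | hS n w ih =>
    rw [barD_S, barIncl_S, map_add, barD_S, barD_ι, r.d_htpy]
    change barIncl L r n _ = _ + barι G T n _
    rw [map_sub, map_sub, barIncl_ι, barIncl_SPred, ih, barE_refl, map_sub, map_sub,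
      barΦ_barIncl, barΦ_d, barE_apply]
    abel

lemma barProj_barIncl (n : ℕ) (w : BarModule G N n) :
    barProj L r n (barIncl L r n w) = w := by
  induction n, w using bar_induction with
  | h0 n => simp
  | hadd n x y hx hy => simp only [map_add, hx, hy]
  | hsmul n g x hx => rw [barIncl_act, barProj_act, hx]
  | hι n y => rw [barIncl_ι, barProj_ι, r.proj_incl]
  | hS n w ih => rw [barIncl_S, map_add, barProj_S, ih, barProj_ι, barΨ_barIncl]; simp

lemma barProj_barHtpy (n : ℕ) (w : BarModule G T n) :
    barProj L r (n + 1) (barHtpy L r n w) = 0 := by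
  induction n, w using bar_induction with
  | h0 n => simp
  | hadd n x y hx hy => simp only [map_add, hx, hy, add_zero]
  | hsmul n g x hx => rw [barHtpy_act, barProj_act, hx, map_zero]
  | hι n y => rw [barHtpy_ι, barProj_ι]; simp
  | hS n w ih =>
    rw [barHtpy_S, map_add, map_neg, barProj_S, ih, barProj_ι, barΨ_barHtpy]; simp

lemma barHtpy_barIncl (n : ℕ) (w : BarModule G N n) :
    barHtpy L r n (barIncl L r n w) = 0 := by
  induction n, w using bar_induction with
  | h0 n => simp
  | hadd n x y hx hy => simp only [map_add, hx, hy, add_zero]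
  | hsmul n g x hx => rw [barIncl_act, barHtpy_act, hx, map_zero]
  | hι n y => rw [barIncl_ι, barHtpy_ι]; simp
  | hS n w ih => rw [barIncl_S, map_add, barHtpy_S, ih, barHtpy_ι, barΨ_barIncl]; simp

lemma barHtpy_barHtpy (n : ℕ) (w : BarModule G T n) :
    barHtpy L r (n + 1) (barHtpy L r n w) = 0 := by
  induction n, w using bar_induction with
  | h0 n => simp
  | hadd n x y hx hy => simp only [map_add, hx, hy, add_zero]
  | hsmul n g x hx => rw [barHtpy_act, barHtpy_act, hx, map_zero]
  | hι n y => rw [barHtpy_ι, barHtpy_ι]; simp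
  | hS n w ih =>
    rw [barHtpy_S, map_add, map_neg, barHtpy_S, ih, barHtpy_ι, barΨ_barHtpy]; simp

lemma barHtpy_d (n : ℕ) (w : BarModule G T n) :
    @Eq (BarModule G T n) (barD L (Reduction.refl T) (n + 1) (barHtpy L r n w))
      (w - barIncl L r n (barProj L r n w) -
        barHtpyPred L r n (barD L (Reduction.refl T) n w)) := by
  induction n, w using bar_induction with
  | h0 n => simp
  | hadd n x y hx hy =>
    rw [map_add, map_add, hx, hy]
    simp only [map_add]
    abel
  | hsmul n g x hx =>
    rw [barHtpy_act, barD_act, barD_act, barHtpyPred_act, barProj_act, barIncl_act]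
    exact (congrArg (mulAct g) hx).trans (by rw [map_sub, map_sub])
  | hι n y =>
    rw [barHtpy_ι, barD_ι, r.d_htpy, barProj_ι, barIncl_ι, barD_ι, barHtpyPred_ι]
    change barι G T n _ = _
    rw [map_sub, map_sub]
  | hS n w ih =>
    rw [barHtpy_S, map_add, map_neg, barD_S, barD_ι, r.d_htpy, r.htpyPred_succ, barProj_S, map_add,
      barIncl_S, barIncl_ι, barD_S, barSPred_succ, ih, barΨ_d, barE_refl, barΦ_barHtpy]
    change _ + barι G T (n + 1) _ = _ - barHtpy L r n _
    simp only [map_sub, map_neg]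
    rw [barHtpy_ι, barHtpy_SPred, barE_refl]
    abel

end BarReduction

/-! ### Constructions of reductions -/

namespace Reduction

section OfLinear

variable {R : Type*} [Ring R] {C D : ChainComplex (ModuleCat.{u} R) ℕ}
  (p : ∀ n, C.X n →ₗ[R] D.X n) (i : ∀ n, D.X n →ₗ[R] C.X n) (h : ∀ n, C.X n →ₗ[R] C.X (n + 1))

/-- The chain map with given linear components. -/
def chainMapOfLinear (hp : ∀ n x, p n ((C.d (n + 1) n).hom x) = (D.d (n + 1) n).hom (p (n + 1) x)) :
    C ⟶ D where
  f n := ModuleCat.ofHom (p n)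
  comm' m n hmn := by
    obtain rfl : n + 1 = m := hmn
    ext x
    exact (hp n x).symm

/-- A reduction given by linear maps. The homotopy equation is stated separately in degree `0`. -/
noncomputable def ofLinear
    (hp : ∀ n x, p n ((C.d (n + 1) n).hom x) = (D.d (n + 1) n).hom (p (n + 1) x))
    (hi : ∀ n x, i n ((D.d (n + 1) n).hom x) = (C.d (n + 1) n).hom (i (n + 1) x))
    (hpi : ∀ n x, p n (i n x) = x) (hph : ∀ n x, p (n + 1) (h n x) = 0)
    (hhi : ∀ n x, h n (i n x) = 0) (hhh : ∀ n x, h (n + 1) (h n x) = 0)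
    (h0 : ∀ x, (C.d 1 0).hom (h 0 x) = x - i 0 (p 0 x))
    (hs : ∀ n x, (C.d (n + 1 + 1) (n + 1)).hom (h (n + 1) x) =
      x - i (n + 1) (p (n + 1) x) - h n ((C.d (n + 1) n).hom x)) :
    Reduction C D where
  proj := chainMapOfLinear p hp
  incl := chainMapOfLinear i hi
  htpy :=
    { hom := fun m n => if e : m + 1 = n then
        ModuleCat.ofHom (h m) ≫ eqToHom (congrArg C.X e) else 0
      zero := fun m n hmn => dif_neg hmn
      comm := fun n => by
        cases n with
        | zero =>
          rw [prevD_eq _ (show (ComplexShape.down ℕ).Rel 1 0 by simp),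
            dNext_eq_zero _ _ (by simp)]
          ext x
          simp [h0, chainMapOfLinear]
        | succ n =>
          rw [prevD_eq _ (show (ComplexShape.down ℕ).Rel (n + 1 + 1) (n + 1) by simp),
            dNext_eq _ (show (ComplexShape.down ℕ).Rel (n + 1) n by simp)]
          ext x
          simp [hs, chainMapOfLinear] }
  incl_proj := by
    ext n x
    exact hpi n x
  htpy_proj n := by
    ext x
    simp [chainMapOfLinear, hph]
  incl_htpy n := by
    ext x
    simp [chainMapOfLinear, hhi]
  htpy_htpy n := by
    ext x
    simp [hhh]

section

variable {p i h} {hp : ∀ n x, p n ((C.d (n + 1) n).hom x) = (D.d (n + 1) n).hom (p (n + 1) x)}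
    {hi : ∀ n x, i n ((D.d (n + 1) n).hom x) = (C.d (n + 1) n).hom (i (n + 1) x)}
    {hpi : ∀ n x, p n (i n x) = x} {hph : ∀ n x, p (n + 1) (h n x) = 0}
    {hhi : ∀ n x, h n (i n x) = 0} {hhh : ∀ n x, h (n + 1) (h n x) = 0}
    {h0 : ∀ x, (C.d 1 0).hom (h 0 x) = x - i 0 (p 0 x)}
    {hs : ∀ n x, (C.d (n + 1 + 1) (n + 1)).hom (h (n + 1) x) =
      x - i (n + 1) (p (n + 1) x) - h n ((C.d (n + 1) n).hom x)}

lemma ofLinear_htpyHom (n : ℕ) (x : C.X n) :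
    (ofLinear p i h hp hi hpi hph hhi hhh h0 hs).htpyHom n x = h n x := by
  simp [ofLinear, htpyHom]

end

/-- The operator `h₁ ∂ h₁` with `h₁ = h (1 - i p)`, which satisfies the side conditions of a
reduction if `h` is any homotopy from `1` to `i p` with `p h = 0`. -/
noncomputable def normalizedHtpy (n : ℕ) : C.X n →ₗ[R] C.X (n + 1) :=
  (h n ∘ₗ (LinearMap.id - i n ∘ₗ p n)) ∘ₗ (C.d (n + 1) n).hom ∘ₗ
    (h n ∘ₗ (LinearMap.id - i n ∘ₗ p n))

lemma normalizedHtpy_apply (n : ℕ) (x : C.X n) :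
    normalizedHtpy p i h n x =
      h n ((C.d (n + 1) n).hom (h n (x - i n (p n x))) -
        i n (p n ((C.d (n + 1) n).hom (h n (x - i n (p n x)))))) := rfl

/-- A reduction from a homotopy operator that need not satisfy the side conditions `h i = 0`
and `h h = 0`. -/
noncomputable def ofHomotopy
    (hp : ∀ n x, p n ((C.d (n + 1) n).hom x) = (D.d (n + 1) n).hom (p (n + 1) x))
    (hi : ∀ n x, i n ((D.d (n + 1) n).hom x) = (C.d (n + 1) n).hom (i (n + 1) x))
    (hpi : ∀ n x, p n (i n x) = x) (hph : ∀ n x, p (n + 1) (h n x) = 0)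
    (h0 : ∀ x, (C.d 1 0).hom (h 0 x) = x - i 0 (p 0 x))
    (hs : ∀ n x, (C.d (n + 1 + 1) (n + 1)).hom (h (n + 1) x) =
      x - i (n + 1) (p (n + 1) x) - h n ((C.d (n + 1) n).hom x)) :
    Reduction C D :=
  have dd : ∀ n x, (C.d (n + 1) n).hom ((C.d (n + 1 + 1) (n + 1)).hom x) = 0 := fun n x =>
    congrArg (fun f => f.hom x) (C.d_comp_d (n + 1 + 1) (n + 1) n)
  have hpd : ∀ n x, p n ((C.d (n + 1) n).hom (h n x)) = 0 := fun n x => by rw [hp, hph, map_zero]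
  have hN : ∀ n x, normalizedHtpy p i h n x =
      h n ((C.d (n + 1) n).hom (h n (x - i n (p n x)))) := fun n x => by
    rw [normalizedHtpy_apply, hpd, map_zero, sub_zero]
  -- On the image of `∂ h₁` the operator `∂ h₁` is the identity.
  have hdd : ∀ n x, (C.d (n + 1) n).hom (h n ((C.d (n + 1) n).hom (h n x))) =
      (C.d (n + 1) n).hom (h n x) := fun n x => by
    cases n with
    | zero => rw [h0, hpd, map_zero, sub_zero]
    | succ n => rw [hs, hpd, map_zero, sub_zero, dd, map_zero, sub_zero]
  ofLinear p i (normalizedHtpy p i h) hp hi hpi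
    (fun n x => by rw [hN, hph])
    (fun n x => by rw [hN, hpi]; simp)
    (fun n x => by
      rw [hN, hN, hph, map_zero, sub_zero, hs, hph, map_zero, sub_zero, hdd, sub_self, map_zero])
    (fun x => by
      rw [hN, hdd, h0, map_sub, hpi, sub_self, map_zero, sub_zero])
    (fun n x => by
      rw [hN, hN, hdd, hs, map_sub (p _), hpi, sub_self, map_zero, sub_zero, map_sub, ← hi, hp]
      congr 2
      cases n with
      | zero => rw [h0, map_sub (p 0), hpi, hp]; simp
      | succ n =>
        have hd : (C.d (n + 1) n).hom (i (n + 1) ((D.d (n + 1 + 1) (n + 1)).hom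
            (p (n + 1 + 1) x))) = 0 := by
          rw [← hi, ← hp, ← hp, dd, map_zero, map_zero]
        rw [hs, map_sub (p _), hpi, hp, map_sub _ _ (i _ _), hd, dd]
        simp)

end OfLinear

/-- The composite of two reductions. -/
noncomputable def trans {R : Type*} [Ring R] {C D E : ChainComplex (ModuleCat.{u} R) ℕ}
    (r : Reduction C D) (s : Reduction D E) : Reduction C E :=
  ofLinear (fun n => (s.proj.f n).hom ∘ₗ (r.proj.f n).hom)
    (fun n => (r.incl.f n).hom ∘ₗ (s.incl.f n).hom)
    (fun n => (r.htpy.hom n (n + 1)).hom +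
      (r.incl.f (n + 1)).hom ∘ₗ (s.htpy.hom n (n + 1)).hom ∘ₗ (r.proj.f n).hom)
    (fun n x => (congrArg (s.projHom n) (r.proj_d (n + 1) x)).trans (s.proj_d (n + 1) _))
    (fun n x => (congrArg (r.inclHom n) (s.incl_d (n + 1) x)).trans (r.incl_d (n + 1) _))
    (fun n x => (congrArg (s.projHom n) (r.proj_incl n _)).trans (s.proj_incl n x))
    (fun n x => by
      change s.projHom (n + 1) (r.projHom (n + 1) (r.htpyHom n x +
        r.inclHom (n + 1) (s.htpyHom n (r.projHom n x)))) = 0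
      simp)
    (fun n x => by
      change r.htpyHom n (r.inclHom n (s.inclHom n x)) +
        r.inclHom (n + 1) (s.htpyHom n (r.projHom n (r.inclHom n (s.inclHom n x)))) = 0
      simp)
    (fun n x => by
      change r.htpyHom (n + 1) (r.htpyHom n x +
        r.inclHom (n + 1) (s.htpyHom n (r.projHom n x))) + r.inclHom (n + 1 + 1)
          (s.htpyHom (n + 1) (r.projHom (n + 1) (r.htpyHom n x +
            r.inclHom (n + 1) (s.htpyHom n (r.projHom n x))))) = 0
      simp)
    (fun x => by
      have h1 := r.d_htpy 0 x
      have h2 := s.d_htpy 0 (r.projHom 0 x)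
      have h3 := (r.incl_d 1 (s.htpyHom 0 (r.projHom 0 x))).symm
      rw [htpyPred_zero, AddMonoidHom.zero_apply, sub_zero] at h1 h2
      change dHom C 1 (r.htpyHom 0 x + r.inclHom 1 (s.htpyHom 0 (r.projHom 0 x))) =
        x - r.inclHom 0 (s.inclHom 0 (s.projHom 0 (r.projHom 0 x)))
      rw [map_add, h1, h3]
      change _ + r.inclHom 0 _ = _
      rw [h2, map_sub]
      abel)
    (fun n x => by
      have h1 := r.d_htpy (n + 1) x
      have h2 := s.d_htpy (n + 1) (r.projHom (n + 1) x)
      have h3 := (r.incl_d (n + 2) (s.htpyHom (n + 1) (r.projHom (n + 1) x))).symm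
      have h4 := r.proj_d (n + 1) x
      rw [htpyPred_succ] at h1 h2
      change dHom C (n + 2) (r.htpyHom (n + 1) x +
        r.inclHom (n + 2) (s.htpyHom (n + 1) (r.projHom (n + 1) x))) =
        x - r.inclHom (n + 1) (s.inclHom (n + 1) (s.projHom (n + 1) (r.projHom (n + 1) x))) -
          (r.htpyHom n (dHom C (n + 1) x) +
            r.inclHom (n + 1) (s.htpyHom n (r.projHom n (dHom C (n + 1) x))))
      rw [map_add, h1, h3]
      change _ + r.inclHom (n + 1) _ = _
      rw [h2, map_sub, map_sub, ← h4]
      change _ + (_ - _ - r.inclHom (n + 1) (s.htpyHom n (r.projHom n (dHom C (n + 1) x)))) = _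
      abel)

section

variable {R : Type*} [Ring R] {C D E : ChainComplex (ModuleCat.{u} R) ℕ}
  (r : Reduction C D) (s : Reduction D E)

lemma trans_htpyHom (n : ℕ) (x : C.X n) :
    (r.trans s).htpyHom n x =
      r.htpyHom n x + r.inclHom (n + 1) (s.htpyHom n (r.projHom n x)) := by
  exact ofLinear_htpyHom n x

end

end Reduction

/-! ### The bar construction as a complex, and the reductions between bar constructions -/

section BarComplex

variable {G : Type u} [Group G] {M : ChainComplex (ModuleCat.{u} (MonoidAlgebra ℤ G)) ℕ}
  {T N : ChainComplex (ModuleCat.{u} ℤ) ℕ}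
  (L : Reduction T (underlying G M)) (r : Reduction T N)

/-- The bar construction of `N` with the transferred structure, as a complex of `ℤ[G]`-modules. -/
noncomputable def barComplex : ChainComplex (ModuleCat.{u} (MonoidAlgebra ℤ G)) ℕ :=
  ChainComplex.of (fun n => ModuleCat.of (MonoidAlgebra ℤ G) (BarModule G N n))
    (fun n => ModuleCat.ofHom (linearOfEquivariant (barD L r (n + 1)) (barD_act L r (n + 1))))
    (fun n => ModuleCat.hom_ext (LinearMap.ext fun w => barD_barD L r (n + 2) w))

lemma barComplex_d (n : ℕ) (w : BarModule G N (n + 1)) :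
    ((barComplex L r).d (n + 1) n).hom w = barD L r (n + 1) w := by
  have h : (barComplex L r).d (n + 1) n =
      ModuleCat.ofHom (linearOfEquivariant (barD L r (n + 1)) (barD_act L r (n + 1))) :=
    ChainComplex.of_d (fun n => ModuleCat.of (MonoidAlgebra ℤ G) (BarModule G N n))
      (fun n => ModuleCat.ofHom (linearOfEquivariant (barD L r (n + 1)) (barD_act L r (n + 1)))) n
  rw [h]
  rfl

/-- The reduction of bar constructions induced by the reduction `r : T ⇒ N`. -/
noncomputable def barReduction :
    Reduction (barComplex L (Reduction.refl T)) (barComplex L r) :=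
  Reduction.ofLinear (C := barComplex L (Reduction.refl T)) (D := barComplex L r)
    (fun n => linearOfEquivariant (barProj L r n) (barProj_act L r n))
    (fun n => linearOfEquivariant (barIncl L r n) (barIncl_act L r n))
    (fun n => linearOfEquivariant (barHtpy L r n) (barHtpy_act L r n))
    (fun n x => (congrArg (barProj L r n) (barComplex_d L _ n x)).trans
      ((barProj_d L r (n + 1) x).trans (barComplex_d L r n _).symm))
    (fun n x => (congrArg (barIncl L r n) (barComplex_d L r n x)).trans
      ((barIncl_d L r (n + 1) x).trans (barComplex_d L _ n _).symm))
    (barProj_barIncl L r) (barProj_barHtpy L r) (barHtpy_barIncl L r) (barHtpy_barHtpy L r)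
    (fun (x : BarModule G T 0) => (barComplex_d L _ 0 _).trans
      ((barHtpy_d L r 0 x).trans (sub_zero (x - barIncl L r 0 (barProj L r 0 x)))))
    (fun n (x : BarModule G T (n + 1)) => (barComplex_d L _ (n + 1) _).trans
      ((barHtpy_d L r (n + 1) x).trans (congrArg (fun y =>
        x - barIncl L r (n + 1) (barProj L r (n + 1) x) - barHtpy L r n y)
          (barComplex_d L _ n x).symm)))

lemma barReduction_htpyHom (n : ℕ) (w : BarModule G T n) :
    (barReduction L r).htpyHom n w = barHtpy L r n w := by
  exact Reduction.ofLinear_htpyHom (C := barComplex L (Reduction.refl T)) n w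

end BarComplex

/-! ### The bar construction of a complex of free modules -/

section Resolution

variable {G : Type u} [Group G] {M : ChainComplex (ModuleCat.{u} (MonoidAlgebra ℤ G)) ℕ}
  {T : ChainComplex (ModuleCat.{u} ℤ) ℕ} (L : Reduction T (underlying G M))

/-- The augmentation `g₀ ⊗ x ↦ g₀ x` of the bar construction of `M`, as a map to `M`. -/
noncomputable def barAug (n : ℕ) : BarModule G (underlying G M) n →+ M.X n := barE L L n

lemma barAug_act (n : ℕ) (g : G) (w : BarModule G (underlying G M) n) :
    barAug L n (mulAct g w) = mulAct g (barAug L n w) := by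
  change L.projHom n (barΦ L L n (mulAct g w)) = _
  rw [barΦ_act, proj_transferAct]
  rfl

/-- The inclusion `x ↦ 1 ⊗ x` of `M` into the bar construction of the underlying complex. -/
noncomputable def barUnit (M : ChainComplex (ModuleCat.{u} (MonoidAlgebra ℤ G)) ℕ) (n : ℕ) :
    M.X n →+ BarModule G (underlying G M) n :=
  barι G (underlying G M) n

lemma bar_induction_unit {Q : ∀ n, BarModule G (underlying G M) n → Prop} (h0 : ∀ n, Q n 0)
    (hadd : ∀ n x y, Q n x → Q n y → Q n (x + y))
    (hsmul : ∀ n (g : G) x, Q n x → Q n (mulAct g x))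
    (hu : ∀ n (y : M.X n), Q n (barUnit M n y))
    (hS : ∀ n w, Q n w → Q (n + 1) (barS G (underlying G M) n w)) (n : ℕ)
    (w : BarModule G (underlying G M) n) : Q n w :=
  bar_induction h0 hadd hsmul hu hS n w

lemma barAug_unit (n : ℕ) (x : M.X n) : barAug L n (barUnit M n x) = x :=
  barE_ι L L n x

lemma barD_unit (n : ℕ) (x : M.X n) :
    barD L L n (barUnit M n x) = barUnit M (n - 1) (dHom M n x) :=
  barD_ι L L n x

lemma barD_S_unit (n : ℕ) (w : BarModule G (underlying G M) n) :
    @Eq (BarModule G (underlying G M) n) (barD L L (n + 1) (barS G (underlying G M) n w))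
      (w - barUnit M n (barAug L n w) - barSPred G (underlying G M) n (barD L L n w)) :=
  barD_S L L n w

lemma barAug_S (n : ℕ) (w : BarModule G (underlying G M) n) :
    barAug L (n + 1) (barS G (underlying G M) n w) = 0 := by
  change L.projHom (n + 1) (barΦ L L (n + 1) _) = 0
  rw [barΦ_S, L.proj_htpy]

lemma barAug_SPred (n : ℕ) (w : BarModule G (underlying G M) (n - 1)) :
    barAug L n (barSPred G (underlying G M) n w) = 0 := by
  cases n with
  | zero => simp
  | succ n => exact barAug_S L n w

lemma barAug_d (n : ℕ) (w : BarModule G (underlying G M) n) :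
    barAug L (n - 1) (barD L L n w) = dHom M n (barAug L n w) :=
  barE_d L L n w

variable {ℓ : ℕ → Type*} (b : ∀ n, Module.Basis (ℓ n) (MonoidAlgebra ℤ G) (M.X n))

/-- The equivariant section of the augmentation that is given on basis elements by
`σ x = 1 ⊗ x + s (σ (∂ x))`, where `s` is the extra degeneracy. -/
noncomputable def barSection :
    ∀ n, M.X n →ₗ[MonoidAlgebra ℤ G] BarModule G (underlying G M) n
  | 0 => (b 0).constr ℕ fun i => barUnit M 0 (b 0 i)
  | n + 1 => (b (n + 1)).constr ℕ fun i => barUnit M (n + 1) (b (n + 1) i) +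
      barS G (underlying G M) n (barSection n (dHom M (n + 1) (b (n + 1) i)))

lemma barSection_basis (n : ℕ) (i : ℓ n) :
    barSection b n (b n i) = barUnit M n (b n i) +
      barSPred G (underlying G M) n (barSection b (n - 1) (dHom M n (b n i))) := by
  cases n with
  | zero => simp [barSection]
  | succ n =>
    rw [barSection, Module.Basis.constr_basis]
    rfl

lemma barSection_act (n : ℕ) (g : G) (x : M.X n) :
    barSection b n (mulAct g x) = mulAct g (barSection b n x) :=
  map_smul (barSection b n) _ x

lemma barAug_barSection (n : ℕ) (x : M.X n) : barAug L n (barSection b n x) = x := by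
  have h : linearOfEquivariant (barAug L n) (barAug_act L n) ∘ₗ barSection b n =
      LinearMap.id := by
    refine (b n).ext fun i => ?_
    rw [LinearMap.comp_apply, linearOfEquivariant_apply, barSection_basis, map_add, barAug_unit,
      barAug_SPred, add_zero]
    rfl
  exact LinearMap.congr_fun h x

lemma barSection_d (n : ℕ) (x : M.X n) :
    barD L L n (barSection b n x) = barSection b (n - 1) (dHom M n x) := by
  cases n with
  | zero =>
    have h : dHom M 0 x = 0 := by
      have h2 : M.d 0 0 = 0 := M.shape _ _ (by simp)
      exact congrArg (fun f => f.hom x) h2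
    rw [h, barD_zero, map_zero]
  | succ n =>
    induction n with
    | zero =>
      have h : linearOfEquivariant (barD L L 1) (barD_act L L 1) ∘ₗ barSection b 1 =
          barSection b 0 ∘ₗ (M.d 1 0).hom := by
        refine (b 1).ext fun i => ?_
        rw [LinearMap.comp_apply, linearOfEquivariant_apply, barSection_basis, map_add, barD_unit L,
          barSPred_succ, barD_S_unit L, barD_zero]
        rw [barAug_barSection, map_zero, sub_zero]
        exact add_sub_cancel _ _
      exact LinearMap.congr_fun h x
    | succ n ih =>
      have h : linearOfEquivariant (barD L L (n + 1 + 1)) (barD_act L L (n + 1 + 1)) ∘ₗ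
          barSection b (n + 1 + 1) = barSection b (n + 1) ∘ₗ (M.d (n + 1 + 1) (n + 1)).hom := by
        refine (b (n + 1 + 1)).ext fun i => ?_
        rw [LinearMap.comp_apply, linearOfEquivariant_apply, barSection_basis, map_add, barD_unit L,
          barSPred_succ, barD_S_unit]
        change _ + (barSection b (n + 1) _ - barUnit M (n + 1) (barAug L (n + 1)
          (barSection b (n + 1) (dHom M (n + 1 + 1) _))) - barSPred G (underlying G M) (n + 1)
            (barD L L (n + 1) (barSection b (n + 1) (dHom M (n + 1 + 1) _)))) = _
        rw [barAug_barSection, ih]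
        have h0 := dHom_dHom M (n + 1 + 1) (b (n + 1 + 1) i)
        change dHom M (n + 1) (dHom M (n + 1 + 1) (b (n + 1 + 1) i)) = 0 at h0
        rw [h0, map_zero, map_zero, sub_zero]
        exact add_sub_cancel _ _
      exact LinearMap.congr_fun h x

/-- `barSection` as an additive map on the underlying complex. -/
noncomputable def barSectionHom (n : ℕ) :
    (underlying G M).X n →+ BarModule G (underlying G M) n :=
  (barSection b n).toAddMonoidHom

/-- An equivariant homotopy from the identity of the bar construction of `M` to the section
composed with the augmentation. -/
noncomputable def barContr (n : ℕ) :
    BarModule G (underlying G M) n →+ BarModule G (underlying G M) (n + 1) :=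
  barRec (P := fun n => BarModule G (underlying G M) (n + 1)) (fun _ => mulAct)
    (fun n => -(barS G (underlying G M) n).comp (barSectionHom b n))
    (fun n => -barS G (underlying G M) (n + 1)) 0 n

lemma barContr_act (n : ℕ) (g : G) (w : BarModule G (underlying G M) n) :
    barContr b n (mulAct g w) = mulAct g (barContr b n w) :=
  barRec_smul (P := fun n => BarModule G (underlying G M) (n + 1)) (fun _ => mulAct_mul) n g w

lemma barContr_unit (n : ℕ) (x : M.X n) :
    barContr b n (barUnit M n x) =
      -barS G (underlying G M) n (barSection b n x) :=
  barRec_ι (N := underlying G M) (P := fun n => BarModule G (underlying G M) (n + 1))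
    (a := fun n => -(barS G (underlying G M) n).comp (barSectionHom b n)) (fun _ => mulAct_one) n x

lemma barContr_S (n : ℕ) (w : BarModule G (underlying G M) n) :
    barContr b (n + 1) (barS G (underlying G M) n w) =
      -barS G (underlying G M) (n + 1) (barContr b n w) :=
  (barRec_S (P := fun n => BarModule G (underlying G M) (n + 1)) (fun _ => mulAct_one) n w).trans
    (add_zero _)

/-- `barContr` indexed by the degree of its target; it is zero into degree `0`. -/
noncomputable def barContrPred :
    ∀ n, BarModule G (underlying G M) (n - 1) →+ BarModule G (underlying G M) n
  | 0 => 0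
  | n + 1 => barContr b n

lemma barContrPred_act (n : ℕ) (g : G) (w : BarModule G (underlying G M) (n - 1)) :
    barContrPred b n (mulAct g w) = mulAct g (barContrPred b n w) := by
  cases n with
  | zero => simp [barContrPred]
  | succ n => exact barContr_act b n g w

lemma barContrPred_unit (n : ℕ) (x : M.X (n - 1)) :
    barContrPred b n (barUnit M (n - 1) x) =
      -barSPred G (underlying G M) n (barSection b (n - 1) x) := by
  cases n with
  | zero => exact (neg_zero (G := BarModule G (underlying G M) 0)).symm
  | succ n => exact barContr_unit b n x

lemma barContr_SPred (n : ℕ) (w : BarModule G (underlying G M) (n - 1)) :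
    barContr b n (barSPred G (underlying G M) n w) =
      -barS G (underlying G M) n (barContrPred b n w) := by
  cases n with
  | zero => simp [barContrPred]
  | succ n => exact barContr_S b n w

lemma barAug_barContr (n : ℕ) (w : BarModule G (underlying G M) n) :
    barAug L (n + 1) (barContr b n w) = 0 := by
  induction n, w using bar_induction_unit with
  | h0 n => simp
  | hadd n x y hx hy => simp only [map_add, hx, hy, add_zero]
  | hsmul n g x hx => rw [barContr_act, barAug_act, hx, map_zero]
  | hu n y =>
    rw [barContr_unit, map_neg, barAug_S, neg_zero]
  | hS n w ih => rw [barContr_S, map_neg, barAug_S, neg_zero]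

lemma barContr_d (n : ℕ) (w : BarModule G (underlying G M) n) :
    @Eq (BarModule G (underlying G M) n) (barD L L (n + 1) (barContr b n w))
      (w - barSection b n (barAug L n w) - barContrPred b n (barD L L n w)) := by
  induction n, w using bar_induction_unit with
  | h0 n => simp
  | hadd n x y hx hy =>
    rw [map_add, map_add, hx, hy]
    simp only [map_add]
    abel
  | hsmul n g x hx =>
    rw [barContr_act, barD_act, barD_act, barContrPred_act, barAug_act, barSection_act]
    exact (congrArg (mulAct g) hx).trans (by rw [map_sub, map_sub])
  | hu n y =>
    rw [barContr_unit, map_neg, barD_S_unit, barAug_barSection, barSection_d, barD_unit,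
      barAug_unit, barContrPred_unit]
    abel
  | hS n w ih =>
    rw [barContr_S, map_neg, barD_S_unit, barSPred_succ, ih, barD_S_unit, barAug_S, map_zero,
      sub_zero, barAug_barContr]
    change _ = _ - barContr b n _
    simp only [map_sub, map_zero]
    rw [barContr_unit, barContr_SPred]
    abel

/-- The bar construction of a complex of free modules `M` reduces to `M`. -/
noncomputable def barResolution : Reduction (barComplex L L) M :=
  Reduction.ofHomotopy (C := barComplex L L) (D := M)
    (fun n => linearOfEquivariant (barAug L n) (barAug_act L n)) (barSection b)
    (fun n => linearOfEquivariant (barContr b n) (barContr_act b n))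
    (fun n x => (congrArg (barAug L n) (barComplex_d L L n x)).trans (barAug_d L (n + 1) x))
    (fun n x => (barSection_d L b (n + 1) x).symm.trans (barComplex_d L L n _).symm)
    (barAug_barSection L b) (barAug_barContr L b)
    (fun (x : BarModule G (underlying G M) 0) => (barComplex_d L _ 0 _).trans
      ((barContr_d L b 0 x).trans (sub_zero (x - barSection b 0 (barAug L 0 x)))))
    (fun n (x : BarModule G (underlying G M) (n + 1)) => (barComplex_d L _ (n + 1) _).trans
      ((barContr_d L b (n + 1) x).trans (congrArg (fun y =>
        x - barSection b (n + 1) (barAug L (n + 1) x) - barContr b n y)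
          (barComplex_d L _ n x).symm)))

/-- `barContr (1 - σ ε)` for the augmentation `ε` and its section `σ`. -/
noncomputable def barContrAux (n : ℕ) :
    BarModule G (underlying G M) n →+ BarModule G (underlying G M) (n + 1) :=
  (barContr b n).comp (AddMonoidHom.id (BarModule G (underlying G M) n) -
    ((barSection b n).toAddMonoidHom : M.X n →+ BarModule G (underlying G M) n).comp (barAug L n))

lemma barResolution_htpyHom (n : ℕ) (w : BarModule G (underlying G M) n) :
    (barResolution L b).htpyHom n w =
      barContrAux L b n (barD L L (n + 1) (barContrAux L b n w)) := by
  have h : (barResolution L b).htpyHom n w = Reduction.normalizedHtpy (C := barComplex L L) (D := M)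
      (fun n => linearOfEquivariant (barAug L n) (barAug_act L n)) (barSection b)
      (fun n => linearOfEquivariant (barContr b n) (barContr_act b n)) n w := by
    unfold barResolution Reduction.ofHomotopy
    exact Reduction.ofLinear_htpyHom (C := barComplex L L) (D := M) n w
  exact h.trans (congrArg (barContrAux L b n) (barComplex_d L L n (barContrAux L b n w)))

end Resolution

/-! ### Comparison with the explicit bar differential -/

section Explicit

variable {G : Type u} [Group G] {M : ChainComplex (ModuleCat.{u} (MonoidAlgebra ℤ G)) ℕ}
  {T N : ChainComplex (ModuleCat.{u} ℤ) ℕ}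
  (L : Reduction T (underlying G M)) (r : Reduction T N)

lemma barTensor_nil (g : G) (q : ℕ) (y : N.X q) :
    barTensor g [] q rfl y = mulAct g (barι G N q y) := by
  simp [barι_apply]

lemma barTensor_cons (g h : G) (l : List G) (q : ℕ) (y : N.X q) :
    barTensor g (h :: l) q rfl y = mulAct g (barS G N (q + l.length) (barTensor h l q rfl y)) := by
  simp

lemma barΦ_barTensor (g : G) (l : List G) (q : ℕ) (y : N.X q) :
    barΦ L r (q + l.length) (barTensor g l q rfl y) = shuffle L r g l (r.inclHom q y) := by
  induction l generalizing g with
  | nil =>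
    refine (congrArg (barΦ L r q) (barTensor_nil g q y)).trans ?_
    rw [barΦ_act, barΦ_ι]
    rfl
  | cons h l ih =>
    refine (congrArg (barΦ L r (q + l.length + 1)) (barTensor_cons g h l q y)).trans ?_
    rw [barΦ_act, barΦ_S, ih]
    rfl

lemma barE_barTensor (g : G) (l : List G) (q : ℕ) (y : N.X q) :
    barE L r (q + l.length) (barTensor g l q rfl y) = higherAction L r g l y :=
  congrArg (r.projHom (q + l.length)) (barΦ_barTensor L r g l q y)

lemma mulAct_barBoundary {n : ℕ} (g g₀ : G) (l : List G) (q : ℕ) (h : q + l.length = n + 1)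
    (y : N.X q) :
    mulAct g (barBoundary L r g₀ l q h y) = barBoundary L r (g * g₀) l q h y := by
  simp only [barBoundary, map_add, map_sum, map_zsmul, mulAct_barTensor, mul_assoc]
  congr 3 <;> split_ifs <;> simp

lemma barBoundary_nil {n : ℕ} (g₀ : G) (y : N.X (n + 1)) :
    barBoundary L r g₀ [] (n + 1) rfl y = barTensor g₀ [] n rfl (dHom N (n + 1) y) := by
  simp [barBoundary]
  rfl

lemma barBoundary_singleton (g : G) (y : N.X 0) :
    barBoundary L r 1 [g] 0 rfl y =
      barTensor g [] 0 rfl y - barι G N 0 (higherAction L r g [] y) := by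
  simp [barBoundary, barι_apply, sub_eq_add_neg]
  rfl

lemma barBoundary_cons {n : ℕ} (g : G) (l : List G) (q : ℕ) (h : q + l.length = n + 1)
    (h' : q + (g :: l).length = n + 1 + 1) (y : N.X q) :
    barBoundary L r 1 (g :: l) q h' y =
      barTensor g l q h y - barTensor 1 [] (q + l.length) h (higherAction L r g l y) -
        barS G N n (barBoundary L r g l q h y) := by
  have h1 : (if hq : 0 < q then (-1 : ℤ) ^ (g :: l).length • barTensor (n := n + 1) 1 (g :: l)
      (q - 1) (by simp; omega) (N.d q (q - 1) y) else 0) = -barS G N n (if hq : 0 < q then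
    (-1 : ℤ) ^ l.length • barTensor g l (q - 1) (by omega) (N.d q (q - 1) y) else 0) := by
    split_ifs with hq
    · simp [pow_succ]
    · simp
  have h4 : (∑ k : Fin (g :: l).length, (-1 : ℤ) ^ (k.1 + 1) •
      barTensor (n := n + 1) 1 ((g :: l).take k) (q + ((g :: l).drop (k + 1)).length)
        (by simp only [List.length_take, List.length_drop]; omega)
        (higherAction L r (g :: l)[k.1] ((g :: l).drop (k + 1)) y)) =
      -barTensor 1 [] (q + l.length) h (higherAction L r g l y) -
        barS G N n (∑ k : Fin l.length, (-1 : ℤ) ^ (k.1 + 1) •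
      barTensor g (l.take k) (q + (l.drop (k + 1)).length)
        (by simp only [List.length_take, List.length_drop]; omega)
        (higherAction L r l[k.1] (l.drop (k + 1)) y)) := by
    refine (Fin.sum_univ_succ _).trans ?_
    rw [sub_eq_add_neg]
    congr 1
    · simp
      rfl
    · rw [← AddMonoidHom.neg_apply, map_sum]
      refine Finset.sum_congr rfl fun k _ => ?_
      have hk : (-1 : ℤ) ^ (k.succ.1 + 1) = -(-1) ^ (k.1 + 1) := by
        rw [Fin.val_succ, pow_succ, mul_neg_one]
      rw [map_zsmul, AddMonoidHom.neg_apply, barS_barTensor, smul_neg, ← neg_smul]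
      exact congr (congrArg HSMul.hSMul hk) rfl
  have h3 : (∑ j : Fin ((g :: l).length - 1), (-1 : ℤ) ^ (j.1 + 1) •
      barTensor (n := n + 1) 1
        ((g :: l).take j ++ ((g :: l)[j.1] * (g :: l)[j.1 + 1]) :: (g :: l).drop (j + 2)) q
        (by simp only [List.length_append, List.length_take, List.length_cons, List.length_drop]
            omega) y) =
      -barS G N n (if hl : 0 < l.length then
        barTensor (g * l[0]) l.tail q (by rw [List.length_tail]; omega) y else 0) -
      barS G N n (∑ j : Fin (l.length - 1), (-1 : ℤ) ^ (j.1 + 1) •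
      barTensor g (l.take j ++ (l[j.1] * l[j.1 + 1]) :: l.drop (j + 2)) q
        (by simp only [List.length_append, List.length_take, List.length_cons, List.length_drop]
            omega) y) := by
    cases l with
    | nil => simp
    | cons g' l =>
      refine (Fin.sum_univ_succ (n := l.length) _).trans ?_
      rw [sub_eq_add_neg]
      congr 1
      · simp
      · rw [← AddMonoidHom.neg_apply, map_sum]
        refine Finset.sum_congr rfl fun k _ => ?_
        have hk : (-1 : ℤ) ^ (k.succ.1 + 1) = -(-1) ^ (k.1 + 1) := by
          rw [Fin.val_succ, pow_succ, mul_neg_one]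
        rw [map_zsmul, AddMonoidHom.neg_apply, barS_barTensor, smul_neg, ← neg_smul]
        exact congr (congrArg HSMul.hSMul hk) rfl
  have h2 : (if hl : 0 < (g :: l).length then
    barTensor ((1 : G) * (g :: l)[0]) (g :: l).tail q (by rw [List.length_tail]; omega) y else 0) =
      barTensor g l q h y := by
    simp
  rw [barBoundary, h1, h2, h3, h4, barBoundary]
  simp only [map_add]
  abel

lemma barD_barTensor {n : ℕ} (g₀ : G) (l : List G) (q : ℕ) (h : q + l.length = n + 1)
    (y : N.X q) :
    barD L r (n + 1) (barTensor g₀ l q h y) = barBoundary L r g₀ l q h y := by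
  induction l generalizing n g₀ with
  | nil =>
    obtain rfl : q = n + 1 := h
    rw [barBoundary_nil, barTensor_nil, barD_act, barD_ι, ← barTensor_nil]
    rfl
  | cons g l ih =>
    have h' : q + l.length = n := by simp at h; omega
    subst h'
    have h1 : mulAct g₀ (barBoundary L r 1 (g :: l) q h y) = barBoundary L r g₀ (g :: l) q h y := by
      rw [mulAct_barBoundary, mul_one]
    rw [← h1]
    refine (congrArg (barD L r (q + l.length + 1)) (barTensor_cons g₀ g l q y)).trans ?_
    rw [barD_act]
    refine congrArg (mulAct g₀) ?_
    rw [barD_S, barE_barTensor]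
    have key : ∀ n (hn : q + l.length = n),
        barTensor g l q hn y - barTensor 1 [] (q + l.length) hn (higherAction L r g l y) -
          barSPred G N n (barD L r n (barTensor g l q hn y)) =
        barBoundary L r 1 (g :: l) q (by simp; omega) y := by
      intro n hn
      cases n with
      | zero =>
        obtain ⟨rfl, hl⟩ := Nat.add_eq_zero_iff.mp hn
        obtain rfl := List.length_eq_zero_iff.mp hl
        exact (sub_zero _).trans (barBoundary_singleton L r g y).symm
      | succ n => rw [barSPred_succ, ih, barBoundary_cons L r g l q hn]
    exact key _ rfl

/-- The complex `barComplex L r` is the bar construction with the explicit differential. -/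
lemma isBarConstruction_barComplex : IsBarConstruction L r (barComplex L r) :=
  ⟨fun _ => LinearEquiv.refl _ _, fun n g₀ l q h y =>
    (barComplex_d L r n _).trans (barD_barTensor L r g₀ l q h y)⟩

lemma locallyFiniteComplex_barComplex [Finite G] (hN : LocallyFiniteComplex N) :
    LocallyFiniteComplex (barComplex L r) := by
  intro n
  change AddGroup.FG (BarModule G N n)
  have hfin : Finite {p : List G × ℕ // p.2 + p.1.length = n} := by
    have h1 : Finite {l : List G // l.length ≤ n} := (List.finite_length_le G n).to_subtype
    refine Finite.of_injective
      (fun p => ((⟨p.1.1, by have := p.2; omega⟩, ⟨p.1.2, by have := p.2; omega⟩) :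
        {l : List G // l.length ≤ n} × Fin (n + 1))) ?_
    rintro ⟨⟨l, q⟩, h⟩ ⟨⟨l', q'⟩, h'⟩ e
    simp only [Prod.mk.injEq, Subtype.mk.injEq, Fin.mk.injEq] at e
    simp [e.1, e.2]
  have := Fintype.ofFinite {p : List G × ℕ // p.2 + p.1.length = n}
  have := Fintype.ofFinite G
  let S := G × {p : List G × ℕ // p.2 + p.1.length = n}
  have hfg : AddGroup.FG (∀ s : S, N.X s.2.1.2) := by
    have h2 : ∀ s : S, AddGroup.FG (N.X s.2.1.2) := fun s => hN s.2.1.2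
    infer_instance
  -- The bar module is the sum of finitely many images of the groups `N.X q`.
  let f : (∀ s : S, N.X s.2.1.2) →+ BarModule G N n :=
    ∑ s : S, (barTensorHom s.1 s.2.1.1 s.2.1.2 s.2.2).comp (Pi.evalAddMonoidHom _ s)
  refine @AddGroup.fg_of_surjective _ _ _ _ hfg f fun w => ?_
  classical
  induction w using barTensor_induction with
  | h0 => exact ⟨0, map_zero f⟩
  | hadd x y hx hy =>
    obtain ⟨x, rfl⟩ := hx
    obtain ⟨y, rfl⟩ := hy
    exact ⟨x + y, map_add f x y⟩
  | ht g l q h y =>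
    refine ⟨Pi.single (⟨g, ⟨(l, q), h⟩⟩ : S) y, ?_⟩
    rw [AddMonoidHom.finsetSum_apply, Finset.sum_eq_single (⟨g, ⟨(l, q), h⟩⟩ : S)]
    · simp
    · intro s _ hs
      simp [hs]
    · simp

end Explicit

/-! ### Uniformly computable families of maps -/

attribute [fun_prop] Computable
attribute [fun_prop] Computable.id Computable.const Computable.comp Computable.pair Computable.fst
  Computable.snd Computable.encode

section Effective

open Nat.Partrec (Code)
open Encodable (encode decode)

@[fun_prop] lemma Computable.natPair {α : Type*} [Primcodable α] {f g : α → ℕ}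
    (hf : Computable f) (hg : Computable g) : Computable fun x => Nat.pair (f x) (g x) :=
  Primrec₂.natPair.to_comp.comp hf hg

@[fun_prop] lemma Computable.natAdd {α : Type*} [Primcodable α] {f g : α → ℕ}
    (hf : Computable f) (hg : Computable g) : Computable fun x => f x + g x :=
  Primrec.nat_add.to_comp.comp hf hg

@[fun_prop] lemma Computable.listCons {α β : Type*} [Primcodable α] [Primcodable β] {f : α → β}
    {g : α → List β} (hf : Computable f) (hg : Computable g) : Computable fun x => f x :: g x :=
  Computable.list_cons.comp hf hg

@[fun_prop] lemma Computable.listLength {α β : Type*} [Primcodable α] [Primcodable β]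
    {g : α → List β} (hg : Computable g) : Computable fun x => (g x).length :=
  Computable.list_length.comp hg

@[fun_prop] lemma Computable.listAppend {α β : Type*} [Primcodable α] [Primcodable β]
    {f g : α → List β} (hf : Computable f) (hg : Computable g) :
    Computable fun x => f x ++ g x :=
  Computable.list_append.comp hf hg

variable {Γ Γ' Δ α β γ : Type*} [Primcodable Γ] [Primcodable Γ'] [Primcodable Δ] [Primcodable α]
  [Primcodable β] [Primcodable γ]

/-- The partial function computed by a program, on arguments and values in encodable types. -/
def evalCode (α β : Type*) [Primcodable α] [Primcodable β] (c : Code) : α →. β := fun a =>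
  (c.eval (encode a)).bind fun b => (decode b : Option β)

lemma partrec_evalCode : Partrec fun x : Code × α => evalCode α β x.1 x.2 := by
  refine Partrec.bind (Code.eval_part.comp Computable.fst
    (Computable.encode.comp Computable.snd)) ?_
  exact Computable.ofOption (Computable.decode.comp Computable.snd)

/-- The `s`-`m`-`n` theorem for encodable types. -/
lemma Partrec.exists_evalCode {p : Γ × α →. β} (hp : Partrec p) :
    ∃ F : Γ → Code, Primrec F ∧ ∀ γ a, evalCode α β (F γ) a = p (γ, a) := by
  obtain ⟨c, hc⟩ := Code.exists_code.1 hp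
  refine ⟨fun γ => c.curry (encode γ), Code.primrec₂_curry.comp (Primrec.const c) Primrec.encode,
    fun γ a => ?_⟩
  rw [evalCode, Code.eval_curry, hc]
  have : Nat.pair (encode γ) (encode a) = encode (γ, a) := rfl
  simp only [this, Encodable.encodek, Part.coe_some, Part.bind_some]
  ext b
  simp

variable {κ κ' : Type*}

/-- A family of elements `y k`, whose names are given by the numberings `μ k`, is computed by one
program uniformly in the code of the index `k`. -/
def EffElt (code : κ → Γ) {Y : κ → Type*} (μ : ∀ k, β →. Y k) (y : ∀ k, Y k) : Prop :=
  ∃ p : Γ →. β, Partrec p ∧ ∀ k, ∃ b ∈ p (code k), y k ∈ μ k b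

/-- A family of maps `f k` is computed, on names, by one program uniformly in the code of the
index `k`. -/
def EffMap (code : κ → Γ) {X Y : κ → Type*} (ν : ∀ k, α →. X k) (μ : ∀ k, β →. Y k)
    (f : ∀ k, X k → Y k) : Prop :=
  ∃ p : Γ × α →. β, Partrec p ∧ ∀ k a, ∀ x ∈ ν k a, ∃ b ∈ p (code k, a), f k x ∈ μ k b

/-- The indices that consist of `k` and an element of `X k` with a name. -/
abbrev Named {X : κ → Type*} (ν : ∀ k, α →. X k) : Type _ :=
  Σ k, {p : α × X k // p.2 ∈ ν k p.1}

/-- The code of an index in `Named ν`. -/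
abbrev namedCode (code : κ → Γ) {X : κ → Type*} (ν : ∀ k, α →. X k) : Named ν → Γ × α :=
  fun k => (code k.1, k.2.1.1)

/-- Names of pairs are pairs of names. -/
def prodVal {X Y : Type*} (ν : α →. X) (μ : β →. Y) : α × β →. X × Y := fun a =>
  (ν a.1).bind fun x => (μ a.2).map fun y => (x, y)

omit [Primcodable α] [Primcodable β] in
lemma mem_prodVal {X Y : Type*} {ν : α →. X} {μ : β →. Y} {a : α × β} {x : X × Y} :
    x ∈ prodVal ν μ a ↔ x.1 ∈ ν a.1 ∧ x.2 ∈ μ a.2 := by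
  simp only [prodVal, Part.mem_bind_iff, Part.mem_map_iff]
  constructor
  · rintro ⟨x, hx, y, hy, rfl⟩
    exact ⟨hx, hy⟩
  · rintro ⟨hx, hy⟩
    exact ⟨_, hx, _, hy, rfl⟩

section Maps

variable {code : κ → Γ} {code' : κ' → Γ'} {X Y Z : κ → Type*} {ν : ∀ k, α →. X k}
  {μ : ∀ k, β →. Y k} {ξ : ∀ k, γ →. Z k}

lemma EffMap.of_computable {f : ∀ k, X k → Y k} (h : Γ × α → β) (hh : Computable h)
    (H : ∀ k a, ∀ x ∈ ν k a, f k x ∈ μ k (h (code k, a))) : EffMap code ν μ f :=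
  ⟨h, hh.partrec, fun k a x hx => ⟨_, Part.mem_some _, H k a x hx⟩⟩

lemma EffElt.of_computable {y : ∀ k, Y k} (h : Γ → β) (hh : Computable h)
    (H : ∀ k, y k ∈ μ k (h (code k))) : EffElt code μ y :=
  ⟨h, hh.partrec, fun k => ⟨_, Part.mem_some _, H k⟩⟩

lemma EffMap.id : EffMap code ν ν fun _ x => x :=
  .of_computable Prod.snd Computable.snd fun _ _ _ hx => hx

lemma EffMap.comp {g : ∀ k, Y k → Z k} {f : ∀ k, X k → Y k} (hg : EffMap code μ ξ g)
    (hf : EffMap code ν μ f) : EffMap code ν ξ fun k x => g k (f k x) := by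
  obtain ⟨p, hp, Hp⟩ := hf
  obtain ⟨q, hq, Hq⟩ := hg
  refine ⟨fun x => (p x).bind fun b => q (x.1, b), hp.bind (hq.comp (by fun_prop)), ?_⟩
  intro k a x hx
  obtain ⟨b, hb, hb'⟩ := Hp k a x hx
  obtain ⟨c, hc, hc'⟩ := Hq k b _ hb'
  exact ⟨c, Part.mem_bind hb hc, hc'⟩

lemma EffElt.app {g : ∀ k, Y k → Z k} {y : ∀ k, Y k} (hg : EffMap code μ ξ g)
    (hy : EffElt code μ y) : EffElt code ξ fun k => g k (y k) := by
  obtain ⟨p, hp, Hp⟩ := hy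
  obtain ⟨q, hq, Hq⟩ := hg
  refine ⟨fun x => (p x).bind fun b => q (x, b), hp.bind (hq.comp (by fun_prop)), ?_⟩
  intro k
  obtain ⟨b, hb, hb'⟩ := Hp k
  obtain ⟨c, hc, hc'⟩ := Hq k b _ hb'
  exact ⟨c, Part.mem_bind hb hc, hc'⟩

lemma EffMap.const {y : ∀ k, Y k} (hy : EffElt code μ y) : EffMap code ν μ fun k _ => y k := by
  obtain ⟨p, hp, Hp⟩ := hy
  exact ⟨fun x => p x.1, hp.comp Computable.fst, fun k _ _ _ => Hp k⟩

lemma EffMap.prodMk {f : ∀ k, X k → Y k} {g : ∀ k, X k → Z k} (hf : EffMap code ν μ f)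
    (hg : EffMap code ν ξ g) :
    EffMap code ν (fun k => prodVal (μ k) (ξ k)) fun k x => (f k x, g k x) := by
  obtain ⟨p, hp, Hp⟩ := hf
  obtain ⟨q, hq, Hq⟩ := hg
  have h1 : Computable₂ fun (x : (Γ × α) × β) (c : γ) => (x.2, c) :=
    (Computable.snd.comp Computable.fst).pair Computable.snd
  have h2 : Partrec₂ fun (x : Γ × α) (b : β) => (q x).map fun c => (b, c) :=
    (hq.comp Computable.fst).map h1
  refine ⟨fun x => (p x).bind fun b => (q x).map fun c => (b, c), hp.bind h2, ?_⟩
  intro k a x hx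
  obtain ⟨b, hb, hb'⟩ := Hp k a x hx
  obtain ⟨c, hc, hc'⟩ := Hq k a x hx
  exact ⟨_, Part.mem_bind hb (Part.mem_map _ hc), mem_prodVal.2 ⟨hb', hc'⟩⟩

/-- Restriction of a computable family along a map of index sets that is computable on codes. -/
lemma EffMap.reindex {f : ∀ k, X k → Y k} (hf : EffMap code ν μ f) (e : κ' → κ) (ε : Γ' → Γ)
    (hε : Computable ε) (he : ∀ k, code (e k) = ε (code' k)) :
    EffMap code' (fun k => ν (e k)) (fun k => μ (e k)) fun k => f (e k) := by
  obtain ⟨p, hp, Hp⟩ := hf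
  refine ⟨fun x => p (ε x.1, x.2), hp.comp (by fun_prop), fun k a x hx => ?_⟩
  have h := Hp _ _ _ hx
  rw [he] at h
  exact h

lemma EffElt.reindex {y : ∀ k, Y k} (hy : EffElt code μ y) (e : κ' → κ) (ε : Γ' → Γ)
    (hε : Computable ε) (he : ∀ k, code (e k) = ε (code' k)) :
    EffElt code' (fun k => μ (e k)) fun k => y (e k) := by
  obtain ⟨p, hp, Hp⟩ := hy
  refine ⟨fun x => p (ε x), hp.comp hε, fun k => ?_⟩
  have h := Hp (e k)
  rw [he] at h
  exact h

lemma EffMap.elt {f : ∀ k, X k → Y k} (hf : EffMap code ν μ f) :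
    EffElt (namedCode code ν) (fun k => μ k.1) fun k => f k.1 k.2.1.2 := by
  obtain ⟨p, hp, Hp⟩ := hf
  exact ⟨p, hp, fun ⟨k, ⟨a, x⟩, hx⟩ => Hp k a x hx⟩

lemma EffMap.uncurry {f : ∀ k, X k × Y k → Z k}
    (hf : EffMap (namedCode code ν) (fun k => μ k.1) (fun k => ξ k.1)
      fun k y => f k.1 (k.2.1.2, y)) :
    EffMap code (fun k => prodVal (ν k) (μ k)) ξ f := by
  obtain ⟨p, hp, Hp⟩ := hf
  refine ⟨fun x => p ((x.1, x.2.1), x.2.2), hp.comp (by fun_prop), ?_⟩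
  rintro k ⟨a, b⟩ ⟨x, y⟩ hx
  rw [mem_prodVal] at hx
  exact Hp ⟨k, ⟨a, x⟩, hx.1⟩ b y hx.2

/-- The indices `(k, n)` together with a program for the map `f k n`. -/
abbrev Programmed {X Y : κ → Type*} (ν : ∀ k, α →. X k) (μ : ∀ k, β →. Y k)
    (f : ∀ k, X k → Y k) : Type _ :=
  {k : κ × Code // ∀ a, ∀ x ∈ ν k.1 a, ∃ b ∈ evalCode α β k.2 a, f k.1 x ∈ μ k.1 b}

/-- The code of an index in `Programmed ν μ f`. -/
abbrev programmedCode (code : κ → Γ) {X Y : κ → Type*} (ν : ∀ k, α →. X k) (μ : ∀ k, β →. Y k)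
    (f : ∀ k, X k → Y k) : Programmed ν μ f → Γ × Code :=
  fun k => (code k.1.1, k.1.2)

/-- The universal program computes a map from a program for it. -/
lemma EffMap.programmed (code : κ → Γ) (ν : ∀ k, α →. X k) (μ : ∀ k, β →. Y k)
    (f : ∀ k, X k → Y k) :
    EffMap (programmedCode code ν μ f) (fun k => ν k.1.1) (fun k => μ k.1.1) fun k => f k.1.1 := by
  have h : Computable fun x : (Γ × Code) × α => (x.1.2, x.2) := by fun_prop
  exact ⟨fun x => evalCode α β x.1.2 x.2, partrec_evalCode.comp h, fun k a x hx => k.2 a x hx⟩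

lemma EffMap.exists_code {f : ∀ k, X k → Y k} (hf : EffMap code ν μ f) :
    ∃ F : Γ → Code, Primrec F ∧
      ∀ k a, ∀ x ∈ ν k a, ∃ b ∈ evalCode α β (F (code k)) a, f k x ∈ μ k b := by
  obtain ⟨p, hp, Hp⟩ := hf
  obtain ⟨F, hF, H⟩ := hp.exists_evalCode
  refine ⟨F, hF, fun k a x hx => ?_⟩
  rw [H]
  exact Hp k a x hx

lemma EffElt.exists_code {y : ∀ k, Y k} (hy : EffElt code μ y) :
    ∃ F : Γ → Code, Primrec F ∧ ∀ k, ∃ b ∈ evalCode Unit β (F (code k)) (), y k ∈ μ k b := by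
  obtain ⟨p, hp, Hp⟩ := hy
  obtain ⟨F, hF, H⟩ := (hp.comp Computable.fst : Partrec fun x : Γ × Unit => p x.1).exists_evalCode
  refine ⟨F, hF, fun k => ?_⟩
  rw [H]
  exact Hp k

end Maps

section Recursion

variable {code : κ → Γ}

/-- Recursion over degrees: a program for `f k (n + 1)` may use a program for `f k n`. -/
lemma EffMap.natRec {X Y : κ × ℕ → Type*} {ν : ∀ k, α →. X k} {μ : ∀ k, β →. Y k}
    {f : ∀ k, X k → Y k}
    (h0 : EffMap code (fun k => ν (k, 0)) (fun k => μ (k, 0)) fun k => f (k, 0))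
    (hs : EffMap (programmedCode (fun k : κ × ℕ => (code k.1, k.2)) ν μ f)
      (fun k => ν (k.1.1.1, k.1.1.2 + 1)) (fun k => μ (k.1.1.1, k.1.1.2 + 1))
      fun k => f (k.1.1.1, k.1.1.2 + 1)) :
    EffMap (fun k : κ × ℕ => (code k.1, k.2)) ν μ f := by
  obtain ⟨F₀, hF₀, H₀⟩ := h0.exists_code
  obtain ⟨F₁, hF₁, H₁⟩ := hs.exists_code
  obtain ⟨F, hF, hF0, hF1⟩ : ∃ F : Γ × ℕ → Code, Computable F ∧ (∀ γ, F (γ, 0) = F₀ γ) ∧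
      ∀ γ n, F (γ, n + 1) = F₁ ((γ, n), F (γ, n)) := by
    refine ⟨fun x => Nat.rec (F₀ x.1) (fun n c => F₁ ((x.1, n), c)) x.2, ?_, fun _ => rfl,
      fun _ _ => rfl⟩
    refine Computable.nat_rec (f := fun x : Γ × ℕ => x.2) (g := fun x => F₀ x.1)
      (h := fun x y => F₁ ((x.1, y.1), y.2)) (by fun_prop) (hF₀.to_comp.comp Computable.fst) ?_
    have h : Computable fun x : (Γ × ℕ) × ℕ × Code => ((x.1.1, x.2.1), x.2.2) := by fun_prop
    exact hF₁.to_comp.comp h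
  have H : ∀ k n a, ∀ x ∈ ν (k, n) a, ∃ b ∈ evalCode α β (F (code k, n)) a,
      f (k, n) x ∈ μ (k, n) b := by
    intro k n
    induction n with
    | zero => simpa only [hF0] using H₀ k
    | succ n ih => simpa only [hF1] using H₁ ⟨((k, n), F (code k, n)), ih⟩
  have h : Computable fun x : (Γ × ℕ) × α => (F x.1, x.2) := by fun_prop
  exact ⟨fun x => evalCode α β (F x.1) x.2, partrec_evalCode.comp h, fun ⟨k, n⟩ => H k n⟩

lemma EffMap.natCases {X Y : κ × ℕ → Type*} {ν : ∀ k, α →. X k} {μ : ∀ k, β →. Y k}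
    {f : ∀ k, X k → Y k}
    (h0 : EffMap code (fun k => ν (k, 0)) (fun k => μ (k, 0)) fun k => f (k, 0))
    (hs : EffMap (fun k : κ × ℕ => (code k.1, k.2)) (fun k => ν (k.1, k.2 + 1))
      (fun k => μ (k.1, k.2 + 1)) fun k => f (k.1, k.2 + 1)) :
    EffMap (fun k : κ × ℕ => (code k.1, k.2)) ν μ f :=
  h0.natRec (hs.reindex (fun k : Programmed ν μ f => k.1.1) (fun x : (Γ × ℕ) × Code => x.1)
    (by fun_prop) fun _ => rfl)

/-- Recursion over words: a program for `f k (g :: l)` may use a program for `f k l`. -/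
lemma EffMap.listRec {X Y : κ × List γ → Type*} {ν : ∀ k, α →. X k} {μ : ∀ k, β →. Y k}
    {f : ∀ k, X k → Y k}
    (h0 : EffMap code (fun k => ν (k, [])) (fun k => μ (k, [])) fun k => f (k, []))
    (hs : EffMap (κ := γ × Programmed ν μ f)
      (fun k => (k.1, programmedCode (fun k : κ × List γ => (code k.1, k.2)) ν μ f k.2))
      (fun k => ν (k.2.1.1.1, k.1 :: k.2.1.1.2)) (fun k => μ (k.2.1.1.1, k.1 :: k.2.1.1.2))
      fun k => f (k.2.1.1.1, k.1 :: k.2.1.1.2)) :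
    EffMap (fun k : κ × List γ => (code k.1, k.2)) ν μ f := by
  obtain ⟨F₀, hF₀, H₀⟩ := h0.exists_code
  obtain ⟨F₁, hF₁, H₁⟩ := hs.exists_code
  obtain ⟨F, hF, hF0, hF1⟩ : ∃ F : Γ × List γ → Code, Primrec F ∧ (∀ γ, F (γ, []) = F₀ γ) ∧
      ∀ γ g l, F (γ, g :: l) = F₁ (g, (γ, l), F (γ, l)) := by
    refine ⟨fun x => List.rec (F₀ x.1) (fun g l c => F₁ (g, (x.1, l), c)) x.2, ?_, fun _ => rfl,
      fun _ _ _ => rfl⟩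
    refine Primrec.list_rec (f := fun x : Γ × List γ => x.2) (g := fun x => F₀ x.1)
      (h := fun x y => F₁ (y.1, (x.1, y.2.1), y.2.2)) Primrec.snd (hF₀.comp Primrec.fst) ?_
    have h : Primrec fun x : (Γ × List γ) × γ × List γ × Code =>
        (x.2.1, (x.1.1, x.2.2.1), x.2.2.2) :=
      have h2 := Primrec.snd.comp (Primrec.snd (α := Γ × List γ) (β := γ × List γ × Code))
      (Primrec.fst.comp Primrec.snd).pair (((Primrec.fst.comp Primrec.fst).pair
        (Primrec.fst.comp h2)).pair (Primrec.snd.comp h2))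
    exact hF₁.comp h
  have H : ∀ k l a, ∀ x ∈ ν (k, l) a, ∃ b ∈ evalCode α β (F (code k, l)) a,
      f (k, l) x ∈ μ (k, l) b := by
    intro k l
    induction l with
    | nil => simpa only [hF0] using H₀ k
    | cons g l ih => simpa only [hF1] using H₁ (g, ⟨((k, l), F (code k, l)), ih⟩)
  have hF' := hF.to_comp
  have h : Computable fun x : (Γ × List γ) × α => (F x.1, x.2) := by fun_prop
  exact ⟨fun x => evalCode α β (F x.1) x.2, partrec_evalCode.comp h, fun ⟨k, l⟩ => H k l⟩

end Recursion

section Groups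

/-- Zero and sums in the monoids `Y k` are computed on names, uniformly in `k`. -/
structure EffAdd (code : κ → Γ) {Y : κ → Type*} [∀ k, AddMonoid (Y k)] (μ : ∀ k, β →. Y k) :
    Prop where
  zero : EffElt code μ fun _ => 0
  add' : EffMap code (fun k => prodVal (μ k) (μ k)) μ fun _ y => y.1 + y.2

/-- The group operations of the `Y k` are computed on names, uniformly in `k`. -/
structure EffGroup (code : κ → Γ) {Y : κ → Type*} [∀ k, AddCommGroup (Y k)] (μ : ∀ k, β →. Y k) :
    Prop extends EffAdd code μ where
  zsmul' : EffMap (κ := κ × ℤ) (fun k => (code k.1, k.2)) (fun k => μ k.1) (fun k => μ k.1)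
    fun k y => k.2 • y

variable {code : κ → Γ} {code' : κ' → Γ'} {X Y : κ → Type*} [∀ k, AddCommGroup (Y k)]
  {ν : ∀ k, α →. X k} {μ : ∀ k, β →. Y k}

lemma EffAdd.reindex {Y : κ → Type*} [∀ k, AddMonoid (Y k)] {μ : ∀ k, β →. Y k}
    (h : EffAdd code μ) (e : κ' → κ) (ε : Γ' → Γ) (hε : Computable ε)
    (he : ∀ k, code (e k) = ε (code' k)) : EffAdd code' fun k => μ (e k) :=
  ⟨h.zero.reindex e ε hε he, h.add'.reindex e ε hε he⟩

lemma EffGroup.reindex (h : EffGroup code μ) (e : κ' → κ) (ε : Γ' → Γ) (hε : Computable ε)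
    (he : ∀ k, code (e k) = ε (code' k)) : EffGroup code' fun k => μ (e k) :=
  { h.toEffAdd.reindex e ε hε he with
    zsmul' := h.zsmul'.reindex (fun k : κ' × ℤ => (e k.1, k.2)) (fun x : Γ' × ℤ => (ε x.1, x.2))
      (by fun_prop) fun k => by rw [he] }

lemma EffAdd.add {Y : κ → Type*} [∀ k, AddMonoid (Y k)] {μ : ∀ k, β →. Y k} (h : EffAdd code μ)
    {f g : ∀ k, X k → Y k} (hf : EffMap code ν μ f) (hg : EffMap code ν μ g) :
    EffMap code ν μ fun k x => f k x + g k x :=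
  h.add'.comp (hf.prodMk hg)

lemma EffGroup.neg (h : EffGroup code μ) {f : ∀ k, X k → Y k} (hf : EffMap code ν μ f) :
    EffMap code ν μ fun k x => -f k x := by
  have h1 : EffMap code μ μ fun k y => (-1 : ℤ) • y :=
    h.zsmul'.reindex (fun k => (k, (-1 : ℤ))) (fun x => (x, (-1 : ℤ))) (by fun_prop) fun _ => rfl
  simpa using h1.comp hf

lemma EffGroup.sub (h : EffGroup code μ) {f g : ∀ k, X k → Y k} (hf : EffMap code ν μ f)
    (hg : EffMap code ν μ g) : EffMap code ν μ fun k x => f k x - g k x := by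
  simpa [sub_eq_add_neg] using h.add hf (h.neg hg)

end Groups

end Effective

/-! ### Sums of named elements -/

section Effective

open Nat.Partrec (Code)
open Encodable (encode decode)

variable {Γ Γ' Δ α β γ : Type*} [Primcodable Γ] [Primcodable Γ'] [Primcodable Δ] [Primcodable α]
  [Primcodable β] [Primcodable γ]

variable {κ κ' : Type*}

section Sums

/-- The numbering of sums of named elements by lists of names. -/
def sumVal {τ A : Type*} [AddMonoid A] (v : τ →. A) : List τ →. A
  | [] => Part.some 0
  | t :: l => (v t).bind fun x => (sumVal v l).map (x + ·)

variable {τ σ A B : Type*} [AddCommMonoid A] [AddCommMonoid B] {v : τ →. A} {w : σ →. B}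

lemma mem_sumVal_nil {x : A} : x ∈ sumVal v [] ↔ x = 0 := by
  simp [sumVal]

lemma mem_sumVal_cons {t : τ} {l : List τ} {x : A} :
    x ∈ sumVal v (t :: l) ↔ ∃ y ∈ v t, ∃ z ∈ sumVal v l, x = y + z := by
  simp [sumVal, eq_comm]

lemma mem_sumVal_singleton {t : τ} {x : A} : x ∈ sumVal v [t] ↔ x ∈ v t := by
  simp [mem_sumVal_cons, mem_sumVal_nil]

lemma add_mem_sumVal {l m : List τ} {x y : A} (hx : x ∈ sumVal v l) (hy : y ∈ sumVal v m) :
    x + y ∈ sumVal v (l ++ m) := by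
  induction l generalizing x with
  | nil =>
    rw [mem_sumVal_nil] at hx
    simpa [hx] using hy
  | cons t l ih =>
    obtain ⟨x', hx', z, hz, rfl⟩ := mem_sumVal_cons.1 hx
    exact mem_sumVal_cons.2 ⟨x', hx', _, ih hz, add_assoc _ _ _⟩

variable {τ σ : Type*} [Primcodable τ] [Primcodable σ] {code : κ → Γ}

lemma effAdd_sumVal {A : κ → Type*} [∀ k, AddCommMonoid (A k)] (v : ∀ k, τ →. A k) :
    EffAdd code fun k => sumVal (v k) where
  zero := .of_computable (fun _ => []) (by fun_prop) fun _ => mem_sumVal_nil.2 rfl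
  add' := .of_computable (fun x => x.2.1 ++ x.2.2) (by fun_prop) fun k a x hx =>
    add_mem_sumVal (mem_prodVal.1 hx).1 (mem_prodVal.1 hx).2

/-- An additive map is computable on sums of named elements if it is so on the named elements. -/
lemma EffAdd.effMap_sumVal {A B : κ → Type*} [∀ k, AddCommMonoid (A k)] [∀ k, AddCommMonoid (B k)]
    {v : ∀ k, τ →. A k} {μ : ∀ k, β →. B k} (hB : EffAdd code μ) (f : ∀ k, A k →+ B k)
    (hf : EffMap code v μ fun k x => f k x) :
    EffMap code (fun k => sumVal (v k)) μ fun k x => f k x := by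
  obtain ⟨F₀, hF₀, H₀⟩ := hB.zero.exists_code
  obtain ⟨p, hp, Hp⟩ := hf
  obtain ⟨q, hq, Hq⟩ := hB.add'
  let step : (Γ × τ × Code) × Unit →. β := fun x => (p (x.1.1, x.1.2.1)).bind fun b =>
    (evalCode Unit β x.1.2.2 ()).bind fun c => q (x.1.1, b, c)
  have hstep : Partrec step := by
    have h1 : Computable fun x : (Γ × τ × Code) × Unit => (x.1.1, x.1.2.1) := by fun_prop
    have h2 : Computable fun x : ((Γ × τ × Code) × Unit) × β => (x.1.1.2.2, ()) := by fun_prop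
    have h3 : Computable fun x : (((Γ × τ × Code) × Unit) × β) × β =>
      (x.1.1.1.1, x.1.2, x.2) := by fun_prop
    have e2 : Partrec fun x : ((Γ × τ × Code) × Unit) × β => evalCode Unit β x.1.1.2.2 () := by
      have h := (partrec_evalCode (α := Unit) (β := β)).comp h2
      exact h
    have e3 : Partrec₂ fun (x : ((Γ × τ × Code) × Unit) × β) (c : β) => q (x.1.1.1, x.2, c) :=
      hq.comp h3
    have e4 : Partrec₂ fun (x : (Γ × τ × Code) × Unit) (b : β) =>
        (evalCode Unit β x.1.2.2 ()).bind fun c => q (x.1.1, b, c) := e2.bind e3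
    exact (hp.comp h1).bind e4
  obtain ⟨F₁, hF₁, H₁⟩ := hstep.exists_evalCode
  obtain ⟨F, hF, hF0, hF1⟩ : ∃ F : Γ × List τ → Code, Primrec F ∧ (∀ γ, F (γ, []) = F₀ γ) ∧
      ∀ γ t l, F (γ, t :: l) = F₁ (γ, t, F (γ, l)) := by
    refine ⟨fun x => List.rec (F₀ x.1) (fun t _ c => F₁ (x.1, t, c)) x.2, ?_, fun _ => rfl,
      fun _ _ _ => rfl⟩
    refine Primrec.list_rec (f := fun x : Γ × List τ => x.2) (g := fun x => F₀ x.1)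
      (h := fun x y => F₁ (x.1, y.1, y.2.2)) Primrec.snd (hF₀.comp Primrec.fst) ?_
    have h : Primrec fun x : (Γ × List τ) × τ × List τ × Code => (x.1.1, x.2.1, x.2.2.2) :=
      (Primrec.fst.comp Primrec.fst).pair ((Primrec.fst.comp Primrec.snd).pair
        (Primrec.snd.comp (Primrec.snd.comp Primrec.snd)))
    exact hF₁.comp h
  have hF' := hF.to_comp
  have h1 : Computable fun x : Γ × List τ => (F x, ()) := by fun_prop
  have h2 := (partrec_evalCode (α := Unit) (β := β)).comp h1
  refine ⟨fun x => evalCode Unit β (F x) (), h2, ?_⟩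
  intro k l
  induction l with
  | nil =>
    intro x hx
    obtain rfl := mem_sumVal_nil.1 hx
    simpa only [map_zero, hF0] using H₀ k
  | cons t l ih =>
    intro x hx
    obtain ⟨y, hy, z, hz, rfl⟩ := mem_sumVal_cons.1 hx
    obtain ⟨c, hc, hc'⟩ := ih z hz
    obtain ⟨b, hb, hb'⟩ := Hp k t y hy
    obtain ⟨d, hd, hd'⟩ := Hq k (b, c) (f k y, f k z) (mem_prodVal.2 ⟨hb', hc'⟩)
    refine ⟨d, ?_, by simpa only [map_add] using hd'⟩
    simp only [hF1, H₁]
    exact Part.mem_bind hb (Part.mem_bind hc hd)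

end Sums

end Effective

/-! ### Computing with elements of the bar module -/

section Integers

lemma Int.primrec_toNat : Primrec Int.toNat := by
  have h : Primrec fun z : ℤ => bif (Encodable.encode z).bodd then 0
      else (Encodable.encode z).div2 :=
    Primrec.cond (Primrec.nat_bodd.comp Primrec.encode) (Primrec.const 0)
      (Primrec.nat_div2.comp Primrec.encode)
  refine h.of_eq fun z => ?_
  rcases z with n | n
  · have : Encodable.encode (Int.ofNat n) = 2 * n := rfl
    rw [this]
    simp
  · have : Encodable.encode (Int.negSucc n) = 2 * n + 1 := rfl
    simp [this]

lemma Int.primrec_neg : Primrec fun z : ℤ => -z := by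
  have h : Primrec fun z : ℤ => bif (Encodable.encode z).bodd then (Encodable.encode z) + 1
      else (Encodable.encode z) - 1 :=
    Primrec.cond (Primrec.nat_bodd.comp Primrec.encode) (Primrec.succ.comp Primrec.encode)
      (Primrec.pred.comp Primrec.encode)
  refine Primrec.encode_iff.1 (h.of_eq fun z => ?_)
  rcases z with n | n
  · have : Encodable.encode (Int.ofNat n) = 2 * n := rfl
    rcases n with _ | n
    · rfl
    · have h2 : Encodable.encode (-Int.ofNat (n + 1)) = 2 * n + 1 := rfl
      rw [this, h2]
      simp
      omega
  · have : Encodable.encode (Int.negSucc n) = 2 * n + 1 := rfl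
    have h2 : Encodable.encode (-Int.negSucc n) = 2 * (n + 1) := rfl
    rw [this, h2]
    simp
    omega

lemma Int.primrec_natCast : Primrec fun n : ℕ => (n : ℤ) :=
  Primrec.encode_iff.1 ((Primrec.nat_mul.comp (Primrec.const 2) Primrec.id).of_eq fun _ => rfl)

lemma Int.primrec_subNatNat : Primrec₂ Int.subNatNat := by
  have h : Primrec fun x : ℕ × ℕ => if x.2 ≤ x.1 then ((x.1 - x.2 : ℕ) : ℤ)
      else -((x.2 - x.1 : ℕ) : ℤ) :=
    Primrec.ite (Primrec.nat_le.comp Primrec.snd Primrec.fst)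
      (Int.primrec_natCast.comp (Primrec.nat_sub.comp Primrec.fst Primrec.snd))
      (Int.primrec_neg.comp
        (Int.primrec_natCast.comp (Primrec.nat_sub.comp Primrec.snd Primrec.fst)))
  refine h.of_eq fun x => ?_
  rw [Int.subNatNat_eq_coe]
  split_ifs <;> omega

/-- Multiplication of integers is primitive recursive: split both factors into their positive and
negative parts. -/
lemma Int.primrec_mul : Primrec₂ fun x y : ℤ => x * y := by
  have h1 : Primrec fun x : ℤ × ℤ => x.1.toNat := Int.primrec_toNat.comp Primrec.fst
  have h2 : Primrec fun x : ℤ × ℤ => (-x.1).toNat :=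
    Int.primrec_toNat.comp (Int.primrec_neg.comp Primrec.fst)
  have h3 : Primrec fun x : ℤ × ℤ => x.2.toNat := Int.primrec_toNat.comp Primrec.snd
  have h4 : Primrec fun x : ℤ × ℤ => (-x.2).toNat :=
    Int.primrec_toNat.comp (Int.primrec_neg.comp Primrec.snd)
  refine (Int.primrec_subNatNat.comp
    (Primrec.nat_add.comp (Primrec.nat_mul.comp h1 h3) (Primrec.nat_mul.comp h2 h4))
    (Primrec.nat_add.comp (Primrec.nat_mul.comp h1 h4) (Primrec.nat_mul.comp h2 h3))).of_eq ?_
  rintro ⟨x, y⟩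
  have hx : x = x.toNat - (-x).toNat := by omega
  have hy : y = y.toNat - (-y).toNat := by omega
  rw [Int.subNatNat_eq_coe]
  push_cast
  generalize (x.toNat : ℤ) = a at *
  generalize ((-x).toNat : ℤ) = b at *
  generalize (y.toNat : ℤ) = c at *
  generalize ((-y).toNat : ℤ) = d at *
  subst hx hy
  ring

lemma Computable.intMul {α : Type*} [Primcodable α] {f g : α → ℤ} (hf : Computable f)
    (hg : Computable g) : Computable fun x => f x * g x :=
  Int.primrec_mul.to_comp.comp hf hg

end Integers

section BarNames

variable {G : Type u} [Group G]

/-- A token `(z, g, l, q, a)` is the data naming `z • (g | l ⊗ x)`, where `x` has degree `q` and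
name `a`. -/
abbrev BarToken (G : Type u) : Type u := ℤ × G × List G × ℕ × ℕ

/-- The numbering of multiples of tensors by tokens. -/
noncomputable def tokVal {N : ChainComplex (ModuleCat.{u} ℤ) ℕ} (ν : ∀ q, ℕ →. N.X q) (n : ℕ) :
    BarToken G →. BarModule G N n := fun t =>
  if h : t.2.2.2.1 + t.2.2.1.length = n then
    (ν t.2.2.2.1 t.2.2.2.2).map fun x => t.1 • barTensor t.2.1 t.2.2.1 t.2.2.2.1 h x
  else Part.none

lemma mem_tokVal {N : ChainComplex (ModuleCat.{u} ℤ) ℕ} {ν : ∀ q, ℕ →. N.X q} {n : ℕ}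
    {t : BarToken G} {u : BarModule G N n} : u ∈ tokVal ν n t ↔
      ∃ h : t.2.2.2.1 + t.2.2.1.length = n, ∃ x ∈ ν t.2.2.2.1 t.2.2.2.2,
        u = t.1 • barTensor t.2.1 t.2.2.1 t.2.2.2.1 h x := by
  unfold tokVal
  split_ifs with h
  · simp [h, eq_comm]
  · simp [h]

/-- The numbering of elements of the bar module by lists of tokens. -/
noncomputable def barVal {N : ChainComplex (ModuleCat.{u} ℤ) ℕ} (ν : ∀ q, ℕ →. N.X q) (n : ℕ) :
    List (BarToken G) →. BarModule G N n := sumVal (tokVal ν n)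

lemma zsmul_barTensor_mem_barVal {N : ChainComplex (ModuleCat.{u} ℤ) ℕ} {ν : ∀ q, ℕ →. N.X q}
    {n : ℕ} (z : ℤ) (g : G) (l : List G) (q : ℕ) (h : q + l.length = n) {a : ℕ} {x : N.X q}
    (hx : x ∈ ν q a) : z • barTensor g l q h x ∈ barVal ν n [(z, g, l, q, a)] :=
  mem_sumVal_singleton.2 (mem_tokVal.2 ⟨h, x, hx, rfl⟩)

lemma barTensor_mem_barVal {N : ChainComplex (ModuleCat.{u} ℤ) ℕ} {ν : ∀ q, ℕ →. N.X q}
    {n : ℕ} (g : G) (l : List G) (q : ℕ) (h : q + l.length = n) {a : ℕ} {x : N.X q}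
    (hx : x ∈ ν q a) : barTensor g l q h x ∈ barVal ν n [(1, g, l, q, a)] := by
  simpa using zsmul_barTensor_mem_barVal 1 g l q h hx

lemma exists_mem_barVal {N : ChainComplex (ModuleCat.{u} ℤ) ℕ} {ν : ∀ q, ℕ →. N.X q}
    (hν : ∀ q x, ∃ a, x ∈ ν q a) (n : ℕ) (w : BarModule G N n) : ∃ l, w ∈ barVal ν n l := by
  induction w using barTensor_induction with
  | h0 => exact ⟨[], mem_sumVal_nil.2 rfl⟩
  | hadd x y hx hy =>
    obtain ⟨l, hl⟩ := hx
    obtain ⟨m, hm⟩ := hy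
    exact ⟨_, add_mem_sumVal hl hm⟩
  | ht g l q h y =>
    obtain ⟨a, ha⟩ := hν q y
    exact ⟨_, barTensor_mem_barVal g l q h ha⟩

variable [Primcodable G] {Γ β κ : Type*} [Primcodable Γ] [Primcodable β] {code : κ → Γ}

/-- An index `k` with the data `(z, g, l, q)` of a token of degree `n k`, up to the name. -/
abbrev TokenIndex (G : Type u) {κ : Type*} (n : κ → ℕ) : Type _ :=
  {t : κ × ℤ × G × List G × ℕ // t.2.2.2.2 + t.2.2.2.1.length = n t.1}

/-- The code of an index in `TokenIndex G n`. -/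
abbrev tokenCode (code : κ → Γ) (n : κ → ℕ) : TokenIndex G n → Γ × ℤ × G × List G × ℕ :=
  fun t => (code t.1.1, t.1.2)

variable {N : κ → ChainComplex (ModuleCat.{u} ℤ) ℕ} {ν : ∀ k q, ℕ →. (N k).X q} {n : κ → ℕ}

/-- An additive map out of the bar module is computable if its values on multiples of tensors
are. -/
lemma EffAdd.effMap_barVal {P : κ → Type*} [∀ k, AddCommMonoid (P k)] {μ : ∀ k, β →. P k}
    (hP : EffAdd code μ) (f : ∀ k, BarModule G (N k) (n k) →+ P k)
    (hf : EffMap (tokenCode code n) (fun t => ν t.1.1 t.1.2.2.2.2) (fun t => μ t.1.1)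
      fun t x => f t.1.1 (t.1.2.1 • barTensor t.1.2.2.1 t.1.2.2.2.1 t.1.2.2.2.2 t.2 x)) :
    EffMap code (fun k => barVal (ν k) (n k)) μ fun k x => f k x := by
  refine hP.effMap_sumVal f ?_
  obtain ⟨p, hp, Hp⟩ := hf
  have h : Computable fun x : Γ × BarToken G =>
    ((x.1, x.2.1, x.2.2.1, x.2.2.2.1, x.2.2.2.2.1), x.2.2.2.2.2) := by fun_prop
  refine ⟨_, hp.comp h, ?_⟩
  rintro k ⟨z, g, l, q, a⟩ u hu
  obtain ⟨h, x, hx, rfl⟩ := mem_tokVal.1 hu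
  exact Hp ⟨(k, z, g, l, q), h⟩ a x hx

/-- The additive map that modifies the group elements of tensors by a computable function. -/
lemma effMap_barVal_of_computable {m : κ → ℕ}
    (f : ∀ k, BarModule G (N k) (n k) →+ BarModule G (N k) (m k))
    (z' : Γ × ℤ × G × List G → ℤ) (g' : Γ × ℤ × G × List G → G) (l' : Γ × G × List G → List G)
    (hz' : Computable z') (hg' : Computable g') (hl' : Computable l')
    (hm : ∀ k g l q, q + l.length = n k → q + (l' (code k, g, l)).length = m k)
    (H : ∀ k z g l q (h : q + l.length = n k) x, f k (z • barTensor g l q h x) =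
      z' (code k, z, g, l) • barTensor (g' (code k, z, g, l)) (l' (code k, g, l)) q
        (hm k g l q h) x) :
    EffMap code (fun k => barVal (ν k) (n k)) (fun k => barVal (ν k) (m k)) fun k x => f k x := by
  refine (effAdd_sumVal fun k => tokVal (ν k) (m k)).effMap_barVal f ?_
  refine .of_computable (fun x => [(z' (x.1.1, x.1.2.1, x.1.2.2.1, x.1.2.2.2.1),
    g' (x.1.1, x.1.2.1, x.1.2.2.1, x.1.2.2.2.1), l' (x.1.1, x.1.2.2.1, x.1.2.2.2.1),
    x.1.2.2.2.2, x.2)]) (by fun_prop) ?_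
  rintro ⟨⟨k, z, g, l, q⟩, h⟩ a x hx
  simp only [H]
  exact zsmul_barTensor_mem_barVal _ _ _ _ _ hx

variable (ν n) in
/-- The group operations of the bar module are computable. -/
lemma effGroup_barVal : EffGroup code fun k => barVal (G := G) (ν k) (n k) :=
  { effAdd_sumVal fun k => tokVal (ν k) (n k) with
    zsmul' := by
      refine effMap_barVal_of_computable (κ := κ × ℤ) (N := fun k => N k.1) (ν := fun k => ν k.1)
        (n := fun k => n k.1) (m := fun k => n k.1)
        (code := fun k => (code k.1, k.2)) (fun k => DistribSMul.toAddMonoidHom _ k.2)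
        (fun x : (Γ × ℤ) × ℤ × G × List G => x.1.2 * x.2.1) (fun x => x.2.2.1)
        (fun x => x.2.2) ?_ (by fun_prop) (by fun_prop) (fun _ _ _ _ h => h) ?_
      · exact Computable.intMul (by fun_prop) (by fun_prop)
      · intro k z g l q h x
        simp [mul_smul] }

/-- The action of group elements on the bar module is computable. -/
lemma effMap_mulAct [Finite G] : EffMap (κ := κ × G) (fun k => (code k.1, k.2))
    (fun k => barVal (G := G) (ν k.1) (n k.1)) (fun k => barVal (G := G) (ν k.1) (n k.1))
    fun k x => mulAct k.2 x := by
  refine effMap_barVal_of_computable (κ := κ × G) (N := fun k => N k.1) (ν := fun k => ν k.1)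
    (n := fun k => n k.1) (m := fun k => n k.1) (code := fun k => (code k.1, k.2))
    (fun k => mulAct k.2) (fun x => x.2.1) (fun x => x.1.2 * x.2.2.1) (fun x => x.2.2)
    (by fun_prop) ?_ (by fun_prop)
    (fun _ _ _ _ h => h) ?_
  · have h : Computable₂ fun x y : G => x * y :=
      (Primrec.dom_finite fun x : G × G => x.1 * x.2).to_comp
    exact h.comp (g := fun x : (Γ × G) × ℤ × G × List G => x.1.2) (h := fun x => x.2.2.1)
      (by fun_prop) (by fun_prop)
  · intro k z g l q h x
    simp

/-- The extra degeneracy is computable: it moves the coefficient `g₀` into the word. -/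
lemma effMap_barS : EffMap code (fun k => barVal (G := G) (ν k) (n k))
    (fun k => barVal (G := G) (ν k) (n k + 1)) fun k x => barS G (N k) (n k) x := by
  refine effMap_barVal_of_computable (fun k => barS G (N k) (n k)) (fun x => x.2.1)
    (fun _ => 1) (fun x => x.2.1 :: x.2.2) (by fun_prop) (by fun_prop) (by fun_prop)
    (fun _ _ _ _ h => by simp; omega) ?_
  intro k z g l q h x
  simp

end BarNames

section BarPrograms

variable {G : Type u} [Group G] [Primcodable G] {Γ β κ : Type*} [Primcodable Γ] [Primcodable β]
  {code : κ → Γ} {N : κ → ChainComplex (ModuleCat.{u} ℤ) ℕ} {ν : ∀ k q, ℕ →. (N k).X q}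

/-- The index set of pairs of an index and a degree. -/
abbrev degCode (code : κ → Γ) : κ × ℕ → Γ × ℕ := fun k => (code k.1, k.2)

/-- The names of elements of the bar module, indexed by degree. -/
noncomputable abbrev barVals (G : Type u) [Group G] (ν : ∀ k q, ℕ →. (N k).X q) :
    ∀ k : κ × ℕ, List (BarToken G) →. BarModule G (N k.1) k.2 :=
  fun k => barVal (ν k.1) k.2

lemma effMap_barTensor : EffMap (κ := κ × G × List G × ℕ) (fun k => (code k.1, k.2))
    (fun k => ν k.1 k.2.2.2) (fun k => barVal (G := G) (ν k.1) (k.2.2.2 + k.2.2.1.length))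
    fun k x => barTensor k.2.1 k.2.2.1 k.2.2.2 rfl x :=
  .of_computable (fun x => [(1, x.1.2.1, x.1.2.2.1, x.1.2.2.2, x.2)]) (by fun_prop)
    fun _ _ _ hx => barTensor_mem_barVal _ _ _ _ hx

lemma effMap_barι : EffMap (degCode code) (fun k => ν k.1 k.2) (barVals G ν)
    fun k x => barι G (N k.1) k.2 x :=
  .of_computable (fun x => [(1, 1, [], x.1.2, x.2)]) (by fun_prop)
    fun _ _ _ hx => barTensor_mem_barVal _ _ _ _ hx

lemma effMap_barSPred : EffMap (degCode code) (fun k => barVal (G := G) (ν k.1) (k.2 - 1))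
    (barVals G ν) fun k x => barSPred G (N k.1) k.2 x :=
  .natCases (.const (.of_computable (fun _ => []) (by fun_prop) fun _ => mem_sumVal_nil.2 rfl))
    (effMap_barS (N := fun k : κ × ℕ => N k.1) (ν := fun k => ν k.1) (n := fun k => k.2))

section Rec

variable {P : κ → ℕ → Type*} [∀ k n, AddCommGroup (P k n)] {μ : ∀ k n, β →. P k n}
  {act : ∀ k n, G → P k n →+ P k n} {a : ∀ k n, (N k).X n →+ P k n}
  {t : ∀ k n, P k n →+ P k (n + 1)} {v : ∀ k n, BarModule G (N k) n →+ P k (n + 1)}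

/-- One step of the recursion `barRecAux`. -/
lemma effMap_barRecAux_cons (hP : EffGroup (degCode code) fun k => μ k.1 k.2)
    (hact : EffMap (κ := (κ × ℕ) × G) (fun k => (degCode code k.1, k.2)) (fun k => μ k.1.1 k.1.2)
      (fun k => μ k.1.1 k.1.2) fun k x => act k.1.1 k.1.2 k.2 x)
    (ht : EffMap (degCode code) (fun k => μ k.1 k.2) (fun k => μ k.1 (k.2 + 1))
      fun k x => t k.1 k.2 x)
    (hv : EffMap (degCode code) (barVals G ν) (fun k => μ k.1 (k.2 + 1)) fun k x => v k.1 k.2 x)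
    {Γ' κ' : Type*} [Primcodable Γ'] {code' : κ' → Γ'} (e : κ' → κ × G × List G × ℕ)
    (ε : Γ' → Γ × G × List G × ℕ) (hε : Computable ε)
    (he : ∀ k, (code (e k).1, (e k).2) = ε (code' k))
    (h : EffMap code' (fun k => ν (e k).1 (e k).2.2.2)
      (fun k => μ (e k).1 ((e k).2.2.2 + (e k).2.2.1.length))
      fun k x => barRecAux (act (e k).1) (a (e k).1) (t (e k).1) (v (e k).1) (e k).2.2.2
        (e k).2.2.1 x) :
    EffMap code' (fun k => ν (e k).1 (e k).2.2.2)
      (fun k => μ (e k).1 ((e k).2.2.2 + ((e k).2.1 :: (e k).2.2.1).length))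
      fun k x => barRecAux (act (e k).1) (a (e k).1) (t (e k).1) (v (e k).1) (e k).2.2.2
        ((e k).2.1 :: (e k).2.2.1) x := by
  have hd : Computable fun x => ((ε x).1, (ε x).2.2.2 + (ε x).2.2.1.length) := by fun_prop
  have hd' : Computable fun x => ((ε x).1, (ε x).2.2.2 + (ε x).2.2.1.length + 1) := by fun_prop
  have hdg : Computable fun x =>
    (((ε x).1, (ε x).2.2.2 + (ε x).2.2.1.length), (ε x).2.1) := by fun_prop
  have h1 : EffGroup code' fun k => μ (e k).1 ((e k).2.2.2 + (e k).2.2.1.length + 1) :=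
    hP.reindex (fun k => ((e k).1, (e k).2.2.2 + (e k).2.2.1.length + 1)) _ hd'
      fun k => by rw [← he]
  have h2 := ht.reindex (code' := code')
    (fun k => ((e k).1, (e k).2.2.2 + (e k).2.2.1.length)) _ hd fun k => by rw [← he]
  have h3 := hact.reindex (code' := code')
    (fun k => (((e k).1, (e k).2.2.2 + (e k).2.2.1.length), (e k).2.1)) _ hdg
    fun k => by rw [← he]
  have h4 := hv.reindex (code' := code')
    (fun k => ((e k).1, (e k).2.2.2 + (e k).2.2.1.length)) _ hd fun k => by rw [← he]
  have h5 := (effMap_barTensor (G := G) (code := code) (ν := ν)).reindex (code' := code') e ε hε he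
  exact h1.add (h2.comp (h3.comp h)) (h4.comp h5)

/-- The recursion `barRec` is computable if its data are. -/
lemma effMap_barRec (hP : EffGroup (degCode code) fun k => μ k.1 k.2)
    (hact : EffMap (κ := (κ × ℕ) × G) (fun k => (degCode code k.1, k.2)) (fun k => μ k.1.1 k.1.2)
      (fun k => μ k.1.1 k.1.2) fun k x => act k.1.1 k.1.2 k.2 x)
    (ha : EffMap (degCode code) (fun k => ν k.1 k.2) (fun k => μ k.1 k.2) fun k x => a k.1 k.2 x)
    (ht : EffMap (degCode code) (fun k => μ k.1 k.2) (fun k => μ k.1 (k.2 + 1))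
      fun k x => t k.1 k.2 x)
    (hv : EffMap (degCode code) (barVals G ν) (fun k => μ k.1 (k.2 + 1)) fun k x => v k.1 k.2 x) :
    EffMap (degCode code) (barVals G ν) (fun k => μ k.1 k.2)
      fun k x => barRec (act k.1) (a k.1) (t k.1) (v k.1) k.2 x := by
  have haux : EffMap (κ := (κ × ℕ) × List G) (fun k => (degCode code k.1, k.2))
      (fun k => ν k.1.1 k.1.2) (fun k => μ k.1.1 (k.1.2 + k.2.length))
      fun k x => barRecAux (act k.1.1) (a k.1.1) (t k.1.1) (v k.1.1) k.1.2 k.2 x := by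
    refine EffMap.listRec (X := fun k : (κ × ℕ) × List G => (N k.1.1).X k.1.2)
      (Y := fun k : (κ × ℕ) × List G => P k.1.1 (k.1.2 + k.2.length)) ha ?_
    refine effMap_barRecAux_cons hP hact ht hv (Γ' := G × ((Γ × ℕ) × List G) × Nat.Partrec.Code)
      (κ' := G × Programmed (κ := (κ × ℕ) × List G) (fun k => ν k.1.1 k.1.2)
        (fun k => μ k.1.1 (k.1.2 + k.2.length)) fun k x =>
          barRecAux (act k.1.1) (a k.1.1) (t k.1.1) (v k.1.1) k.1.2 k.2 x)
      (fun k => (k.2.1.1.1.1, k.1, k.2.1.1.2, k.2.1.1.1.2))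
      (fun x => (x.2.1.1.1, x.1, x.2.1.2, x.2.1.1.2)) (by fun_prop) (fun _ => rfl) ?_
    exact (EffMap.programmed (fun k : (κ × ℕ) × List G => (degCode code k.1, k.2))
      (fun k => ν k.1.1 k.1.2) (fun k => μ k.1.1 (k.1.2 + k.2.length)) fun k x =>
        barRecAux (act k.1.1) (a k.1.1) (t k.1.1) (v k.1.1) k.1.2 k.2 x).reindex
      Prod.snd Prod.snd Computable.snd fun _ => rfl
  refine EffAdd.effMap_barVal (κ := κ × ℕ) (N := fun k => N k.1) (n := fun k => k.2)
    hP.toEffAdd (fun k => barRec (act k.1) (a k.1) (t k.1) (v k.1) k.2) ?_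
  have h1 := (haux.reindex (fun k : κ × ℤ × G × List G × ℕ => ((k.1, k.2.2.2.2), k.2.2.2.1))
    (code' := fun k => (code k.1, k.2)) (fun x => ((x.1, x.2.2.2.2), x.2.2.2.1)) (by fun_prop)
    fun _ => rfl)
  have h2 := (hact.reindex
    (fun k : κ × ℤ × G × List G × ℕ => ((k.1, k.2.2.2.2 + k.2.2.2.1.length), k.2.2.1))
    (code' := fun k => (code k.1, k.2))
    (fun x => ((x.1, x.2.2.2.2 + x.2.2.2.1.length), x.2.2.1)) (by fun_prop) fun _ => rfl)
  have h3 := (hP.zsmul'.reindex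
    (fun k : κ × ℤ × G × List G × ℕ => ((k.1, k.2.2.2.2 + k.2.2.2.1.length), k.2.1))
    (code' := fun k => (code k.1, k.2))
    (fun x => ((x.1, x.2.2.2.2 + x.2.2.2.1.length), x.2.1)) (by fun_prop) fun _ => rfl)
  obtain ⟨p, hp, Hp⟩ := h3.comp (h2.comp h1)
  have hc : Computable fun x : ((Γ × ℕ) × ℤ × G × List G × ℕ) × ℕ => ((x.1.1.1, x.1.2), x.2) := by
    fun_prop
  refine ⟨_, hp.comp hc, ?_⟩
  rintro ⟨⟨⟨k, m⟩, z, g, l, q⟩, h⟩ b x hx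
  obtain rfl : q + l.length = m := h
  obtain ⟨c, hc, hc'⟩ := Hp (k, z, g, l, q) b x hx
  refine ⟨c, hc, ?_⟩
  simpa only [map_zsmul, barRec_barTensor] using hc'

end Rec

end BarPrograms

/-! ### Computability of the bar construction -/

section EffReduction

variable {Γ α β γ κ : Type*} [Primcodable Γ] [Primcodable α] [Primcodable β] [Primcodable γ]

/-- The maps of the reductions `r k` are computed on names, uniformly in `k` and the degree. -/
structure EffReduction (code : κ → Γ) {R : Type*} [Ring R]
    {C D : κ → ChainComplex (ModuleCat.{u} R) ℕ} (ν : ∀ k q, α →. (C k).X q)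
    (μ : ∀ k q, β →. (D k).X q) (r : ∀ k, Reduction (C k) (D k)) : Prop where
  proj : EffMap (degCode code) (fun k => ν k.1 k.2) (fun k => μ k.1 k.2)
    fun k x => (r k.1).projHom k.2 x
  incl : EffMap (degCode code) (fun k => μ k.1 k.2) (fun k => ν k.1 k.2)
    fun k x => (r k.1).inclHom k.2 x
  htpy : EffMap (degCode code) (fun k => ν k.1 k.2) (fun k => ν k.1 (k.2 + 1))
    fun k x => (r k.1).htpyHom k.2 x

variable {code : κ → Γ}

/-- Restriction of a computable family of maps to the successor of the degree. -/
lemma EffMap.succ {X Y : κ → ℕ → Type*} {ν : ∀ k n, α →. X k n} {μ : ∀ k n, β →. Y k n}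
    {f : ∀ k n, X k n → Y k n}
    (h : EffMap (degCode code) (fun k => ν k.1 k.2) (fun k => μ k.1 k.2) fun k => f k.1 k.2) :
    EffMap (degCode code) (fun k => ν k.1 (k.2 + 1)) (fun k => μ k.1 (k.2 + 1))
      fun k => f k.1 (k.2 + 1) :=
  h.reindex (fun k : κ × ℕ => (k.1, k.2 + 1)) (fun x : Γ × ℕ => (x.1, x.2 + 1)) (by fun_prop)
    fun _ => rfl

/-- Restriction of a computable family of maps to the predecessor of the degree. -/
lemma EffMap.pred {X Y : κ → ℕ → Type*} {ν : ∀ k n, α →. X k n} {μ : ∀ k n, β →. Y k n}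
    {f : ∀ k n, X k n → Y k n}
    (h : EffMap (degCode code) (fun k => ν k.1 k.2) (fun k => μ k.1 k.2) fun k => f k.1 k.2) :
    EffMap (degCode code) (fun k => ν k.1 (k.2 - 1)) (fun k => μ k.1 (k.2 - 1))
      fun k => f k.1 (k.2 - 1) :=
  h.reindex (fun k : κ × ℕ => (k.1, k.2 - 1)) (fun x : Γ × ℕ => (x.1, x.2 - 1))
    (Computable.fst.pair (Computable.pred.comp Computable.snd)) fun _ => rfl

lemma EffGroup.succ {X : κ → ℕ → Type*} [∀ k n, AddCommGroup (X k n)] {ν : ∀ k n, α →. X k n}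
    (h : EffGroup (degCode code) fun k => ν k.1 k.2) :
    EffGroup (degCode code) fun k => ν k.1 (k.2 + 1) :=
  h.reindex (fun k : κ × ℕ => (k.1, k.2 + 1)) (fun x : Γ × ℕ => (x.1, x.2 + 1)) (by fun_prop)
    fun _ => rfl

variable {R : Type*} [Ring R] {C D E : κ → ChainComplex (ModuleCat.{u} R) ℕ}
  {ν : ∀ k q, α →. (C k).X q} {μ : ∀ k q, β →. (D k).X q} {ξ : ∀ k q, γ →. (E k).X q}
  {r : ∀ k, Reduction (C k) (D k)} {s : ∀ k, Reduction (D k) (E k)}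

lemma EffReduction.refl (hC : EffGroup (degCode code) fun k => ν k.1 k.2) :
    EffReduction code ν ν fun k => Reduction.refl (C k) :=
  ⟨.id, .id, .const hC.succ.zero⟩

lemma EffReduction.trans (hC : EffGroup (degCode code) fun k => ν k.1 k.2)
    (hr : EffReduction code ν μ r) (hs : EffReduction code μ ξ s) :
    EffReduction code ν ξ fun k => (r k).trans (s k) where
  proj := hs.proj.comp hr.proj
  incl := hr.incl.comp hs.incl
  htpy := by
    simp only [Reduction.trans_htpyHom]
    exact hC.succ.add hr.htpy ((EffMap.succ (f := fun k n x => (r k).inclHom n x) hr.incl).comp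
      (hs.htpy.comp hr.proj))

end EffReduction

section

variable {G : Type u} [Group G] [Primcodable G] {Γ κ : Type*} [Primcodable Γ] {code : κ → Γ}
  {N : κ → ChainComplex (ModuleCat.{u} ℤ) ℕ} {ν : ∀ k q, ℕ →. (N k).X q}

lemma effMap_barι_succ : EffMap (degCode code) (fun k => ν k.1 (k.2 + 1))
    (fun k => barVal (G := G) (ν k.1) (k.2 + 1)) fun k x => barι G (N k.1) (k.2 + 1) x :=
  EffMap.succ (μ := fun k n => barVal (G := G) (ν k) n) (f := fun k n x => barι G (N k) n x)
    effMap_barι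

lemma effMap_barι_pred : EffMap (degCode code) (fun k => ν k.1 (k.2 - 1))
    (fun k => barVal (G := G) (ν k.1) (k.2 - 1)) fun k x => barι G (N k.1) (k.2 - 1) x :=
  EffMap.pred (μ := fun k n => barVal (G := G) (ν k) n) (f := fun k n x => barι G (N k) n x)
    effMap_barι

end

section Bar

variable {G : Type u} [Group G] [Finite G] [Primcodable G] {Γ κ : Type*} [Primcodable Γ]
  {code : κ → Γ} {M : κ → ChainComplex (ModuleCat.{u} (MonoidAlgebra ℤ G)) ℕ}
  {T N : κ → ChainComplex (ModuleCat.{u} ℤ) ℕ} {L : ∀ k, Reduction (T k) (underlying G (M k))}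
  {r : ∀ k, Reduction (T k) (N k)} {νM : ∀ k q, ℕ →. (underlying G (M k)).X q}
  {νT : ∀ k q, ℕ →. (T k).X q} {νN : ∀ k q, ℕ →. (N k).X q}

/-- The action of group elements on `M` is computable. -/
def EffAct (code : κ → Γ) (νM : ∀ k q, ℕ →. (underlying G (M k)).X q) : Prop :=
  EffMap (κ := (κ × ℕ) × G) (fun k => (degCode code k.1, k.2)) (fun k => νM k.1.1 k.1.2)
    (fun k => νM k.1.1 k.1.2) fun k x => underlyingAct (M k.1.1) k.1.2 k.2 x

/-- The differentials of the complexes `C k` are computable. -/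
def EffDiff (code : κ → Γ) {R : Type*} [Ring R] {C : κ → ChainComplex (ModuleCat.{u} R) ℕ}
    {α : Type*} [Primcodable α] (ν : ∀ k q, α →. (C k).X q) : Prop :=
  EffMap (degCode code) (fun k => ν k.1 k.2) (fun k => ν k.1 (k.2 - 1))
    fun k x => dHom (C k.1) k.2 x

omit [Finite G] in
lemma effMap_transferAct (hT : EffGroup (degCode code) fun k => νT k.1 k.2)
    (hL : EffReduction code νT νM L) (hact : EffAct code νM) :
    EffMap (κ := (κ × ℕ) × G) (fun k => (degCode code k.1, k.2)) (fun k => νT k.1.1 k.1.2)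
      (fun k => νT k.1.1 k.1.2) fun k x => transferAct (L k.1.1) k.1.2 k.2 x := by
  have hT' := hT.reindex (code' := fun k : (κ × ℕ) × G => (degCode code k.1, k.2)) (fun k => k.1)
    (fun x => x.1) (by fun_prop) fun _ => rfl
  have hp := hL.proj.reindex (code' := fun k : (κ × ℕ) × G => (degCode code k.1, k.2))
    (fun k => k.1) (fun x => x.1) (by fun_prop) fun _ => rfl
  have hi := hL.incl.reindex (code' := fun k : (κ × ℕ) × G => (degCode code k.1, k.2))
    (fun k => k.1) (fun x => x.1) (by fun_prop) fun _ => rfl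
  exact hT'.add (hi.comp (hact.comp hp)) (hT'.sub .id (hi.comp hp))

section

variable (hT : EffGroup (degCode code) fun k => νT k.1 k.2)
  (hL : EffReduction code νT νM L) (hact : EffAct code νM) (hr : EffReduction code νT νN r)

include hT hL hact hr

omit [Finite G] in
lemma effMap_barΦ : EffMap (degCode code) (barVals G νN) (fun k => νT k.1 k.2)
    fun k x => barΦ (L k.1) (r k.1) k.2 x :=
  effMap_barRec (P := fun k n => (T k).X n) (act := fun k => transferAct (L k))
    (a := fun k => (r k).inclHom) (t := fun k => (r k).htpyHom) (v := 0) hT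
    (effMap_transferAct hT hL hact) hr.incl hr.htpy (.const hT.succ.zero)

omit [Finite G] in
lemma effMap_barE : EffMap (degCode code) (barVals G νN) (fun k => νN k.1 k.2)
    fun k x => barE (L k.1) (r k.1) k.2 x :=
  hr.proj.comp (effMap_barΦ hT hL hact hr)

omit [Finite G] in
lemma effMap_barΨ : EffMap (degCode code) (barVals G νT) (fun k => νT k.1 (k.2 + 1))
    fun k x => barΨ (L k.1) (r k.1) k.2 x := by
  have h := (effMap_transferAct hT hL hact).reindex
    (code' := fun k : (κ × ℕ) × G => (degCode code k.1, k.2))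
    (fun k => ((k.1.1, k.1.2 + 1), k.2)) (fun x => ((x.1.1, x.1.2 + 1), x.2)) (by fun_prop)
    fun _ => rfl
  have h1 : EffGroup (degCode code) fun k => νT k.1 (k.2 + 1) := EffGroup.succ (ν := νT) hT
  have h2 : EffGroup (degCode code) fun k => νT k.1 (k.2 + 1 + 1) :=
    EffGroup.succ (ν := fun k n => νT k (n + 1)) h1
  exact effMap_barRec (P := fun k n => (T k).X (n + 1)) (μ := fun k n => νT k (n + 1))
    (act := fun k n => transferAct (L k) (n + 1)) (a := fun k n => -(r k).htpyHom n)
    (t := fun k n => -(r k).htpyHom (n + 1)) (v := 0) h1 h (h1.neg hr.htpy)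
    (h2.neg (EffMap.succ (μ := fun k n => νT k (n + 1))
      (f := fun k n x => (r k).htpyHom n x) hr.htpy)) (.const h2.zero)

lemma effMap_barProj : EffMap (degCode code) (barVals G νT) (barVals G νN)
    fun k x => barProj (L k.1) (r k.1) k.2 x := by
  refine effMap_barRec (P := fun k n => BarModule G (N k) n) (μ := fun k n => barVal (νN k) n)
    (act := fun _ _ => mulAct) (a := fun k n => (barι G (N k) n).comp ((r k).projHom n))
    (t := fun k => barS G (N k)) (v := fun k n => (barι G (N k) (n + 1)).comp
      (((r k).projHom (n + 1)).comp (barΨ (L k) (r k) n))) (effGroup_barVal _ _)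
    (effMap_mulAct (code := degCode code) (ν := fun k : κ × ℕ => νN k.1) (n := fun k => k.2))
    (effMap_barι.comp hr.proj) effMap_barS ?_
  exact effMap_barι_succ.comp
    ((EffMap.succ (f := fun k n x => (r k).projHom n x) hr.proj).comp (effMap_barΨ hT hL hact hr))

lemma effMap_barIncl : EffMap (degCode code) (barVals G νN) (barVals G νT)
    fun k x => barIncl (L k.1) (r k.1) k.2 x := by
  refine effMap_barRec (P := fun k n => BarModule G (T k) n) (μ := fun k n => barVal (νT k) n)
    (act := fun _ _ => mulAct) (a := fun k n => (barι G (T k) n).comp ((r k).inclHom n))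
    (t := fun k => barS G (T k)) (v := fun k n => (barι G (T k) (n + 1)).comp
      (((r k).htpyHom n).comp (barΦ (L k) (r k) n))) (effGroup_barVal _ _)
    (effMap_mulAct (code := degCode code) (ν := fun k : κ × ℕ => νT k.1) (n := fun k => k.2))
    (effMap_barι.comp hr.incl) effMap_barS ?_
  exact effMap_barι_succ.comp
    (hr.htpy.comp (effMap_barΦ hT hL hact hr))

lemma effMap_barHtpy : EffMap (degCode code) (barVals G νT)
    (fun k => barVal (G := G) (νT k.1) (k.2 + 1)) fun k x => barHtpy (L k.1) (r k.1) k.2 x := by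
  refine effMap_barRec (P := fun k n => BarModule G (T k) (n + 1))
    (μ := fun k n => barVal (νT k) (n + 1))
    (act := fun _ _ => mulAct) (a := fun k n => (barι G (T k) (n + 1)).comp ((r k).htpyHom n))
    (t := fun k n => -barS G (T k) (n + 1)) (v := fun k n => (barι G (T k) (n + 1 + 1)).comp
      (((r k).htpyHom (n + 1)).comp (barΨ (L k) (r k) n))) (effGroup_barVal _ _)
    (effMap_mulAct (code := degCode code) (ν := fun k : κ × ℕ => νT k.1) (n := fun k => k.2 + 1))
    (effMap_barι_succ.comp hr.htpy)
    ((effGroup_barVal _ _).neg effMap_barS) ?_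
  exact (EffMap.succ (ν := fun k n => νT k (n + 1))
    (μ := fun k n => barVal (G := G) (νT k) (n + 1)) (f := fun k n x => barι G (T k) (n + 1) x)
    effMap_barι_succ).comp
    ((EffMap.succ (μ := fun k n => νT k (n + 1))
      (f := fun k n x => (r k).htpyHom n x) hr.htpy).comp (effMap_barΨ hT hL hact hr))

lemma effMap_barD (hN : EffDiff code νN) :
    EffMap (degCode code) (barVals G νN) (fun k => barVal (G := G) (νN k.1) (k.2 - 1))
      fun k x => barD (L k.1) (r k.1) k.2 x := by
  refine effMap_barRec (P := fun k n => BarModule G (N k) (n - 1))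
    (μ := fun k n => barVal (νN k) (n - 1)) (act := fun _ _ => mulAct)
    (a := fun k n => (barι G (N k) (n - 1)).comp (dHom (N k) n))
    (t := fun k n => -barSPred G (N k) n)
    (v := fun k n => AddMonoidHom.id (BarModule G (N k) n) -
      (barι G (N k) n).comp (barE (L k) (r k) n)) (effGroup_barVal _ _)
    (effMap_mulAct (code := degCode code) (ν := fun k : κ × ℕ => νN k.1) (n := fun k => k.2 - 1))
    (effMap_barι_pred.comp hN)
    ((effGroup_barVal _ _).neg effMap_barSPred)
    ((effGroup_barVal _ _).sub .id (effMap_barι.comp (effMap_barE hT hL hact hr)))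

lemma effReduction_barReduction : EffReduction code
    (C := fun k => barComplex (L k) (Reduction.refl (T k))) (D := fun k => barComplex (L k) (r k))
    (fun k => barVal (G := G) (νT k)) (fun k => barVal (G := G) (νN k))
    fun k => barReduction (L k) (r k) where
  proj := effMap_barProj hT hL hact hr
  incl := effMap_barIncl hT hL hact hr
  htpy := by
    have h := effMap_barHtpy hT hL hact hr
    have h2 : ∀ (k : κ × ℕ) (x : BarModule G (T k.1) k.2), barHtpy (L k.1) (r k.1) k.2 x =
        (barReduction (L k.1) (r k.1)).htpyHom k.2 x :=
      fun k x => (barReduction_htpyHom _ _ _ _).symm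
    simp only [h2] at h
    exact h

end

end Bar

/-! ### Uniformly locally effective complexes -/

section EncodedNames

open Encodable (encode decode)

variable {Γ Γ' α β γ κ κ' : Type*} [Primcodable Γ] [Primcodable Γ'] [Primcodable α]
  [Primcodable β] [Primcodable γ] {code : κ → Γ} {X Y Z : κ → Type*} {ν : ∀ k, α →. X k}
  {μ : ∀ k, β →. Y k} {ξ : ∀ k, γ →. Z k}

/-- The numbering by codes of names. -/
def encodeVal {X : Type*} (ν : α →. X) : ℕ →. X := fun a =>
  ((decode a : Option α) : Part α).bind ν

lemma mem_encodeVal {X : Type*} {ν : α →. X} {a : ℕ} {x : X} :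
    x ∈ encodeVal ν a ↔ ∃ b, decode a = some b ∧ x ∈ ν b :=
  Part.mem_bind_iff.trans (by simp)

lemma mem_encodeVal_encode {X : Type*} {ν : α →. X} {a : α} {x : X} :
    x ∈ encodeVal ν (encode a) ↔ x ∈ ν a := by
  simp [mem_encodeVal]

lemma EffMap.encodeName : EffMap code ν (fun k => encodeVal (ν k)) fun _ x => x :=
  .of_computable (fun x => encode x.2) (by fun_prop) fun _ _ _ hx => mem_encodeVal_encode.2 hx

lemma EffMap.decodeName : EffMap code (fun k => encodeVal (ν k)) ν fun _ x => x := by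
  refine ⟨fun x => ((decode x.2 : Option α) : Part α),
    Computable.ofOption (Computable.decode.comp Computable.snd), fun k a x hx => ?_⟩
  obtain ⟨b, hb, hb'⟩ := mem_encodeVal.1 hx
  exact ⟨b, by simp [hb], hb'⟩

lemma EffMap.prodMap {X' Y' : κ → Type*} {α' β' : Type*} [Primcodable α'] [Primcodable β']
    {ν' : ∀ k, α' →. X' k} {μ' : ∀ k, β' →. Y' k} {f : ∀ k, X k → X' k} {g : ∀ k, Y k → Y' k}
    (hf : EffMap code ν ν' f) (hg : EffMap code μ μ' g) :
    EffMap code (fun k => prodVal (ν k) (μ k)) (fun k => prodVal (ν' k) (μ' k))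
      fun k x => (f k x.1, g k x.2) := by
  have h1 : EffMap code (fun k => prodVal (ν k) (μ k)) ν fun _ x => x.1 :=
    .of_computable (fun x => x.2.1) (by fun_prop) fun _ _ _ hx => (mem_prodVal.1 hx).1
  have h2 : EffMap code (fun k => prodVal (ν k) (μ k)) μ fun _ x => x.2 :=
    .of_computable (fun x => x.2.2) (by fun_prop) fun _ _ _ hx => (mem_prodVal.1 hx).2
  exact (hf.comp h1).prodMk (hg.comp h2)

lemma EffMap.swap : EffMap code (fun k => prodVal (ν k) (μ k)) (fun k => prodVal (μ k) (ν k))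
    fun _ x => (x.2, x.1) :=
  .of_computable (fun x => (x.2.2, x.2.1)) (by fun_prop) fun _ _ _ hx =>
    mem_prodVal.2 (mem_prodVal.1 hx).symm

lemma EffAdd.encode [∀ k, AddMonoid (X k)] (h : EffAdd code ν) :
    EffAdd code fun k => encodeVal (ν k) where
  zero := by
    have h1 := EffElt.app EffMap.encodeName h.zero
    exact h1
  add' := EffMap.encodeName.comp (h.add'.comp (EffMap.decodeName.prodMap EffMap.decodeName))

end EncodedNames

section GroupRing

variable {G : Type u} [Group G] [Primcodable G] {Γ β κ : Type*} [Primcodable Γ] [Primcodable β]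
  {code : κ → Γ}

/-- The element of the group ring named by a pair. -/
noncomputable def termVal (G : Type u) [Group G] : ℤ × G →. MonoidAlgebra ℤ G := fun p =>
  Part.some (MonoidAlgebra.single p.2 p.1)

lemma mem_groupRing_val {a : ℕ} {x : MonoidAlgebra ℤ G} :
    x ∈ (Naming.groupRing G).val a ↔ x ∈ encodeVal (sumVal (termVal G)) a := by
  have h : ∀ l : List (ℤ × G), x ∈ sumVal (termVal G) l ↔
      x = (l.map fun p => MonoidAlgebra.single p.2 p.1).sum := by
    intro l
    induction l generalizing x with
    | nil => simp [mem_sumVal_nil]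
    | cons t l ih => simp [mem_sumVal_cons, ih, termVal]
  rw [mem_encodeVal]
  simp only [h, Naming.groupRing, Part.mem_map_iff, Part.mem_coe, Option.mem_def, eq_comm]

/-- A map is computable on the group ring if it is additive and computable on the multiples of
group elements. -/
lemma EffAdd.effMap_groupRing {B : κ → Type*} [∀ k, AddCommMonoid (B k)] {μ : ∀ k, β →. B k}
    (hB : EffAdd code μ) (f : ∀ k, MonoidAlgebra ℤ G →+ B k)
    (hf : EffElt (κ := κ × ℤ × G) (fun k => (code k.1, k.2)) (fun k => μ k.1)
      fun k => f k.1 (MonoidAlgebra.single k.2.2 k.2.1)) :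
    EffMap code (fun _ => (Naming.groupRing G).val) μ fun k x => f k x := by
  have h : (fun _ : κ => (Naming.groupRing G).val) = fun _ => encodeVal (sumVal (termVal G)) := by
    funext k a
    exact Part.ext fun x => mem_groupRing_val
  rw [h]
  refine (hB.effMap_sumVal f ?_).comp EffMap.decodeName
  obtain ⟨p, hp, Hp⟩ := hf
  refine ⟨p, hp, fun k a x hx => ?_⟩
  obtain rfl : x = _ := Part.mem_some_iff.1 hx
  exact Hp (k, a)

omit [Primcodable G] in
lemma single_smul_eq {P : Type*} [AddCommGroup P] [Module (MonoidAlgebra ℤ G) P] (g : G) (z : ℤ)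
    (x : P) : (MonoidAlgebra.single g z : MonoidAlgebra ℤ G) • x = z • mulAct g x := by
  have : (MonoidAlgebra.single g z : MonoidAlgebra ℤ G) = z • MonoidAlgebra.of ℤ G g := by
    simp [MonoidAlgebra.of_apply, MonoidAlgebra.smul_single]
  rw [this, smul_assoc, mulAct_def]

/-- Scalar multiplication by the group ring is computable if the action of the group is. -/
lemma EffGroup.effMap_smul {B : κ → Type*} [∀ k, AddCommGroup (B k)]
    [∀ k, Module (MonoidAlgebra ℤ G) (B k)] {μ : ∀ k, β →. B k} (hB : EffGroup code μ)
    (hact : EffMap (κ := κ × G) (fun k => (code k.1, k.2)) (fun k => μ k.1) (fun k => μ k.1)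
      fun k x => mulAct k.2 x) :
    EffMap code (fun k => prodVal (Naming.groupRing G).val (μ k)) μ fun _ x => x.1 • x.2 := by
  have hw : EffElt (κ := Named μ × ℤ × G) (fun k => (namedCode code μ k.1, k.2))
      (fun k => μ k.1.1) fun k => k.1.2.1.2 :=
    (EffMap.id (code := code) (ν := μ)).elt.reindex Prod.fst Prod.fst Computable.fst fun _ => rfl
  have hg := hact.reindex (code' := fun k : Named μ × ℤ × G => (namedCode code μ k.1, k.2))
    (fun k => (k.1.1, k.2.2)) (fun x => (x.1.1, x.2.2)) (by fun_prop) fun _ => rfl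
  have hz := hB.zsmul'.reindex
    (code' := fun k : Named μ × ℤ × G => (namedCode code μ k.1, k.2))
    (fun k => (k.1.1, k.2.1)) (fun x => (x.1.1, x.2.1)) (by fun_prop) fun _ => rfl
  have h := EffElt.app hz (EffElt.app hg hw)
  have hB' := hB.toEffAdd.reindex (code' := namedCode code μ) (fun k => k.1) Prod.fst
    Computable.fst fun _ => rfl
  have h2 : EffMap (namedCode code μ) (fun _ => (Naming.groupRing G).val) (fun k => μ k.1)
      fun k r => r • k.2.1.2 := by
    refine hB'.effMap_groupRing (fun k => (smulAddHom (MonoidAlgebra ℤ G) (B k.1)).flip k.2.1.2) ?_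
    have h3 : ∀ k : Named μ × ℤ × G, k.2.1 • mulAct k.2.2 k.1.2.1.2 =
        (AddMonoidHom.flip (smulAddHom (MonoidAlgebra ℤ G) (B k.1.1))) k.1.2.1.2
          (MonoidAlgebra.single k.2.2 k.2.1) := by
      intro k
      rw [AddMonoidHom.flip_apply, smulAddHom_apply, single_smul_eq]
    simpa only [h3] using h
  exact (EffMap.uncurry (f := fun k x => x.2 • x.1) h2).comp EffMap.swap

end GroupRing

section EffComplex

variable {Γ κ : Type*} [Primcodable Γ] {code : κ → Γ} {R : Type*} [Ring R]
  {C D : κ → ChainComplex (ModuleCat.{u} R) ℕ}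

/-- The numbering of a set of natural numbers by its elements. -/
def labelVal (S : Set ℕ) : ℕ →. S := fun b => ⟨b ∈ S, fun h => ⟨b, h⟩⟩

lemma mem_labelVal {S : Set ℕ} {b : ℕ} {i : S} : i ∈ labelVal S b ↔ i.1 = b := by
  refine ⟨?_, ?_⟩
  · rintro ⟨h, rfl⟩
    rfl
  · rintro rfl
    exact ⟨i.2, rfl⟩

/-- The numbering of multiples of basis elements by a name of the scalar and a label. -/
noncomputable def basisTermVal {X : ChainComplex (ModuleCat.{u} R) ℕ} (E : EffStructure X)
    (ρ : Naming R) (n : ℕ) : ℕ × ℕ →. X.X n := fun t =>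
  (ρ.val t.1).bind fun r => (labelVal (E.label n) t.2).map fun i => r • E.basis n i

lemma mem_basisTermVal {X : ChainComplex (ModuleCat.{u} R) ℕ} {E : EffStructure X}
    {ρ : Naming R} {n : ℕ} {t : ℕ × ℕ} {x : X.X n} : x ∈ basisTermVal E ρ n t ↔
      ∃ r ∈ ρ.val t.1, ∃ h : t.2 ∈ E.label n, x = r • E.basis n ⟨t.2, h⟩ := by
  simp only [basisTermVal, Part.mem_bind_iff, Part.mem_map_iff, mem_labelVal]
  constructor
  · rintro ⟨r, hr, ⟨i, hi⟩, rfl, rfl⟩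
    exact ⟨r, hr, hi, rfl⟩
  · rintro ⟨r, hr, h, rfl⟩
    exact ⟨r, hr, _, rfl, rfl⟩

lemma mem_sumVal_basisTermVal {X : ChainComplex (ModuleCat.{u} R) ℕ} {E : EffStructure X}
    {ρ : Naming R} {n : ℕ} {l : List (ℕ × ℕ)} {x : X.X n} :
    x ∈ sumVal (basisTermVal E ρ n) l ↔ E.Expands ρ n l x := by
  induction l generalizing x with
  | nil => simp [mem_sumVal_nil, EffStructure.Expands]
  | cons t l ih =>
    obtain ⟨a, b⟩ := t
    rw [mem_sumVal_cons, EffStructure.Expands]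
    simp only [ih, mem_basisTermVal]
    constructor
    · rintro ⟨_, ⟨r, hr, h, rfl⟩, z, hz, rfl⟩
      exact ⟨r, hr, h, z, hz, rfl⟩
    · rintro ⟨r, hr, h, z, hz, rfl⟩
      exact ⟨_, ⟨r, hr, h, rfl⟩, z, hz, rfl⟩

/-- The numbering of the elements of a complex with an effective structure. -/
abbrev nameVal (E : ∀ k, EffStructure (C k)) : ∀ k q, ℕ →. (C k).X q :=
  fun k q => ((E k).name q).val

/-- The complexes `C k` are locally effective, uniformly in `k`. -/
structure EffComplex (code : κ → Γ) (ρ : Naming R) (E : ∀ k, EffStructure (C k)) : Prop where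
  add : EffAdd (degCode code) fun k => nameVal E k.1 k.2
  smul : EffMap (degCode code) (fun k => prodVal ρ.val (nameVal E k.1 k.2))
    (fun k => nameVal E k.1 k.2) fun _ x => x.1 • x.2
  diff : EffDiff code (nameVal E)
  gen : EffMap (degCode code) (fun k => labelVal ((E k.1).label k.2))
    (fun k => nameVal E k.1 k.2) fun k i => (E k.1).basis k.2 i
  coord : EffMap (degCode code) (fun k => nameVal E k.1 k.2)
    (fun k => sumVal (basisTermVal (E k.1) ρ k.2)) fun _ x => x

variable {ρ : Naming R} {E : ∀ k, EffStructure (C k)}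

/-- Multiplication by integers is computable if integers can be named in the ring of scalars. -/
lemma EffComplex.group (h : EffComplex code ρ E) {i : ℤ → ℕ} (hi : Computable i)
    (hi' : ∀ z, (z : R) ∈ ρ.val (i z)) : EffGroup (degCode code) fun k => nameVal E k.1 k.2 :=
  { h.add with
    zsmul' := by
      have h1 := h.smul.reindex (code' := fun k : (κ × ℕ) × ℤ => (degCode code k.1, k.2))
        Prod.fst Prod.fst Computable.fst fun _ => rfl
      have h2 : EffMap (fun k : (κ × ℕ) × ℤ => (degCode code k.1, k.2))
          (fun k => nameVal E k.1.1 k.1.2) (fun k => prodVal ρ.val (nameVal E k.1.1 k.1.2))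
          fun k x => ((k.2 : R), x) :=
        .of_computable (fun x => (i x.1.2, x.2)) (by fun_prop) fun k a x hx =>
          mem_prodVal.2 ⟨hi' _, hx⟩
      simpa only [Int.cast_smul_eq_zsmul] using h1.comp h2 }

end EffComplex

/-! ### From programs to uniform computability and back -/

section Programs

open Nat.Partrec (Code)
open Encodable (encode decode)

lemma computable_complexCodes_equiv : Computable ComplexCodes.equiv := by
  have h := Primrec.of_equiv (e := ComplexCodes.equiv)
  exact h.to_comp

lemma computable_complexCodes_zero : Computable ComplexCodes.zero := by
  have h := Computable.fst.comp computable_complexCodes_equiv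
  exact h.of_eq fun _ => rfl

lemma computable_complexCodes_add : Computable ComplexCodes.add := by
  have h := Computable.fst.comp (Computable.snd.comp computable_complexCodes_equiv)
  exact h.of_eq fun _ => rfl

lemma computable_complexCodes_smul : Computable ComplexCodes.smul := by
  have h := Computable.fst.comp (Computable.snd.comp
    (Computable.snd.comp computable_complexCodes_equiv))
  exact h.of_eq fun _ => rfl

lemma computable_complexCodes_diff : Computable ComplexCodes.diff := by
  have h := Computable.fst.comp (Computable.snd.comp (Computable.snd.comp
    (Computable.snd.comp computable_complexCodes_equiv)))
  exact h.of_eq fun _ => rfl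

lemma computable_complexCodes_gen : Computable ComplexCodes.gen := by
  have h := Computable.fst.comp (Computable.snd.comp (Computable.snd.comp (Computable.snd.comp
    (Computable.snd.comp computable_complexCodes_equiv))))
  exact h.of_eq fun _ => rfl

lemma computable_complexCodes_coord : Computable ComplexCodes.coord := by
  have h := Computable.snd.comp (Computable.snd.comp (Computable.snd.comp (Computable.snd.comp
    (Computable.snd.comp computable_complexCodes_equiv))))
  exact h.of_eq fun _ => rfl

lemma computable_reductionCodes_equiv : Computable ReductionCodes.equiv := by
  have h := Primrec.of_equiv (e := ReductionCodes.equiv)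
  exact h.to_comp

lemma computable_reductionCodes_proj : Computable ReductionCodes.proj := by
  have h := Computable.fst.comp computable_reductionCodes_equiv
  exact h.of_eq fun _ => rfl

lemma computable_reductionCodes_incl : Computable ReductionCodes.incl := by
  have h := Computable.fst.comp (Computable.snd.comp computable_reductionCodes_equiv)
  exact h.of_eq fun _ => rfl

lemma computable_reductionCodes_htpy : Computable ReductionCodes.htpy := by
  have h := Computable.snd.comp (Computable.snd.comp computable_reductionCodes_equiv)
  exact h.of_eq fun _ => rfl

lemma computable_spanCodes_equiv : Computable SpanCodes.equiv := by
  have h := Primrec.of_equiv (e := SpanCodes.equiv)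
  exact h.to_comp

lemma computable_spanCodes_mid : Computable SpanCodes.mid := by
  have h := Computable.fst.comp computable_spanCodes_equiv
  exact h.of_eq fun _ => rfl

lemma computable_spanCodes_target : Computable SpanCodes.target := by
  have h := Computable.fst.comp (Computable.snd.comp computable_spanCodes_equiv)
  exact h.of_eq fun _ => rfl

lemma computable_spanCodes_left : Computable SpanCodes.left := by
  have h := Computable.fst.comp (Computable.snd.comp
    (Computable.snd.comp computable_spanCodes_equiv))
  exact h.of_eq fun _ => rfl

lemma computable_spanCodes_right : Computable SpanCodes.right := by
  have h := Computable.snd.comp (Computable.snd.comp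
    (Computable.snd.comp computable_spanCodes_equiv))
  exact h.of_eq fun _ => rfl

variable {Γ β κ : Type*} [Primcodable Γ] [Primcodable β] {code : κ → Γ}

section

variable {X Y : κ × ℕ → Type*} {ν : ∀ k, ℕ →. X k} {μ : ∀ k, β →. Y k}

lemma EffMap.of_eval {f : ∀ k, X k → Y k} {c : Γ → Code} (hc : Computable c)
    (h : ∀ k n a, ∀ x ∈ ν (k, n) a, ∃ b, encode b ∈ (c (code k)).eval (Nat.pair n a) ∧
      f (k, n) x ∈ μ (k, n) b) : EffMap (degCode code) ν μ f := by
  have h1 : Computable fun x : (Γ × ℕ) × ℕ => (c x.1.1, Nat.pair x.1.2 x.2) := by fun_prop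
  have h2 := (partrec_evalCode (α := ℕ) (β := β)).comp h1
  refine ⟨_, h2, ?_⟩
  rintro ⟨k, n⟩ a x hx
  obtain ⟨b, hb, hb'⟩ := h k n a x hx
  exact ⟨b, Part.mem_bind hb (by simp), hb'⟩

lemma EffMap.exists_eval {f : ∀ k, X k → Y k} (h : EffMap (degCode code) ν μ f) :
    ∃ c : Γ → Code, Computable c ∧ ∀ k n a, ∀ x ∈ ν (k, n) a,
      ∃ b, encode b ∈ (c (code k)).eval (Nat.pair n a) ∧ f (k, n) x ∈ μ (k, n) b := by
  obtain ⟨p, hp, Hp⟩ := h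
  have h1 : Computable fun x : Γ × ℕ × ℕ => ((x.1, x.2.1), x.2.2) := by fun_prop
  have h2 : Partrec fun x : Γ × ℕ × ℕ => (p ((x.1, x.2.1), x.2.2)).map encode :=
    (hp.comp h1).map (Computable.encode.comp Computable.snd).to₂
  obtain ⟨c, hc, H⟩ := h2.exists_evalCode
  refine ⟨c, hc.to_comp, fun k n a x hx => ?_⟩
  obtain ⟨b, hb, hb'⟩ := Hp (k, n) a x hx
  refine ⟨b, ?_, hb'⟩
  have h3 : encode b ∈ evalCode (ℕ × ℕ) ℕ (c (code k)) (n, a) := by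
    rw [H]
    exact Part.mem_map _ hb
  obtain ⟨d, hd, hd'⟩ := Part.mem_bind_iff.1 h3
  have h4 : d = encode b := by simpa [eq_comm] using hd'
  exact h4 ▸ hd

lemma EffElt.of_eval {y : ∀ k, Y k} {c : Γ → Code} (hc : Computable c)
    (h : ∀ k n, ∃ b, encode b ∈ (c (code k)).eval n ∧ y (k, n) ∈ μ (k, n) b) :
    EffElt (degCode code) μ y := by
  have h1 : Computable fun x : Γ × ℕ => (c x.1, x.2) := by fun_prop
  have h2 := (partrec_evalCode (α := ℕ) (β := β)).comp h1
  refine ⟨_, h2, ?_⟩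
  rintro ⟨k, n⟩
  obtain ⟨b, hb, hb'⟩ := h k n
  exact ⟨b, Part.mem_bind hb (by simp), hb'⟩

lemma EffElt.exists_eval {y : ∀ k, Y k} (h : EffElt (degCode code) μ y) :
    ∃ c : Γ → Code, Computable c ∧ ∀ k n,
      ∃ b, encode b ∈ (c (code k)).eval n ∧ y (k, n) ∈ μ (k, n) b := by
  obtain ⟨p, hp, Hp⟩ := h
  have h2 : Partrec fun x : Γ × ℕ => (p x).map encode :=
    hp.map (Computable.encode.comp Computable.snd).to₂
  obtain ⟨c, hc, H⟩ := h2.exists_evalCode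
  refine ⟨c, hc.to_comp, fun k n => ?_⟩
  obtain ⟨b, hb, hb'⟩ := Hp (k, n)
  refine ⟨b, ?_, hb'⟩
  have h3 : encode b ∈ evalCode ℕ ℕ (c (code k)) n := by
    rw [H]
    exact Part.mem_map _ hb
  obtain ⟨d, hd, hd'⟩ := Part.mem_bind_iff.1 h3
  have h4 : d = encode b := by simpa [eq_comm] using hd'
  exact h4 ▸ hd

end

section

variable {X Y Z : κ → ℕ → Type*} {ν : ∀ k n, Naming (X k n)} {μ : ∀ k n, Naming (Y k n)}
  {ξ : ∀ k n, Naming (Z k n)}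

lemma EffMap.of_computes {f : ∀ k n, X k n → Y k n} {c : Γ → Code} (hc : Computable c)
    (h : ∀ k, Computes (c (code k)) (ν k) (μ k) (f k)) :
    EffMap (degCode code) (fun k => (ν k.1 k.2).val) (fun k => (μ k.1 k.2).val)
      fun k x => f k.1 k.2 x :=
  .of_eval hc fun k n a x hx => h k n a x hx

lemma EffMap.exists_computes {f : ∀ k n, X k n → Y k n}
    (h : EffMap (degCode code) (fun k => (ν k.1 k.2).val) (fun k => (μ k.1 k.2).val)
      fun k x => f k.1 k.2 x) :
    ∃ c : Γ → Code, Computable c ∧ ∀ k, Computes (c (code k)) (ν k) (μ k) (f k) := by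
  obtain ⟨c, hc, H⟩ := h.exists_eval
  exact ⟨c, hc, fun k n a x hx => H k n a x hx⟩

lemma mem_naming_prod {X Y : Type*} {ν : Naming X} {μ : Naming Y} {a : ℕ} {x : X × Y} :
    x ∈ (ν.prod μ).val a ↔ x ∈ prodVal ν.val μ.val a.unpair := Iff.rfl

lemma EffMap.pairName {X Y : κ → Type*} {ν : ∀ k, Naming (X k)} {μ : ∀ k, Naming (Y k)} :
    EffMap code (fun k => prodVal (ν k).val (μ k).val) (fun k => ((ν k).prod (μ k)).val)
      fun _ x => x :=
  .of_computable (fun x => Nat.pair x.2.1 x.2.2) (by fun_prop) fun k a x hx => by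
    rw [mem_naming_prod, Nat.unpair_pair]
    exact hx

lemma EffMap.unpairName {X Y : κ → Type*} {ν : ∀ k, Naming (X k)} {μ : ∀ k, Naming (Y k)} :
    EffMap code (fun k => ((ν k).prod (μ k)).val) (fun k => prodVal (ν k).val (μ k).val)
      fun _ x => x :=
  .of_computable (fun x => x.2.unpair) (Computable.unpair.comp Computable.snd) fun _ _ _ hx => hx

end

section

variable {R : Type*} [Ring R] {C D : κ → ChainComplex (ModuleCat.{u} R) ℕ} {ρ : Naming R}
  {E : ∀ k, EffStructure (C k)}

/-- Programs for the operations, computable from the code of `k`, give uniform computability. -/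
lemma EffComplex.of_realizedBy {c : Γ → ComplexCodes} (hc : Computable c)
    (h : ∀ k, (E k).RealizedBy ρ (c (code k))) : EffComplex code ρ E := by
  have hz : EffElt (degCode code) (fun k => nameVal E k.1 k.2) fun _ => 0 :=
    .of_eval (computable_complexCodes_zero.comp hc) fun k n => (h k).zero n
  refine ⟨⟨hz, ?_⟩, ?_, ?_, ?_, ?_⟩
  · exact (EffMap.of_computes (computable_complexCodes_add.comp hc) fun k => (h k).add).comp
      EffMap.pairName
  · exact (EffMap.of_computes (computable_complexCodes_smul.comp hc) fun k => (h k).smul).comp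
      EffMap.pairName
  · refine EffMap.natCases ?_ ?_
    · have h0 : ∀ k (x : (C k).X 0), dHom (C k) 0 x = 0 := fun k x =>
        congrArg (fun f => f.hom x) ((C k).shape 0 (0 - 1) (by simp))
      simp only [h0]
      exact .const (hz.reindex (fun k => (k, 0)) (fun x => (x, 0)) (by fun_prop) fun _ => rfl)
    · exact EffMap.of_computes (computable_complexCodes_diff.comp hc) fun k => (h k).diff
  · refine EffMap.of_eval (computable_complexCodes_gen.comp hc) fun k n a x hx => ?_
    obtain rfl := mem_labelVal.1 hx
    exact (h k).gen n x
  · refine EffMap.of_eval (computable_complexCodes_coord.comp hc) fun k n a x hx => ?_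
    obtain ⟨l, hl, hl'⟩ := (h k).coord n a x hx
    exact ⟨l, hl, mem_sumVal_basisTermVal.2 hl'⟩

/-- Uniform computability gives programs for the operations that are computable from the code
of `k`. -/
lemma EffComplex.exists_realizedBy (h : EffComplex code ρ E) :
    ∃ c : Γ → ComplexCodes, Computable c ∧ ∀ k, (E k).RealizedBy ρ (c (code k)) := by
  obtain ⟨c₁, hc₁, H₁⟩ := h.add.zero.exists_eval
  obtain ⟨c₂, hc₂, H₂⟩ := EffMap.exists_computes (μ := fun k n => (E k).name n)
    (ν := fun k n => ((E k).name n).prod ((E k).name n))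
    (f := fun k n (p : (C k).X n × (C k).X n) => p.1 + p.2) (h.add.add'.comp EffMap.unpairName)
  obtain ⟨c₃, hc₃, H₃⟩ := EffMap.exists_computes (μ := fun k n => (E k).name n)
    (ν := fun k n => ρ.prod ((E k).name n)) (f := fun k n (p : R × (C k).X n) =>
    p.1 • p.2) (h.smul.comp EffMap.unpairName)
  obtain ⟨c₄, hc₄, H₄⟩ := EffMap.exists_computes (ν := fun k n => (E k).name (n + 1))
    (μ := fun k n => (E k).name n) (f := fun k n (x : (C k).X (n + 1)) => (C k).d (n + 1) n x)
    (EffMap.succ (μ := fun k n => nameVal E k (n - 1)) (f := fun k n x => dHom (C k) n x) h.diff)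
  obtain ⟨c₅, hc₅, H₅⟩ := h.gen.exists_eval
  obtain ⟨c₆, hc₆, H₆⟩ := h.coord.exists_eval
  have hc : Computable fun x => (c₁ x, c₂ x, c₃ x, c₄ x, c₅ x, c₆ x) := by fun_prop
  refine ⟨fun x => ⟨c₁ x, c₂ x, c₃ x, c₄ x, c₅ x, c₆ x⟩,
    (Primrec.of_equiv_symm (e := ComplexCodes.equiv)).to_comp.comp hc, fun k => ?_⟩
  refine ⟨H₁ k, H₂ k, H₃ k, H₄ k, fun n i => H₅ k n i i (mem_labelVal.2 rfl), fun n a x hx => ?_⟩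
  obtain ⟨l, hl, hl'⟩ := H₆ k n a x hx
  exact ⟨l, hl, mem_sumVal_basisTermVal.1 hl'⟩

variable {ν : ∀ k n, Naming ((C k).X n)} {μ : ∀ k n, Naming ((D k).X n)}
  {r : ∀ k, Reduction (C k) (D k)}

lemma EffReduction.of_realizedBy {c : Γ → ReductionCodes} (hc : Computable c)
    (h : ∀ k, (r k).RealizedBy (ν k) (μ k) (c (code k))) :
    EffReduction code (fun k n => (ν k n).val) (fun k n => (μ k n).val) r where
  proj := .of_computes (computable_reductionCodes_proj.comp hc) fun k => (h k).proj
  incl := .of_computes (computable_reductionCodes_incl.comp hc) fun k => (h k).incl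
  htpy := .of_computes (μ := fun k n => ν k (n + 1)) (computable_reductionCodes_htpy.comp hc)
    fun k => (h k).htpy

lemma EffReduction.exists_realizedBy
    (h : EffReduction code (fun k n => (ν k n).val) (fun k n => (μ k n).val) r) :
    ∃ c : Γ → ReductionCodes, Computable c ∧
      ∀ k, (r k).RealizedBy (ν k) (μ k) (c (code k)) := by
  obtain ⟨c₁, hc₁, H₁⟩ := EffMap.exists_computes (f := fun k n x => (r k).projHom n x) h.proj
  obtain ⟨c₂, hc₂, H₂⟩ := EffMap.exists_computes (f := fun k n x => (r k).inclHom n x) h.incl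
  obtain ⟨c₃, hc₃, H₃⟩ := EffMap.exists_computes (μ := fun k n => ν k (n + 1))
    (f := fun k n x => (r k).htpyHom n x) h.htpy
  have hc : Computable fun x => (c₁ x, c₂ x, c₃ x) := by fun_prop
  exact ⟨fun x => ⟨c₁ x, c₂ x, c₃ x⟩,
    (Primrec.of_equiv_symm (e := ReductionCodes.equiv)).to_comp.comp hc,
    fun k => ⟨H₁ k, H₂ k, H₃ k⟩⟩

end

end Programs

/-! ### The effective structure of the bar construction -/

section BarBasis

lemma DFinsupp.basis_apply {ι : Type*} {R : Type*} {M : ι → Type*} [DecidableEq ι] [Semiring R]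
    [∀ i, AddCommMonoid (M i)] [∀ i, Module R (M i)] {η : ι → Type*}
    (b : ∀ i, Module.Basis (η i) R (M i)) (i : ι) (j : η i) :
    DFinsupp.basis b ⟨i, j⟩ = DFinsupp.single i (b i j) := by
  rw [Module.Basis.apply_eq_iff]
  change sigmaFinsuppEquivDFinsupp.symm _ = _
  rw [Equiv.symm_apply_eq, sigmaFinsuppEquivDFinsupp_single]
  change DFinsupp.mapRange (fun i => (b i).repr) (fun i => map_zero (b i).repr) _ = _
  rw [DFinsupp.mapRange_single, Module.Basis.repr_self]

open Encodable (encode decode)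

variable {G : Type u} [Group G] {N : ChainComplex (ModuleCat.{u} ℤ) ℕ}

open Classical in
/-- The basis of the bar module that consists of the `1 | l ⊗ b` for the members `b` of a basis
of `N`. -/
noncomputable def barBasis {ℓ : ℕ → Type*} (b : ∀ q, Module.Basis (ℓ q) ℤ (N.X q)) (n : ℕ) :
    Module.Basis (Σ p : {p : List G × ℕ // p.2 + p.1.length = n}, ℓ p.1.2) (MonoidAlgebra ℤ G)
      (BarModule G N n) :=
  DFinsupp.basis fun p => Algebra.TensorProduct.basis (MonoidAlgebra ℤ G) (b p.1.2)

lemma barBasis_apply {ℓ : ℕ → Type*} (b : ∀ q, Module.Basis (ℓ q) ℤ (N.X q)) {n : ℕ} (l : List G)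
    (q : ℕ) (h : q + l.length = n) (i : ℓ q) :
    barBasis b n ⟨⟨(l, q), h⟩, i⟩ = barTensor 1 l q h (b q i) := by
  classical
  have h1 : (MonoidAlgebra.of ℤ G 1 : MonoidAlgebra ℤ G) = 1 := map_one _
  rw [barBasis, barTensor, h1, DFinsupp.basis_apply]
  exact congrArg _ (Algebra.TensorProduct.basis_apply (b q) i)

variable [Primcodable G]

/-- The labels of the basis elements `1 | l ⊗ b` in degree `n`. -/
def barLabel (G : Type u) [Primcodable G] (EN : EffStructure N) (n : ℕ) : Set ℕ :=
  {i | ∃ (l : List G) (q b : ℕ), encode (l, q, b) = i ∧ q + l.length = n ∧ b ∈ EN.label q}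

/-- The labels in the bar construction correspond to pairs of a word and a label in `N`. -/
noncomputable def barLabelEquiv (G : Type u) [Primcodable G] (EN : EffStructure N) (n : ℕ) :
    (Σ p : {p : List G × ℕ // p.2 + p.1.length = n}, EN.label p.1.2) ≃ barLabel G EN n :=
  Equiv.ofBijective (fun x => ⟨encode (x.1.1.1, x.1.1.2, x.2.1),
      x.1.1.1, x.1.1.2, x.2.1, rfl, x.1.2, x.2.2⟩) (by
    constructor
    · rintro ⟨⟨⟨l, q⟩, h⟩, b, hb⟩ ⟨⟨⟨l', q'⟩, h'⟩, b', hb'⟩ hx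
      obtain ⟨rfl, rfl, rfl⟩ : l = l' ∧ q = q' ∧ b = b' := by
        simpa using Encodable.encode_injective (congrArg Subtype.val hx)
      rfl
    · rintro ⟨_, l, q, b, rfl, h, hb⟩
      exact ⟨⟨⟨(l, q), h⟩, b, hb⟩, rfl⟩)

variable {M : ChainComplex (ModuleCat.{u} (MonoidAlgebra ℤ G)) ℕ}
  {T : ChainComplex (ModuleCat.{u} ℤ) ℕ}

/-- The effective structure of the bar construction of a complex with an effective structure. -/
noncomputable def barStructure (L : Reduction T (underlying G M)) (r : Reduction T N)
    (EN : EffStructure N) : EffStructure (barComplex L r) where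
  name n :=
    { val := encodeVal (barVal (G := G) (fun q => (EN.name q).val) n)
      surj := fun w => by
        obtain ⟨l, hl⟩ := exists_mem_barVal (fun q => (EN.name q).surj) n w
        exact ⟨encode l, mem_encodeVal_encode.2 hl⟩ }
  label := barLabel G EN
  basis n := (barBasis EN.basis n).reindex (barLabelEquiv G EN n)

lemma barStructure_basis (L : Reduction T (underlying G M)) (r : Reduction T N)
    (EN : EffStructure N) {n : ℕ} (l : List G) (q b : ℕ) (h : q + l.length = n)
    (hb : b ∈ EN.label q) (hi : encode (l, q, b) ∈ barLabel G EN n) :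
    @Eq (BarModule G N n) ((barStructure L r EN).basis n ⟨encode (l, q, b), hi⟩)
      (barTensor 1 l q h (EN.basis q ⟨b, hb⟩)) := by
  have h1 : (⟨encode (l, q, b), hi⟩ : barLabel G EN n) =
      barLabelEquiv G EN n ⟨⟨(l, q), h⟩, b, hb⟩ := rfl
  have h2 : (barStructure L r EN).basis n ⟨encode (l, q, b), hi⟩ =
      (barBasis EN.basis n).reindex (barLabelEquiv G EN n) ⟨encode (l, q, b), hi⟩ := rfl
  rw [h2, h1, Module.Basis.reindex_apply, Equiv.symm_apply_apply, barBasis_apply]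

end BarBasis

section BarEffective

open Encodable (encode decode)

variable {G : Type u} [Group G] [Finite G] [Primcodable G] {Γ κ : Type*} [Primcodable Γ]
  {code : κ → Γ} {M : κ → ChainComplex (ModuleCat.{u} (MonoidAlgebra ℤ G)) ℕ}
  {T N : κ → ChainComplex (ModuleCat.{u} ℤ) ℕ} {L : ∀ k, Reduction (T k) (underlying G (M k))}
  {r : ∀ k, Reduction (T k) (N k)} {EN : ∀ k, EffStructure (N k)}

omit [Finite G] in
lemma effMap_barGen (hgen : EffMap (degCode code) (fun k => labelVal ((EN k.1).label k.2))
      (fun k => nameVal EN k.1 k.2) fun k i => (EN k.1).basis k.2 i) :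
    EffMap (degCode code) (fun k => labelVal (barLabel G (EN k.1) k.2)) (barVals G (nameVal EN))
      fun k i => (barStructure (L k.1) (r k.1) (EN k.1)).basis k.2 i := by
  obtain ⟨p, hp, Hp⟩ := hgen
  have h1 : Computable fun x : (Γ × ℕ) × ℕ => (decode x.2 : Option (List G × ℕ × ℕ)) :=
    Computable.decode.comp Computable.snd
  have h2 : Computable fun x : ((Γ × ℕ) × ℕ) × List G × ℕ × ℕ => ((x.1.1.1, x.2.2.1), x.2.2.2) := by
    fun_prop
  have h3 : Computable fun x : (((Γ × ℕ) × ℕ) × List G × ℕ × ℕ) × ℕ =>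
      [((1, 1, x.1.2.1, x.1.2.2.1, x.2) : BarToken G)] := by
    fun_prop
  have h4 : Partrec₂ fun (x : (Γ × ℕ) × ℕ) (y : List G × ℕ × ℕ) =>
      (p ((x.1.1, y.2.1), y.2.2)).map fun a => [((1, 1, y.1, y.2.1, a) : BarToken G)] :=
    (hp.comp h2).map h3.to₂
  refine ⟨_, (Computable.ofOption h1).bind h4, ?_⟩
  rintro ⟨k, n⟩ _ ⟨i, l, q, b, rfl, h, hb⟩ hx
  obtain rfl := mem_labelVal.1 hx
  obtain ⟨a, ha, ha'⟩ := Hp (k, q) b ⟨b, hb⟩ (mem_labelVal.2 rfl)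
  refine ⟨[(1, 1, l, q, a)], Part.mem_bind (a := (l, q, b)) (by simp) (Part.mem_map _ ha), ?_⟩
  have h5 := barTensor_mem_barVal (G := G) (ν := nameVal EN k) 1 l q h ha'
  rw [← barStructure_basis (L k) (r k) (EN k) l q b h hb ⟨l, q, b, rfl, h, hb⟩] at h5
  exact h5

omit [Finite G] in
lemma effMap_barCoord (hcoord : EffMap (degCode code) (fun k => nameVal EN k.1 k.2)
      (fun k => sumVal (basisTermVal (EN k.1) Naming.int k.2)) fun _ x => x) :
    EffMap (degCode code) (barVals G (nameVal EN))
      (fun k => sumVal (basisTermVal (barStructure (L k.1) (r k.1) (EN k.1))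
        (Naming.groupRing G) k.2)) fun _ x => x := by
  refine EffAdd.effMap_barVal (κ := κ × ℕ) (N := fun k => N k.1) (n := fun k => k.2)
    (P := fun k => BarModule G (N k.1) k.2)
    (effAdd_sumVal _) (fun k => AddMonoidHom.id _) ?_
  have h1 := hcoord.reindex (code' := tokenCode (G := G) (degCode code) (fun k : κ × ℕ => k.2))
    (fun t => (t.1.1.1, t.1.2.2.2.2)) (fun x => (x.1.1, x.2.2.2.2)) (by fun_prop) fun _ => rfl
  suffices h2 : EffMap _ _ _ _ from (EffAdd.effMap_sumVal (effAdd_sumVal _)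
    (fun t : TokenIndex G (fun k : κ × ℕ => k.2) =>
      (DistribSMul.toAddMonoidHom (BarModule G (N t.1.1.1) t.1.1.2) t.1.2.1).comp
        (barTensorHom t.1.2.2.1 t.1.2.2.2.1 t.1.2.2.2.2 t.2)) h2).comp h1
  refine .of_computable (fun x => [(encode [(x.1.2.1 * Denumerable.ofNat ℤ x.2.1, x.1.2.2.1)],
    encode (x.1.2.2.2.1, x.1.2.2.2.2, x.2.2))]) ?_ ?_
  · have h2 : Computable fun x : ((Γ × ℕ) × ℤ × G × List G × ℕ) × ℕ × ℕ =>
        x.1.2.1 * Denumerable.ofNat ℤ x.2.1 :=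
      Computable.intMul (by fun_prop) ((Computable.ofNat ℤ).comp (by fun_prop))
    fun_prop
  · rintro ⟨⟨⟨k, n⟩, z, g, l, q⟩, h⟩ ⟨a, b⟩ x hx
    obtain ⟨z', hz', hb, rfl⟩ := mem_basisTermVal.1 hx
    have hz : z' = Denumerable.ofNat ℤ a := by
      have : Encodable.decode a = some z' := by simpa [Naming.int, eq_comm] using hz'
      rw [Denumerable.decode_eq_ofNat] at this
      exact (Option.some.inj this).symm
    refine mem_sumVal_singleton.2 (mem_basisTermVal.2 ⟨MonoidAlgebra.single g (z * z'), ?_,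
      ⟨l, q, b, rfl, h, hb⟩, ?_⟩)
    · rw [mem_groupRing_val, mem_encodeVal_encode, mem_sumVal_singleton, ← hz]
      exact Part.mem_some _
    · have h5 := barStructure_basis (L k) (r k) (EN k) l q b h hb ⟨l, q, b, rfl, h, hb⟩
      refine Eq.trans ?_ (congrArg (fun y : BarModule G (N k) n =>
        MonoidAlgebra.single g (z * z') • y) h5.symm)
      refine (congrArg _ (int_smul_eq_zsmul (inferInstance : Module ℤ ((N k).X q)) z'
        ((EN k).basis q ⟨b, hb⟩))).trans ?_
      rw [map_zsmul]
      have h7 : ∀ y : BarModule G (N k) n, MonoidAlgebra.single g (z * z') • y =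
          z' • z • mulAct g y := fun y =>
        (single_smul_eq (P := BarModule G (N k) n) g (z * z') y).trans
          (by rw [mul_comm, mul_smul])
      refine Eq.trans ?_ (h7 _).symm
      rw [mulAct_barTensor, mul_one]
      rfl

/-- The bar construction is locally effective. -/
lemma effComplex_barStructure
    (hD : EffMap (degCode code) (barVals G (nameVal EN))
      (fun k => barVal (G := G) (nameVal EN k.1) (k.2 - 1))
      fun k x => barD (L k.1) (r k.1) k.2 x)
    (hN : EffComplex code Naming.int EN) :
    EffComplex code (Naming.groupRing G) fun k => barStructure (L k) (r k) (EN k) where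
  add := by
    have h := (effGroup_barVal (G := G) (code := degCode code) (fun k => nameVal EN k.1)
      (fun k => k.2)).toEffAdd.encode
    exact h
  smul := by
    have h := (effGroup_barVal (G := G) (code := degCode code) (fun k => nameVal EN k.1)
      (fun k => k.2)).effMap_smul (effMap_mulAct (code := degCode code)
        (ν := fun k : κ × ℕ => nameVal EN k.1) (n := fun k => k.2))
    have h2 := EffMap.encodeName.comp (h.comp (EffMap.id.prodMap EffMap.decodeName))
    exact h2
  diff := by
    have h := EffMap.encodeName.comp (hD.comp EffMap.decodeName)
    have h2 : ∀ (k : κ × ℕ) (x : BarModule G (N k.1) k.2), barD (L k.1) (r k.1) k.2 x =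
        dHom (barComplex (L k.1) (r k.1)) k.2 x := by
      rintro ⟨k, n⟩ x
      cases n with
      | zero =>
        rw [barD_zero]
        exact (congrArg (fun f => f.hom x)
          ((barComplex (L k) (r k)).shape 0 (0 - 1) (by simp))).symm
      | succ n => exact (barComplex_d (L k) (r k) n x).symm
    simp only [h2] at h
    exact h
  gen := EffMap.encodeName.comp (effMap_barGen (L := L) (r := r) hN.gen)
  coord := (effMap_barCoord (L := L) (r := r) hN.coord).comp EffMap.decodeName

end BarEffective

/-! ### Computability of the resolution of the given complex -/

section OfBasis

variable {Γ Γ' β κ κ' : Type*} [Primcodable Γ] [Primcodable Γ'] [Primcodable β] {code : κ → Γ}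
  {code' : κ' → Γ'} {R : Type*} [Ring R] {C : κ → ChainComplex (ModuleCat.{u} R) ℕ}
  {ρ : Naming R} {E : ∀ k, EffStructure (C k)}

/-- A linear map on a locally effective complex is computable if its values on the basis elements
are. -/
lemma EffComplex.effMap_of_basis (hE : EffComplex code ρ E) (e : κ' → κ × ℕ) (ε : Γ' → Γ × ℕ)
    (hε : Computable ε) (he : ∀ k, degCode code (e k) = ε (code' k)) {Y : κ' → Type*}
    [∀ k, AddCommGroup (Y k)] [∀ k, Module R (Y k)] {μ : ∀ k, β →. Y k} (hadd : EffAdd code' μ)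
    (hsmul : EffMap code' (fun k => prodVal ρ.val (μ k)) μ fun _ x => x.1 • x.2)
    (f : ∀ k, (C (e k).1).X (e k).2 →ₗ[R] Y k)
    (hf : EffMap code' (fun k => labelVal ((E (e k).1).label (e k).2)) μ
      fun k i => f k ((E (e k).1).basis (e k).2 i)) :
    EffMap code' (fun k => nameVal E (e k).1 (e k).2) μ fun k x => f k x := by
  have h1 := hE.coord.reindex (code' := code') e ε hε he
  refine (hadd.effMap_sumVal (fun k => (f k).toAddMonoidHom) ?_).comp h1
  obtain ⟨p, hp, Hp⟩ := hsmul.comp ((EffMap.id (ν := fun _ => ρ.val)).prodMap hf)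
  refine ⟨p, hp, fun k t x hx => ?_⟩
  obtain ⟨s, hs, h, rfl⟩ := mem_basisTermVal.1 hx
  obtain ⟨b, hb, hb'⟩ := Hp k t (s, ⟨t.2, h⟩) (mem_prodVal.2 ⟨hs, mem_labelVal.2 rfl⟩)
  refine ⟨b, hb, ?_⟩
  have h2 : f k (s • (E (e k).1).basis (e k).2 ⟨t.2, h⟩) =
      s • f k ((E (e k).1).basis (e k).2 ⟨t.2, h⟩) := map_smul _ _ _
  have h3 : f k (s • (E (e k).1).basis (e k).2 ⟨t.2, h⟩) ∈ μ k b := by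
    rw [h2]
    exact hb'
  exact h3

end OfBasis

section Resolution

variable {G : Type u} [Group G] [Primcodable G] {Γ κ : Type*} [Primcodable Γ]
  {code : κ → Γ} {M : κ → ChainComplex (ModuleCat.{u} (MonoidAlgebra ℤ G)) ℕ}
  {T : κ → ChainComplex (ModuleCat.{u} ℤ) ℕ} {L : ∀ k, Reduction (T k) (underlying G (M k))}
  {EM : ∀ k, EffStructure (M k)} {νT : ∀ k q, ℕ →. (T k).X q}

open Encodable (encode)

/-- The names of the elements of a complex, as elements of the underlying complex. -/
noncomputable abbrev underlyingVal (EM : ∀ k, EffStructure (M k)) :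
    ∀ k q, ℕ →. (underlying G (M k)).X q :=
  fun k q => ((EM k).name q).val

lemma Naming.int_cast_mem (z : ℤ) : ((z : ℤ) : ℤ) ∈ Naming.int.val (encode z) := by
  change z ∈ ((Encodable.decode (encode z) : Option ℤ) : Part ℤ)
  rw [Encodable.encodek]
  exact Part.mem_some z

lemma Naming.groupRing_single_mem (z : ℤ) (g : G) :
    (MonoidAlgebra.single g z : MonoidAlgebra ℤ G) ∈
      (Naming.groupRing G).val (encode [(z, g)]) := by
  rw [mem_groupRing_val, mem_encodeVal_encode, mem_sumVal_singleton]
  exact Part.mem_some _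

lemma EffComplex.group_int {N : κ → ChainComplex (ModuleCat.{u} ℤ) ℕ}
    {EN : ∀ k, EffStructure (N k)} (h : EffComplex code Naming.int EN) :
    EffGroup (degCode code) fun k => nameVal EN k.1 k.2 :=
  h.group (i := fun z => encode z) Computable.encode Naming.int_cast_mem

/-- The action of `G` is computed as scalar multiplication by the elements `1 • g` of the group
ring. -/
lemma EffComplex.effAct (h : EffComplex code (Naming.groupRing G) EM) :
    EffAct code (underlyingVal EM) := by
  have h1 := h.smul.reindex (code' := fun k : (κ × ℕ) × G => (degCode code k.1, k.2))
    Prod.fst Prod.fst Computable.fst fun _ => rfl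
  have h2 : EffMap (fun k : (κ × ℕ) × G => (degCode code k.1, k.2))
      (fun k => nameVal EM k.1.1 k.1.2)
      (fun k => prodVal (Naming.groupRing G).val (nameVal EM k.1.1 k.1.2))
      fun k x => (MonoidAlgebra.single k.2 1, x) :=
    .of_computable (fun x => (encode [((1 : ℤ), x.1.2)], x.2)) (by fun_prop) fun k a x hx =>
      mem_prodVal.2 ⟨Naming.groupRing_single_mem _ _, hx⟩
  have h3 := h1.comp h2
  exact h3

lemma EffComplex.effDiff_underlying (h : EffComplex code (Naming.groupRing G) EM) :
    EffDiff code (underlyingVal EM) := by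
  have h1 := h.diff
  exact h1

variable [Finite G] (hM : EffComplex code (Naming.groupRing G) EM)

include hM

/-- The section in degree `n + 1` is computed from a program for it in degree `n`: expand the
argument in the basis and use the recursion on the basis elements. -/
lemma effMap_barSection_succ {Γ' κ' : Type*} [Primcodable Γ'] {code' : κ' → Γ'} (e : κ' → κ × ℕ)
    (ε : Γ' → Γ × ℕ) (hε : Computable ε) (he : ∀ k, degCode code (e k) = ε (code' k))
    (hσ : EffMap code' (fun k => underlyingVal EM (e k).1 (e k).2)
      (fun k => barVal (G := G) (underlyingVal EM (e k).1) (e k).2)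
      fun k x => barSection (EM (e k).1).basis (e k).2 x) :
    EffMap code' (fun k => underlyingVal EM (e k).1 ((e k).2 + 1))
      (fun k => barVal (G := G) (underlyingVal EM (e k).1) ((e k).2 + 1))
      fun k x => barSection (EM (e k).1).basis ((e k).2 + 1) x := by
  have hc : Computable fun x : Γ' => ((ε x).1, (ε x).2 + 1) := by fun_prop
  have he' : ∀ k, degCode code ((e k).1, (e k).2 + 1) = ((ε (code' k)).1, (ε (code' k)).2 + 1) :=
    fun k => by rw [← he]
  have hg := hM.gen.reindex (code' := code') (fun k => ((e k).1, (e k).2 + 1)) _ hc he'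
  have hd := hM.diff.reindex (code' := code') (fun k => ((e k).1, (e k).2 + 1)) _ hc he'
  have hι := (effMap_barι (G := G) (code := code) (ν := underlyingVal EM)).reindex
    (code' := code') (fun k => ((e k).1, (e k).2 + 1)) _ hc he'
  have hs := effMap_barS (G := G) (code := code') (ν := fun k => underlyingVal EM (e k).1)
    (n := fun k => (e k).2)
  have hB := effGroup_barVal (G := G) (code := code') (fun k => underlyingVal EM (e k).1)
    (fun k => (e k).2 + 1)
  refine hM.effMap_of_basis (fun k => ((e k).1, (e k).2 + 1)) _ hc he'
    (Y := fun k => BarModule G (underlying G (M (e k).1)) ((e k).2 + 1)) hB.toEffAdd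
    (hB.effMap_smul (effMap_mulAct (code := code') (ν := fun k => underlyingVal EM (e k).1)
      (n := fun k => (e k).2 + 1)))
    (fun k => barSection (EM (e k).1).basis ((e k).2 + 1)) ?_
  simp only [barSection_basis]
  exact hB.add (hι.comp hg) (hs.comp (hσ.comp (hd.comp hg)))

lemma effMap_barSection : EffMap (degCode code) (fun k => underlyingVal EM k.1 k.2)
    (barVals G (underlyingVal EM)) fun k x => barSection (EM k.1).basis k.2 x := by
  refine EffMap.natRec (X := fun k : κ × ℕ => (M k.1).X k.2)
    (Y := fun k => BarModule G (underlying G (M k.1)) k.2) ?_ ?_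
  · have hg := hM.gen.reindex (code' := code) (fun k => (k, 0)) (fun x => (x, 0)) (by fun_prop)
      fun _ => rfl
    have hι := (effMap_barι (G := G) (code := code) (ν := underlyingVal EM)).reindex
      (code' := code) (fun k => (k, 0)) (fun x => (x, 0)) (by fun_prop) fun _ => rfl
    have hB := effGroup_barVal (G := G) (code := code) (underlyingVal EM) (fun _ => 0)
    refine hM.effMap_of_basis (fun k => (k, 0)) (fun x => (x, 0)) (by fun_prop) (fun _ => rfl)
      (Y := fun k => BarModule G (underlying G (M k)) 0) hB.toEffAdd
      (hB.effMap_smul (effMap_mulAct (code := code) (ν := underlyingVal EM) (n := fun _ => 0)))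
      (fun k => barSection (EM k).basis 0) ?_
    have h : ∀ k (i : (EM k).label 0), barSection (EM k).basis 0 ((EM k).basis 0 i) =
        barUnit (M k) 0 ((EM k).basis 0 i) := fun k i => by
      rw [barSection_basis, barSPred_zero, AddMonoidHom.zero_apply, add_zero]
    simp only [h]
    exact hι.comp hg
  · have hc : Computable fun x : (Γ × ℕ) × Nat.Partrec.Code => x.1 := by fun_prop
    exact effMap_barSection_succ hM (κ' := Programmed
      (fun k : κ × ℕ => underlyingVal EM k.1 k.2) (barVals G (underlyingVal EM))
      fun k x => barSection (EM k.1).basis k.2 x) (fun k => k.1.1) _ hc (fun _ => rfl)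
      (EffMap.programmed (degCode code) (fun k => underlyingVal EM k.1 k.2)
        (barVals G (underlyingVal EM)) fun k x => barSection (EM k.1).basis k.2 x)

lemma effMap_barContr : EffMap (degCode code) (barVals G (underlyingVal EM))
    (fun k => barVal (G := G) (underlyingVal EM k.1) (k.2 + 1))
    fun k x => barContr (EM k.1).basis k.2 x := by
  have hP := effGroup_barVal (G := G) (code := degCode code) (fun k : κ × ℕ => underlyingVal EM k.1)
    (fun k => k.2 + 1)
  have hP' := effGroup_barVal (G := G) (code := degCode code) (fun k => underlyingVal EM k.1)
    (fun k => k.2 + 1 + 1)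
  have hs := effMap_barS (G := G) (code := degCode code) (ν := fun k => underlyingVal EM k.1)
    (n := fun k => k.2)
  have hs' := effMap_barS (G := G) (code := degCode code) (ν := fun k => underlyingVal EM k.1)
    (n := fun k => k.2 + 1)
  have ha := hP.neg (hs.comp (effMap_barSection hM))
  exact effMap_barRec (P := fun k n => BarModule G (underlying G (M k)) (n + 1))
    (μ := fun k n => barVal (underlyingVal EM k) (n + 1)) (act := fun _ _ => mulAct)
    (a := fun k n => -(barS G (underlying G (M k)) n).comp (barSectionHom (EM k).basis n))
    (t := fun k n => -barS G (underlying G (M k)) (n + 1)) (v := 0) hP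
    (effMap_mulAct (code := degCode code) (ν := fun k : κ × ℕ => underlyingVal EM k.1)
      (n := fun k => k.2 + 1)) ha (hP'.neg hs') (.const hP'.zero)

variable (hT : EffGroup (degCode code) fun k => νT k.1 k.2)
  (hL : EffReduction code νT (underlyingVal EM) L)

include hT hL

lemma effMap_barContrAux : EffMap (degCode code) (barVals G (underlyingVal EM))
    (fun k => barVal (G := G) (underlyingVal EM k.1) (k.2 + 1))
    fun k x => barContrAux (L k.1) (EM k.1).basis k.2 x := by
  have h := (effMap_barContr hM).comp ((effGroup_barVal _ _).sub .id
    ((effMap_barSection hM).comp (effMap_barE hT hL hM.effAct hL)))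
  exact h

/-- The reduction of the bar construction of `M` to `M` is computable. -/
lemma effReduction_barResolution : EffReduction code
    (C := fun k => barComplex (L k) (L k)) (D := M)
    (fun k => barVal (G := G) (underlyingVal EM k)) (nameVal EM)
    fun k => barResolution (L k) (EM k).basis where
  proj := by
    have h := effMap_barE hT hL hM.effAct hL
    exact h
  incl := effMap_barSection hM
  htpy := by
    have h1 := effMap_barContrAux hM hT hL
    have h2 := EffMap.succ (ν := fun k n => barVal (G := G) (underlyingVal EM k) n)
      (μ := fun k n => barVal (G := G) (underlyingVal EM k) (n - 1))
      (f := fun k n x => barD (L k) (L k) n x)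
      (effMap_barD hT hL hM.effAct hL hM.effDiff_underlying)
    have h3 := h1.comp (h2.comp h1)
    have h4 : ∀ (k : κ × ℕ) (x : BarModule G (underlying G (M k.1)) k.2),
        barContrAux (L k.1) (EM k.1).basis k.2 (barD (L k.1) (L k.1) (k.2 + 1)
          (barContrAux (L k.1) (EM k.1).basis k.2 x)) =
        (barResolution (L k.1) (EM k.1).basis).htpyHom k.2 x :=
      fun k x => (barResolution_htpyHom _ _ _ _).symm
    simp only [h4] at h3
    exact h3

end Resolution

/-! ### Assembling the algorithm -/

section EncodedReductions

variable {Γ α β κ : Type*} [Primcodable Γ] [Primcodable α] [Primcodable β] {code : κ → Γ}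
  {R : Type*} [Ring R] {C D : κ → ChainComplex (ModuleCat.{u} R) ℕ} {ν : ∀ k q, α →. (C k).X q}
  {μ : ∀ k q, β →. (D k).X q} {r : ∀ k, Reduction (C k) (D k)}

lemma EffReduction.encode_source (h : EffReduction code ν μ r) :
    EffReduction code (fun k q => encodeVal (ν k q)) μ r where
  proj := h.proj.comp EffMap.decodeName
  incl := EffMap.encodeName.comp h.incl
  htpy := EffMap.encodeName.comp (h.htpy.comp EffMap.decodeName)

lemma EffReduction.encode_target (h : EffReduction code ν μ r) :
    EffReduction code ν (fun k q => encodeVal (μ k q)) r where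
  proj := EffMap.encodeName.comp h.proj
  incl := h.incl.comp EffMap.decodeName
  htpy := h.htpy

end EncodedReductions

lemma computable_spanCodes_equiv_symm : Computable SpanCodes.equiv.symm := by
  have h := Primrec.of_equiv_symm (e := SpanCodes.equiv)
  exact h.to_comp

/-- A locally effective strong equivalence between a complex of free `ℤ[G]`-modules and a complex
of free abelian groups, with all its programs: an input of the algorithm. -/
structure EffectiveSpan (G : Type u) [Group G] [Primcodable G] where
  M : ChainComplex (ModuleCat.{u} (MonoidAlgebra ℤ G)) ℕ
  EM : EffStructure M
  T : ChainComplex (ModuleCat.{u} ℤ) ℕ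
  N : ChainComplex (ModuleCat.{u} ℤ) ℕ
  ET : EffStructure T
  EN : EffStructure N
  L : Reduction T (underlying G M)
  r : Reduction T N
  sourceCodes : ComplexCodes
  spanCodes : SpanCodes
  realizes_source : EM.RealizedBy (Naming.groupRing G) sourceCodes
  realizes_mid : ET.RealizedBy Naming.int spanCodes.mid
  realizes_target : EN.RealizedBy Naming.int spanCodes.target
  realizes_left : L.RealizedBy ET.name EM.name spanCodes.left
  realizes_right : r.RealizedBy ET.name EN.name spanCodes.right

namespace EffectiveSpan

variable {G : Type u} [Group G] [Primcodable G]

/-- The programs of the input. -/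
def codes (k : EffectiveSpan G) : ComplexCodes × SpanCodes := (k.sourceCodes, k.spanCodes)

lemma effComplex_source :
    EffComplex codes (Naming.groupRing G) fun k : EffectiveSpan G => k.EM :=
  .of_realizedBy Computable.fst realizes_source

lemma effComplex_mid : EffComplex codes Naming.int fun k : EffectiveSpan G => k.ET :=
  .of_realizedBy (computable_spanCodes_mid.comp Computable.snd) realizes_mid

lemma effComplex_target : EffComplex codes Naming.int fun k : EffectiveSpan G => k.EN :=
  .of_realizedBy (computable_spanCodes_target.comp Computable.snd) realizes_target

lemma effReduction_left : EffReduction codes (nameVal fun k : EffectiveSpan G => k.ET)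
    (underlyingVal fun k => k.EM) fun k => k.L := by
  have h (k : EffectiveSpan G) := k.realizes_left
  have h2 := EffReduction.of_realizedBy (code := codes (G := G))
    (D := fun k => underlying G k.M) (ν := fun k => k.ET.name)
    (μ := fun k => k.EM.name) (computable_spanCodes_left.comp Computable.snd) h
  exact h2

lemma effReduction_right : EffReduction codes (nameVal fun k : EffectiveSpan G => k.ET)
    (nameVal fun k => k.EN) fun k => k.r :=
  .of_realizedBy (computable_spanCodes_right.comp Computable.snd) realizes_right

variable [Finite G]

lemma effComplex_barStructure_mid : EffComplex codes (Naming.groupRing G)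
    fun k : EffectiveSpan G => barStructure k.L (Reduction.refl k.T) k.ET := by
  have h1 := EffReduction.refl (effComplex_mid (G := G)).group_int
  have h2 := effMap_barD (effComplex_mid (G := G)).group_int effReduction_left
    effComplex_source.effAct h1 effComplex_mid.diff
  exact effComplex_barStructure (r := fun k : EffectiveSpan G => Reduction.refl k.T) h2
    effComplex_mid

lemma effComplex_barStructure_target : EffComplex codes (Naming.groupRing G)
    fun k : EffectiveSpan G => barStructure k.L k.r k.EN :=
  effComplex_barStructure (effMap_barD effComplex_mid.group_int effReduction_left
    effComplex_source.effAct effReduction_right effComplex_target.diff) effComplex_target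

/-- The `ℤ[G]`-linear reduction of the bar construction of the middle complex to `M`. -/
noncomputable def barLeft (k : EffectiveSpan G) :
    Reduction (barComplex k.L (Reduction.refl k.T)) k.M :=
  (barReduction k.L k.L).trans (barResolution k.L k.EM.basis)

lemma effReduction_barLeft : EffReduction codes
    (nameVal fun k : EffectiveSpan G => barStructure k.L (Reduction.refl k.T) k.ET)
    (nameVal fun k => k.EM) barLeft := by
  have h1 := effReduction_barReduction effComplex_mid.group_int (effReduction_left (G := G))
    effComplex_source.effAct effReduction_left
  have h2 := effReduction_barResolution effComplex_source effComplex_mid.group_int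
    (effReduction_left (G := G))
  exact ((h1.trans (effGroup_barVal _ _) h2).encode_source)

lemma effReduction_barRight : EffReduction codes
    (nameVal fun k : EffectiveSpan G => barStructure k.L (Reduction.refl k.T) k.ET)
    (nameVal fun k => barStructure k.L k.r k.EN) fun k => barReduction k.L k.r :=
  (effReduction_barReduction effComplex_mid.group_int effReduction_left
    effComplex_source.effAct effReduction_right).encode_source.encode_target

/-- The algorithm on the level of programs, for inputs with their certificates. -/
lemma exists_spanCodes : ∃ c : ComplexCodes × SpanCodes → SpanCodes, Computable c ∧
    ∀ k : EffectiveSpan G,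
      (barStructure k.L (Reduction.refl k.T) k.ET).RealizedBy (Naming.groupRing G)
        (c k.codes).mid ∧
      (barStructure k.L k.r k.EN).RealizedBy (Naming.groupRing G) (c k.codes).target ∧
      k.barLeft.RealizedBy (barStructure k.L (Reduction.refl k.T) k.ET).name k.EM.name
        (c k.codes).left ∧
      (barReduction k.L k.r).RealizedBy (barStructure k.L (Reduction.refl k.T) k.ET).name
        (barStructure k.L k.r k.EN).name (c k.codes).right := by
  obtain ⟨c₁, hc₁, H₁⟩ := (effComplex_barStructure_mid (G := G)).exists_realizedBy
  obtain ⟨c₂, hc₂, H₂⟩ := (effComplex_barStructure_target (G := G)).exists_realizedBy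
  obtain ⟨c₃, hc₃, H₃⟩ := (effReduction_barLeft (G := G)).exists_realizedBy
  obtain ⟨c₄, hc₄, H₄⟩ := (effReduction_barRight (G := G)).exists_realizedBy
  have hc : Computable fun x => (c₁ x, c₂ x, c₃ x, c₄ x) := by fun_prop
  have he : Computable SpanCodes.equiv.symm := computable_spanCodes_equiv_symm
  have hF : Computable fun x => SpanCodes.equiv.symm (c₁ x, c₂ x, c₃ x, c₄ x) := he.comp hc
  exact ⟨fun x => SpanCodes.equiv.symm (c₁ x, c₂ x, c₃ x, c₄ x), hF,
    fun k => ⟨H₁ k, H₂ k, H₃ k, H₄ k⟩⟩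

end EffectiveSpan

theorem theorem1 (G : Type u) [Group G] [Finite G] [Primcodable G] :
    ∃ F : ComplexCodes → SpanCodes → SpanCodes, Computable₂ F ∧
      ∀ (M : ChainComplex (ModuleCat.{u} (MonoidAlgebra ℤ G)) ℕ) (EM : EffStructure M)
        (T N : ChainComplex (ModuleCat.{u} ℤ) ℕ) (ET : EffStructure T) (EN : EffStructure N)
        (L : Reduction T (underlying G M)) (r : Reduction T N)
        (cM : ComplexCodes) (c : SpanCodes),
        EM.RealizedBy (Naming.groupRing G) cM →
        ET.RealizedBy Naming.int c.mid →
        EN.RealizedBy Naming.int c.target →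
        L.RealizedBy ET.name EM.name c.left →
        r.RealizedBy ET.name EN.name c.right →
        ∃ (T' N' : ChainComplex (ModuleCat.{u} (MonoidAlgebra ℤ G)) ℕ)
          (ET' : EffStructure T') (EN' : EffStructure N')
          (L' : Reduction T' M) (r' : Reduction T' N'),
          ET'.RealizedBy (Naming.groupRing G) (F cM c).mid ∧
          EN'.RealizedBy (Naming.groupRing G) (F cM c).target ∧
          L'.RealizedBy ET'.name EM.name (F cM c).left ∧
          r'.RealizedBy ET'.name EN'.name (F cM c).right ∧
          IsBarConstruction L r N' ∧
          (LocallyFiniteComplex N → LocallyFiniteComplex N') := by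
  obtain ⟨F, hF, H⟩ := EffectiveSpan.exists_spanCodes (G := G)
  refine ⟨fun cM c => F (cM, c), hF.to₂, ?_⟩
  intro M EM T N ET EN L r cM c h₁ h₂ h₃ h₄ h₅
  obtain ⟨H₁, H₂, H₃, H₄⟩ := H ⟨M, EM, T, N, ET, EN, L, r, cM, c, h₁, h₂, h₃, h₄, h₅⟩
  exact ⟨barComplex L (Reduction.refl T), barComplex L r, barStructure L (Reduction.refl T) ET,
    barStructure L r EN, EffectiveSpan.barLeft
      ⟨M, EM, T, N, ET, EN, L, r, cM, c, h₁, h₂, h₃, h₄, h₅⟩, barReduction L r,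
    H₁, H₂, H₃, H₄, isBarConstruction_barComplex L r, locallyFiniteComplex_barComplex L r⟩
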